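/- Let $n\ge 1$, let $0<\rho_1<\dots<\rho_n<1$ be real numbers and let $C>0$. With $\theta=t\,\frac{d}{dt}$ and the Pochhammer symbol $(a)_k=a(a+1)\cdots(a+k-1)$, consider the hypergeometric differential equation $$\big[\theta^n-C\,t\,(\theta+\rho_1)\cdots(\theta+\rho_n)\big]F(t)=0 .\qquad(*)$$ Put $f(\epsilon,t)=t^{\epsilon}\sum_{k\ge 0}\frac{(\rho_1+\epsilon)_k\cdots(\rho_n+\epsilon)_k}{((1+\epsilon)_k)^n}\,t^k$ and define, for $0<|t|<1/C$ and $m=0,\dots,n-1$, $$\tilde f_m(t)=\frac{1}{(2\pi i)^m\,m!}\left.\frac{\partial^m}{\partial\epsilon^m}\right|_{\epsilon=0}\Big[C^{-\epsilon}f(\epsilon,Ct)\Big].$$ For $|t|>1/C$ and $r=1,\dots,n$ define $\tilde F_r(t)=F_r(Ct)$, where $$F_r(t)=A_r\,t^{-\rho_r}\;{}_nF_{n-1}\!\left(\begin{matrix}\rho_r,\ \dots,\ \rho_r\\ (1+\rho_r-\rho_i)_{i\ne r}\end{matrix}\,\Big|\,\frac1t\right),\qquad A_r=e^{-\pi i\rho_r}\prod_{i\ne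 r}\frac{\Gamma(\rho_i-\rho_r)}{\Gamma(\rho_i)\,\Gamma(1-\rho_r)} .$$ Powers of $t$ are taken with their principal branches. Here $(1+\rho_r-\rho_i)_{i\ne r}$ denotes the list of the $n-1$ lower parameters. Let $$B_k(\epsilon)=e^{-\pi i\epsilon}\left[\prod_{i=1}^n\frac{\Gamma(\rho_i)\,\Gamma(1+\epsilon)}{\Gamma(\rho_i+\epsilon)}\right]\frac{\sin(\pi\rho_k)}{\sin(\pi\rho_k+\pi\epsilon)} .$$ Write $\tilde{\mathbf f}=(\tilde f_{n-1},\dots,\tilde f_0)^t$ and $\tilde{\mathbf F}=(\tilde F_n,\dots,\tilde F_1)^t$. Let $\mathsf m_0$ be the upper triangular $n\times n$ matrix with entries $1/(l-i)!$ for $i\le l$, and let $\mathsf M_\infty=\operatorname{diag}(e^{-2\pi i\rho_n},\dots,e^{-2\pi i\rho_1})$. Let $\tilde{\mathsf P}$ be the $n\times n$ matrix with entries $$\tilde{\mathsf P}_{n-j,\,n+1-k}=\frac{1}{(2\pi i)^j\,j!}\left.\frac{\partial^j}{\partial\epsilon^j}\right|_{\epsilon=0}\Big[C^{-\epsilon}B_k(\epsilon)\Big]\qquad(0\le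 j\le n-1,\ 1\le k\le n).$$ Then the entries of $\tilde{\mathbf f}$ on $\{0<|t|<1/C\}$ cut along the negative real axis, and the entries of $\tilde{\mathbf F}$ on $\{|t|>1/C\}$ cut along the negative real axis, are $n$ linearly independent analytic solutions of $(*)$, and $\tilde{\mathsf P}$ is invertible. Moreover, let $0<t_0<1/C<R$ and let $\delta$ be any path from $t_0$ to $R$ whose interior lies in the lower half-plane. Then: 1. $\tilde{\mathsf P}$ is the transition matrix: analytic continuation of $\tilde{\mathbf f}$ along $\delta$ gives $\tilde{\mathbf f}=\tilde{\mathsf P}\cdot\tilde{\mathbf F}$ near $R$. (For $C=1$ this is the transition matrix for the unscaled equation.) 2. Continuation of $\tilde{\mathbf f}$ along the counterclockwise circle about $0$ through $t_0$ gives $\mathsf m_0\tilde{\mathbf f}$, and continuation of $\tilde{\mathbf F}$ along the counterclockwise circle about $0$ through $R$ gives $\mathsf M_\infty\tilde{\mathbf F}$. 3. The monodromy of $\tilde{\mathbf f}$ around $t=\infty$, that is, along $\delta$, then once counterclockwise along the circle $|t|=R$, then back along $\delta$, is $\mathsf m_\infty=\tilde{\mathsf P}\cdot\mathsf M_\infty\cdot\tilde{\mathsf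 P}^{-1}$. 4. The monodromy of $\tilde{\mathbf f}$ around $t=1/C$, that is, once counterclockwise along the circle about $1/C$ through $t_0$, is $\mathsf m_{1/C}=\mathsf m_\infty\cdot\mathsf m_0^{-1}$. -/

import Mathlib

open scoped Topology Nat
open Matrix

noncomputable section

namespace HypergeometricMonodromy

/-- The generalized hypergeometric series
`∑ₖ (∏ᵢ (aᵢ)ₖ / ∏ⱼ (bⱼ)ₖ) zᵏ / k!`, with upper parameters `a` and lower parameters `b`. -/
def hypergeometricSeries {ι κ : Type*} [Fintype ι] [Fintype κ] (a : ι → ℂ) (b : κ → ℂ)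
    (z : ℂ) : ℂ :=
  ∑' k : ℕ, (∏ i, (ascPochhammer ℂ k).eval (a i)) / (∏ j, (ascPochhammer ℂ k).eval (b j))
    * z ^ k / (k ! : ℂ)

variable {n : ℕ}

/-- The Euler operator `θ = t d/dt`. -/
def theta (F : ℂ → ℂ) : ℂ → ℂ := fun t => t * deriv F t

/-- `(θ + ρ₁) ⋯ (θ + ρₙ) F`. -/
def thetaProd (ρ : Fin n → ℝ) (F : ℂ → ℂ) : ℂ → ℂ :=
  (List.ofFn ρ).foldr (fun r G => fun t => theta G t + (r : ℂ) * G t) F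

/-- `F` is an analytic solution on `D` of the rescaled hypergeometric equation
`[θⁿ - C t (θ + ρ₁) ⋯ (θ + ρₙ)] F = 0`. -/
def IsSolutionOn (ρ : Fin n → ℝ) (C : ℝ) (D : Set ℂ) (F : ℂ → ℂ) : Prop :=
  AnalyticOnNhd ℂ F D ∧ ∀ t ∈ D, theta^[n] F t - (C : ℂ) * t * thetaProd ρ F t = 0

/-- `n` linearly independent solutions on `D` of the equation of order `n`. -/
def IsFundamentalSystemOn (ρ : Fin n → ℝ) (C : ℝ) (D : Set ℂ) (F : Fin n → ℂ → ℂ) : Prop :=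
  (∀ i, IsSolutionOn ρ C D (F i)) ∧ LinearIndependent ℂ (fun i => D.domRestrict (F i))

/-- The punctured disc `0 < |t| < 1/C` cut along the negative real axis. -/
def slitDiscZero (C : ℝ) : Set ℂ := {t | t ∈ Complex.slitPlane ∧ ‖t‖ < 1 / C}

/-- The punctured disc `|t| > 1/C` around infinity cut along the negative real axis. -/
def slitDiscInfty (C : ℝ) : Set ℂ := {t | t ∈ Complex.slitPlane ∧ 1 / C < ‖t‖}

/-- The generating function `f(ε, t) = t^ε ∑ₖ (∏ᵢ (ρᵢ + ε)ₖ) / ((1 + ε)ₖ)ⁿ tᵏ`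
(principal branch of `t^ε`). -/
def genFun (ρ : Fin n → ℝ) (ε t : ℂ) : ℂ :=
  t ^ ε * ∑' k : ℕ, (∏ i, (ascPochhammer ℂ k).eval ((ρ i : ℂ) + ε))
    / ((ascPochhammer ℂ k).eval (1 + ε)) ^ n * t ^ k

/-- `f̃ₘ(t) = (2πi)⁻ᵐ (m!)⁻¹ ∂ᵐ/∂εᵐ [C^{-ε} f(ε, C t)]` at `ε = 0`. -/
def solZero (ρ : Fin n → ℝ) (C : ℝ) (m : ℕ) (t : ℂ) : ℂ :=
  iteratedDeriv m (fun ε : ℂ => (C : ℂ) ^ (-ε) * genFun ρ ε ((C : ℂ) * t)) 0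
    / ((2 * (Real.pi : ℂ) * Complex.I) ^ m * (m ! : ℂ))

/-- `A_r = e^{-πiρ_r} ∏_{i ≠ r} Γ(ρᵢ - ρ_r) / (Γ(ρᵢ) Γ(1 - ρ_r))`. -/
def coeffA (ρ : Fin n → ℝ) (r : Fin n) : ℂ :=
  Complex.exp (-((Real.pi : ℂ) * Complex.I * (ρ r : ℂ))) *
    ∏ i ∈ Finset.univ.erase r,
      Complex.Gamma ((ρ i : ℂ) - ρ r) / (Complex.Gamma (ρ i) * Complex.Gamma (1 - ρ r))

/-- `F̃_r(t) = F_r(C t)`, where `F_r(t) = A_r t^{-ρ_r} ₙFₙ₋₁(ρ_r, …, ρ_r; (1 + ρ_r - ρᵢ)_{i ≠ r} | 1/t)`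
(principal branch of `t^{-ρ_r}`). -/
def solInfty (ρ : Fin n → ℝ) (C : ℝ) (r : Fin n) (t : ℂ) : ℂ :=
  coeffA ρ r * ((C : ℂ) * t) ^ (-(ρ r : ℂ)) *
    hypergeometricSeries (fun _ : Fin n => (ρ r : ℂ))
      (fun i : {i : Fin n // i ≠ r} => 1 + (ρ r : ℂ) - (ρ i : ℂ)) (1 / ((C : ℂ) * t))

/-- The tuple `(f̃ₙ₋₁, …, f̃₀)`. -/
def basisZero (ρ : Fin n → ℝ) (C : ℝ) (i : Fin n) : ℂ → ℂ := solZero ρ C (Fin.rev i : Fin n)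

/-- The tuple `(F̃ₙ, …, F̃₁)`. -/
def basisInfty (ρ : Fin n → ℝ) (C : ℝ) (i : Fin n) : ℂ → ℂ := solInfty ρ C (Fin.rev i)

/-- `B_k(ε) = e^{-πiε} (∏ᵢ Γ(ρᵢ) Γ(1 + ε) / Γ(ρᵢ + ε)) sin(πρ_k) / sin(πρ_k + πε)`. -/
def funB (ρ : Fin n → ℝ) (k : Fin n) (ε : ℂ) : ℂ :=
  Complex.exp (-((Real.pi : ℂ) * Complex.I * ε)) *
    (∏ i, Complex.Gamma (ρ i) * Complex.Gamma (1 + ε) / Complex.Gamma ((ρ i : ℂ) + ε)) *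
    (Complex.sin ((Real.pi : ℂ) * (ρ k : ℂ)) /
      Complex.sin ((Real.pi : ℂ) * (ρ k : ℂ) + (Real.pi : ℂ) * ε))

/-- The number `(2πi)⁻ʲ (j!)⁻¹ ∂ʲ/∂εʲ [C^{-ε} B_k(ε)]` at `ε = 0`. -/
def transitionCoeff (ρ : Fin n → ℝ) (C : ℝ) (j : ℕ) (k : Fin n) : ℂ :=
  iteratedDeriv j (fun ε : ℂ => (C : ℂ) ^ (-ε) * funB ρ k ε) 0
    / ((2 * (Real.pi : ℂ) * Complex.I) ^ j * (j ! : ℂ))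

/-- The matrix `P̃`. Counting rows and columns from `1`, its entry in row `n - j` and column
`n + 1 - k` is the coefficient with indices `j = 0, …, n - 1` and `k = 1, …, n`. -/
def transitionMatrix (ρ : Fin n → ℝ) (C : ℝ) : Matrix (Fin n) (Fin n) ℂ :=
  Matrix.of fun i c => transitionCoeff ρ C (Fin.rev i : Fin n) (Fin.rev c)

/-- The upper triangular matrix `m₀` with entries `1 / (l - i)!` for `i ≤ l`. -/
def monodromyZero (n : ℕ) : Matrix (Fin n) (Fin n) ℂ :=
  Matrix.of fun i l => if i ≤ l then 1 / (((l : ℕ) - (i : ℕ))! : ℂ) else 0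

/-- The matrix `M_∞ = diag(e^{-2πiρₙ}, …, e^{-2πiρ₁})`. -/
def monodromyInfty (ρ : Fin n → ℝ) : Matrix (Fin n) (Fin n) ℂ :=
  Matrix.diagonal fun i => Complex.exp (-(2 * (Real.pi : ℂ) * Complex.I * (ρ (Fin.rev i) : ℂ)))

/-- The germ of `g` at the end point of `γ` is the analytic continuation along `γ` of the germ of
`f` at the starting point: a family of germs along `γ` that is locally given by one function. -/
def IsAnalyticContinuationAlong {x y : ℂ} (γ : Path x y) (f g : ℂ → ℂ) : Prop :=
  ∃ h : unitInterval → ℂ → ℂ,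
    (∀ s, AnalyticAt ℂ (h s) (γ s)) ∧ h 0 =ᶠ[𝓝 x] f ∧ h 1 =ᶠ[𝓝 y] g ∧
    ∀ s, ∀ᶠ s' in 𝓝 s, h s' =ᶠ[𝓝 (γ s')] h s

/-- Analytic continuation along `γ` turns the tuple of germs `f` into `m · g`. -/
def ContinuesTo {x y : ℂ} (γ : Path x y) (f : Fin n → ℂ → ℂ) (m : Matrix (Fin n) (Fin n) ℂ)
    (g : Fin n → ℂ → ℂ) : Prop :=
  ∀ i, IsAnalyticContinuationAlong γ (f i) (fun t => (m *ᵥ fun l => g l t) i)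

/-- Analytic continuation along the loop `γ` turns the tuple of germs `f` into `m · f`. -/
def HasMonodromy {x : ℂ} (γ : Path x x) (f : Fin n → ℂ → ℂ) (m : Matrix (Fin n) (Fin n) ℂ) :
    Prop :=
  ContinuesTo γ f m f

/-- The circle with centre `c` through `z`, run through once counterclockwise from `z` to `z`. -/
def circleLoop (c z : ℂ) : Path z z where
  toFun s := c + (z - c) * Complex.exp (2 * (Real.pi : ℂ) * Complex.I * ((s : ℝ) : ℂ))
  continuous_toFun := by fun_prop
  source' := by simp
  target' := by simp

end HypergeometricMonodromy

end

/-! In the coordinate `w = log (C t)` the operator `θ` becomes `d/dw`, the equation becomes `hypOp ρ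
F = 0`, and turning once around `0` or `∞` is translation by `2πi`. The scale `C` survives only in
the factor `C^{-ε}`.

By Euler's Beta integral, `φ(s) = ∏ Γ(ρᵢ + s) / (Γ(ρᵢ) Γ(1 + s))` is the exponential moment of a
probability measure on the negative half-line, the law of a sum of independent logarithms of Beta
variables. Summing a geometric series under the integral, the Frobenius series `∑ φ(k + ε) e^{(k +
ε)w}` equals `Φ(ε, w) = ∫ e^{ε(w+y)} / (1 - e^{w+y})` (`hasSum_hypInt`). This integral continues the
series to all `w` with `e^w ∉ [1, ∞)`. Applying the operator to `Φ` leaves `ε^n φ(ε) e^{εw}`, so the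
Taylor coefficients of order `< n` at `ε = 0` of `C^{-ε} Φ / φ(ε)` are solutions; up to powers of
`2πi` they are the `f̃ₘ`. At infinity a series `Ψ(ε, w)` (`infSeries`) leaves `-N(ε) e^{εw}` with
`N(ε) = ∏ (ε - 1 + ρᵢ)`, and `A_r Ψ(1 - ρ_r, ·)` is `F̃_r`.

The combination `N Φ + ε^n φ Ψ` (`connFun`) therefore solves the equation for every admissible `ε`.
For `Re w > 0` it is `∑ c_r(ε) F̃_r` in the strip below the real axis and `∑ e_r(ε) F̃_r` in the one
above. Translation by `2πi` gives `e_r = e^{2πi(ρ_r + ε)} c_r`. The kernel of `Φ(ε) - Φ(0)`, namely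
`(e^{εz} - 1) / (1 - e^z)`, is regular at `0`, so this difference crosses the real axis and `e_r -
c_r` is `N(ε)` times a constant `d_r`. Hence `c_r(ε) (e^{2πi(ρ_r + ε)} - 1) = N(ε) d_r`. Letting `ε
→ 1 - ρ_s` kills `N Φ`, and the reflection formula yields `d_s` (`connection_constants_eq`).
Division by `N φ` turns `c_r` into `B_r(ε)`; the term with `Ψ` carries `ε^n` and drops out of the
derivatives of order `< n`. This is the connection formula `logSolZero_eq_sum`, that is, the matrix
`P̃`.

Linear independence comes from the translations by `2πi`: a polynomial in the number of turns at the
origin, a Vandermonde determinant at infinity. It also makes `P̃` invertible. A path in the lower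
half-plane stays in one strip of the `w`-plane, so one function continues `f̃` to `P̃ F̃`. The
monodromy at infinity is a composition of continuations. The loop around `1/C` is continued
directly, through the lower strip and back through the upper one, and the relation between the two
strips by `2πi` produces `m_∞ m₀⁻¹`. -/

namespace HypergeometricMonodromy

/-! ### Constant coefficient operators `∏ (d/dw + r)` -/

/-- `∏ (d/dw + r)`, the product over the list `l`, applied to `F`. -/
noncomputable def shiftProd (l : List ℝ) (F : ℂ → ℂ) : ℂ → ℂ :=
  l.foldr (fun r G => fun w => deriv G w + (r : ℂ) * G w) F

theorem shiftProd_nil (F : ℂ → ℂ) : shiftProd [] F = F := rfl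

theorem shiftProd_cons (r : ℝ) (l : List ℝ) (F : ℂ → ℂ) :
    shiftProd (r :: l) F = fun w => deriv (shiftProd l F) w + (r : ℂ) * shiftProd l F w := rfl

theorem shiftProd_replicate_zero (n : ℕ) (F : ℂ → ℂ) :
    shiftProd (List.replicate n 0) F = deriv^[n] F := by
  induction n with
  | zero => rfl
  | succ n ih =>
    rw [List.replicate_succ, shiftProd_cons, ih, Function.iterate_succ_apply']
    simp

theorem AnalyticOnNhd.shiftProd {U : Set ℂ} {F : ℂ → ℂ} (hF : AnalyticOnNhd ℂ F U)
    (l : List ℝ) : AnalyticOnNhd ℂ (shiftProd l F) U := by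
  induction l with
  | nil => exact hF
  | cons r l ih => exact ih.deriv.add (analyticOnNhd_const.mul ih)

theorem shiftProd_congr {U : Set ℂ} (hU : IsOpen U) {F G : ℂ → ℂ} (h : Set.EqOn F G U)
    (l : List ℝ) : Set.EqOn (shiftProd l F) (shiftProd l G) U := by
  induction l with
  | nil => exact h
  | cons r l ih =>
    intro w hw
    simp only [shiftProd_cons]
    rw [(ih.eventuallyEq_of_mem (hU.mem_nhds hw)).deriv_eq, ih hw]

theorem shiftProd_sum {ι : Type*} (s : Finset ι) {U : Set ℂ} (hU : IsOpen U) {F : ι → ℂ → ℂ}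
    (hF : ∀ i ∈ s, AnalyticOnNhd ℂ (F i) U) (c : ι → ℂ) (l : List ℝ) :
    Set.EqOn (shiftProd l fun w => ∑ i ∈ s, c i * F i w)
      (fun w => ∑ i ∈ s, c i * shiftProd l (F i) w) U := by
  induction l with
  | nil => exact fun w _ => rfl
  | cons r l ih =>
    intro w hw
    simp only [shiftProd_cons]
    rw [(ih.eventuallyEq_of_mem (hU.mem_nhds hw)).deriv_eq, ih hw, deriv_fun_sum]
    · simp only [Finset.mul_sum, ← Finset.sum_add_distrib]
      refine Finset.sum_congr rfl fun i hi => ?_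
      rw [deriv_const_mul _ ((AnalyticOnNhd.shiftProd (hF i hi) l w hw).differentiableAt)]
      ring
    · exact fun i hi =>
        ((AnalyticOnNhd.shiftProd (hF i hi) l w hw).differentiableAt).const_mul _

theorem shiftProd_sub {U : Set ℂ} (hU : IsOpen U) {F G : ℂ → ℂ}
    (hF : AnalyticOnNhd ℂ F U) (hG : AnalyticOnNhd ℂ G U) (l : List ℝ) :
    Set.EqOn (shiftProd l fun w => F w - G w)
      (fun w => shiftProd l F w - shiftProd l G w) U := by
  induction l with
  | nil => exact fun w _ => rfl
  | cons r l ih =>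
    intro w hw
    simp only [shiftProd_cons]
    rw [(ih.eventuallyEq_of_mem (hU.mem_nhds hw)).deriv_eq, ih hw, deriv_fun_sub
      (AnalyticOnNhd.shiftProd hF l w hw).differentiableAt
      (AnalyticOnNhd.shiftProd hG l w hw).differentiableAt]
    ring

/-- Exponentials are eigenfunctions, so on series of exponentials the differential equation becomes
a recursion for the coefficients. -/
theorem shiftProd_exp (l : List ℝ) (c s : ℂ) :
    shiftProd l (fun w => c * Complex.exp (s * w)) =
      fun w => (l.map fun r : ℝ => s + (r : ℂ)).prod * (c * Complex.exp (s * w)) := by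
  induction l with
  | nil => simp [shiftProd_nil]
  | cons r l ih =>
    funext w
    have : HasDerivAt (fun w => Complex.exp (s * w)) (Complex.exp (s * w) * (s * 1)) w :=
      ((hasDerivAt_id w).const_mul s).cexp
    simp only [shiftProd_cons, ih, List.map_cons, List.prod_cons]
    rw [((this.const_mul c).const_mul _).deriv]
    ring

/-! ### Locally dominated series of holomorphic functions -/

/-- A sequence of holomorphic functions on `U`, dominated near every point by a summable
sequence. -/
structure LocDominated (U : Set ℂ) (u : ℕ → ℂ → ℂ) : Prop where
  differentiableOn : ∀ k, DifferentiableOn ℂ (u k) U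
  bound : ∀ w ∈ U, ∃ δ > 0, Metric.ball w δ ⊆ U ∧ ∃ b : ℕ → ℝ, Summable b ∧
    ∀ k, ∀ z ∈ Metric.ball w δ, ‖u k z‖ ≤ b k

namespace LocDominated

variable {U : Set ℂ} {u v : ℕ → ℂ → ℂ}

theorem summable (h : LocDominated U u) {w : ℂ} (hw : w ∈ U) : Summable fun k => u k w := by
  obtain ⟨δ, hδ, -, b, hb, hub⟩ := h.bound w hw
  exact Summable.of_norm_bounded hb fun k => hub k w (Metric.mem_ball_self hδ)

theorem isOpen (h : LocDominated U u) : IsOpen U := by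
  refine Metric.isOpen_iff.mpr fun w hw => ?_
  obtain ⟨δ, hδ, hU, -⟩ := h.bound w hw
  exact ⟨δ, hδ, hU⟩

theorem differentiableOn_tsum (h : LocDominated U u) :
    DifferentiableOn ℂ (fun w => ∑' k, u k w) U := by
  intro w hw
  obtain ⟨δ, hδ, hU, b, hb, hub⟩ := h.bound w hw
  exact ((Complex.differentiableOn_tsum_of_summable_norm hb (fun k => (h.differentiableOn k).mono hU)
    Metric.isOpen_ball hub).differentiableAt (Metric.ball_mem_nhds w hδ)).differentiableWithinAt

theorem analyticOnNhd_tsum (h : LocDominated U u) :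
    AnalyticOnNhd ℂ (fun w => ∑' k, u k w) U :=
  h.differentiableOn_tsum.analyticOnNhd h.isOpen

theorem deriv_tsum (h : LocDominated U u) {w : ℂ} (hw : w ∈ U) :
    deriv (fun w => ∑' k, u k w) w = ∑' k, deriv (u k) w := by
  obtain ⟨δ, hδ, hU, b, hb, hub⟩ := h.bound w hw
  exact (Complex.hasSum_deriv_of_summable_norm hb (fun k => (h.differentiableOn k).mono hU)
    Metric.isOpen_ball hub (Metric.mem_ball_self hδ)).tsum_eq.symm

/-- Cauchy's estimate on circles of radius `δ / 4` around points of the half-size ball costs only a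
constant factor. This makes the class stable under differential operators. -/
protected theorem deriv (h : LocDominated U u) : LocDominated U fun k => deriv (u k) where
  differentiableOn k := (h.differentiableOn k).deriv h.isOpen
  bound w hw := by
    obtain ⟨δ, hδ, hU, b, hb, hub⟩ := h.bound w hw
    refine ⟨δ / 2, by positivity, (Metric.ball_subset_ball (by linarith)).trans hU,
      fun k => b k / (δ / 4), hb.div_const _, fun k z hz => ?_⟩
    have hsub : Metric.closedBall z (δ / 4) ⊆ Metric.ball w δ := by
      intro y hy
      rw [Metric.mem_closedBall] at hy
      rw [Metric.mem_ball] at hz ⊢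
      linarith [dist_triangle y z w]
    refine Complex.norm_deriv_le_of_forall_mem_sphere_norm_le (by positivity) ?_ fun y hy =>
      hub k y (hsub (Metric.sphere_subset_closedBall hy))
    exact ((h.differentiableOn k).mono (hsub.trans hU)).diffContOnCl_ball subset_rfl

theorem add (hu : LocDominated U u) (hv : LocDominated U v) :
    LocDominated U fun k w => u k w + v k w where
  differentiableOn k := (hu.differentiableOn k).add (hv.differentiableOn k)
  bound w hw := by
    obtain ⟨δ, hδ, hU, b, hb, hub⟩ := hu.bound w hw
    obtain ⟨δ', hδ', -, b', hb', hub'⟩ := hv.bound w hw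
    refine ⟨min δ δ', lt_min hδ hδ', (Metric.ball_subset_ball (min_le_left _ _)).trans hU,
      fun k => b k + b' k, hb.add hb', fun k z hz => ?_⟩
    exact (norm_add_le _ _).trans (add_le_add
      (hub k z (Metric.ball_subset_ball (min_le_left _ _) hz))
      (hub' k z (Metric.ball_subset_ball (min_le_right _ _) hz)))

theorem const_mul (hu : LocDominated U u) (c : ℂ) : LocDominated U fun k w => c * u k w where
  differentiableOn k := (hu.differentiableOn k).const_mul c
  bound w hw := by
    obtain ⟨δ, hδ, hU, b, hb, hub⟩ := hu.bound w hw
    refine ⟨δ, hδ, hU, fun k => ‖c‖ * b k, hb.mul_left _, fun k z hz => ?_⟩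
    rw [norm_mul]
    exact mul_le_mul_of_nonneg_left (hub k z hz) (norm_nonneg c)

theorem map_shiftProd (h : LocDominated U u) (l : List ℝ) :
    LocDominated U fun k => shiftProd l (u k) := by
  induction l with
  | nil => exact h
  | cons r l ih => exact ih.deriv.add (ih.const_mul r)

theorem shiftProd_tsum (h : LocDominated U u) (l : List ℝ) :
    Set.EqOn (shiftProd l fun w => ∑' k, u k w)
      (fun w => ∑' k, shiftProd l (u k) w) U := by
  induction l with
  | nil => exact fun w _ => rfl
  | cons r l ih =>
    intro w hw
    have hl := h.map_shiftProd l
    simp only [shiftProd_cons]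
    rw [(ih.eventuallyEq_of_mem (h.isOpen.mem_nhds hw)).deriv_eq, ih hw, hl.deriv_tsum hw,
      ← tsum_mul_left, (hl.deriv.summable hw).tsum_add ((hl.summable hw).mul_left _)]

theorem iteratedDeriv_tsum (h : LocDominated U u) (m : ℕ) {w : ℂ} (hw : w ∈ U) :
    iteratedDeriv m (fun w => ∑' k, u k w) w = ∑' k, iteratedDeriv m (u k) w := by
  have := h.shiftProd_tsum (List.replicate m 0) hw
  simpa only [shiftProd_replicate_zero, ← iteratedDeriv_eq_iterate] using this

end LocDominated

/-! ### The hypergeometric operator in the coordinate `w = log (C t)` -/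

variable {n : ℕ}

/-- `(d/dw)ⁿ - e^w ∏ (d/dw + ρᵢ)`. -/
noncomputable def hypOp (ρ : Fin n → ℝ) (F : ℂ → ℂ) (w : ℂ) : ℂ :=
  shiftProd (List.replicate n 0) F w - Complex.exp w * shiftProd (List.ofFn ρ) F w

theorem AnalyticOnNhd.hypOp {U : Set ℂ} {F : ℂ → ℂ} (hF : AnalyticOnNhd ℂ F U)
    (ρ : Fin n → ℝ) : AnalyticOnNhd ℂ (hypOp ρ F) U := by
  refine (AnalyticOnNhd.shiftProd hF _).sub (AnalyticOnNhd.mul ?_ (AnalyticOnNhd.shiftProd hF _))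
  exact fun w _ => analyticAt_cexp

theorem hypOp_congr (ρ : Fin n → ℝ) {U : Set ℂ} (hU : IsOpen U) {F G : ℂ → ℂ}
    (h : Set.EqOn F G U) : Set.EqOn (hypOp ρ F) (hypOp ρ G) U := fun w hw => by
  rw [hypOp, hypOp, shiftProd_congr hU h _ hw, shiftProd_congr hU h _ hw]

theorem hypOp_sum (ρ : Fin n → ℝ) {ι : Type*} (s : Finset ι) {U : Set ℂ} (hU : IsOpen U)
    {F : ι → ℂ → ℂ} (hF : ∀ i ∈ s, AnalyticOnNhd ℂ (F i) U) (c : ι → ℂ) :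
    Set.EqOn (hypOp ρ fun w => ∑ i ∈ s, c i * F i w) (fun w => ∑ i ∈ s, c i * hypOp ρ (F i) w) U :=
  fun w hw => by
    simp only [hypOp]
    rw [shiftProd_sum s hU hF c _ hw, shiftProd_sum s hU hF c _ hw, Finset.mul_sum,
      ← Finset.sum_sub_distrib]
    exact Finset.sum_congr rfl fun i _ => by ring

theorem hypOp_sub (ρ : Fin n → ℝ) {U : Set ℂ} (hU : IsOpen U)
    {F G : ℂ → ℂ} (hF : AnalyticOnNhd ℂ F U) (hG : AnalyticOnNhd ℂ G U) :
    Set.EqOn (hypOp ρ fun w => F w - G w) (fun w => hypOp ρ F w - hypOp ρ G w) U :=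
  fun w hw => by
    simp only [hypOp]
    rw [shiftProd_sub hU hF hG _ hw, shiftProd_sub hU hF hG _ hw]
    ring

/-- If the operator telescopes on a series, only its first term survives. -/
theorem LocDominated.hypOp_tsum_of_telescope {U : Set ℂ} {u : ℕ → ℂ → ℂ} (h : LocDominated U u)
    (ρ : Fin n → ℝ) {w : ℂ} (hw : w ∈ U)
    (hu : ∀ k, shiftProd (List.replicate n 0) (u (k + 1)) w =
      Complex.exp w * shiftProd (List.ofFn ρ) (u k) w) :
    hypOp ρ (fun w => ∑' k, u k w) w = shiftProd (List.replicate n 0) (u 0) w := by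
  rw [hypOp, h.shiftProd_tsum _ hw, h.shiftProd_tsum _ hw, ← tsum_mul_left]
  simp only [← hu]
  rw [((h.map_shiftProd _).summable hw).tsum_eq_zero_add]
  ring

/-- The version for decreasing exponents: the cancellation runs in the opposite direction, so the
survivor comes from the part of the operator with the factor `e^w`. -/
theorem LocDominated.hypOp_tsum_of_telescope' {U : Set ℂ} {u : ℕ → ℂ → ℂ} (h : LocDominated U u)
    (ρ : Fin n → ℝ) {w : ℂ} (hw : w ∈ U)
    (hu : ∀ k, shiftProd (List.replicate n 0) (u k) w =
      Complex.exp w * shiftProd (List.ofFn ρ) (u (k + 1)) w) :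
    hypOp ρ (fun w => ∑' k, u k w) w =
      - (Complex.exp w * shiftProd (List.ofFn ρ) (u 0) w) := by
  rw [hypOp, h.shiftProd_tsum _ hw, h.shiftProd_tsum _ hw, ← tsum_mul_left]
  simp only [hu]
  rw [(((h.map_shiftProd _).summable hw).mul_left _).tsum_eq_zero_add]
  ring

/-! ### Uniqueness for the differential equation -/

theorem le_analyticOrderAt_deriv {f : ℂ → ℂ} {w : ℂ} (hf : AnalyticAt ℂ f w) {M : ℕ}
    (h : ((M + 1 : ℕ) : ℕ∞) ≤ analyticOrderAt f w) : (M : ℕ∞) ≤ analyticOrderAt (deriv f) w := by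
  rw [natCast_le_analyticOrderAt_iff_iteratedDeriv_eq_zero hf] at h
  rw [natCast_le_analyticOrderAt_iff_iteratedDeriv_eq_zero hf.deriv]
  intro i hi
  rw [← iteratedDeriv_succ']
  exact h _ (by omega)

theorem le_analyticOrderAt_iterate_deriv {f : ℂ → ℂ} {w : ℂ} (hf : AnalyticAt ℂ f w) {M : ℕ}
    (k : ℕ) (h : ((M + k : ℕ) : ℕ∞) ≤ analyticOrderAt f w) :
    (M : ℕ∞) ≤ analyticOrderAt (deriv^[k] f) w := by
  induction k generalizing M with
  | zero => exact h
  | succ k ih =>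
    rw [Function.iterate_succ_apply']
    refine le_analyticOrderAt_deriv (hf.iterated_deriv k) (ih ?_)
    rwa [add_right_comm, add_assoc]

/-- Expanding the product, the difference involves only derivatives of order below `l.length`, and
each derivative not taken saves one order of vanishing. -/
theorem le_analyticOrderAt_shiftProd_sub {f : ℂ → ℂ} {w : ℂ} (hf : AnalyticAt ℂ f w)
    (l : List ℝ) {M : ℕ} (h : ((M + l.length : ℕ) : ℕ∞) ≤ analyticOrderAt f w) :
    ((M + 1 : ℕ) : ℕ∞) ≤ analyticOrderAt (shiftProd l f - deriv^[l.length] f) w := by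
  have key : ∀ l : List ℝ, AnalyticAt ℂ (shiftProd l f) w := fun l =>
    AnalyticOnNhd.shiftProd (U := {w}) (by simpa [AnalyticOnNhd] using hf) l w rfl
  induction l generalizing M with
  | nil =>
    have : shiftProd [] f - deriv^[([] : List ℝ).length] f = 0 := by
      simp [shiftProd_nil]
    rw [this, analyticOrderAt_eq_top.mpr (by simp)]
    exact le_top
  | cons r l ih =>
    have hd := hf.iterated_deriv l.length
    have h1 := ih (M := M + 1) (by simpa [add_assoc, add_comm 1] using h)
    have h2 : ((M + 1 : ℕ) : ℕ∞) ≤ analyticOrderAt (deriv^[l.length] f) w :=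
      le_analyticOrderAt_iterate_deriv hf _ (by simpa [add_assoc, add_comm 1] using h)
    have e : shiftProd (r :: l) f - deriv^[(r :: l).length] f =ᶠ[𝓝 w]
        deriv (shiftProd l f - deriv^[l.length] f) +
          (fun _ => (r : ℂ)) * ((shiftProd l f - deriv^[l.length] f) + deriv^[l.length] f) := by
      filter_upwards [(key l).eventually_analyticAt, hd.eventually_analyticAt] with z h1 h2
      simp only [shiftProd_cons, List.length_cons, Function.iterate_succ_apply', Pi.sub_apply,
        Pi.add_apply, Pi.mul_apply, sub_add_cancel]
      rw [deriv_sub h1.differentiableAt h2.differentiableAt]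
      ring
    rw [analyticOrderAt_congr e]
    refine le_trans (le_min ?_ ?_) (le_analyticOrderAt_add)
    · exact le_analyticOrderAt_deriv ((key l).sub hd) h1
    · rw [analyticOrderAt_mul analyticAt_const (((key l).sub hd).add hd)]
      refine le_trans (le_trans (le_min ?_ h2) le_analyticOrderAt_add) le_add_self
      exact le_trans (by exact_mod_cast Nat.le_succ _) h1

/-- The equation reads `(1 - e^w) f⁽ⁿ⁾ = e^w · (lower order terms)`, and `1 - e^w` is a unit away
from the singular point. If `f` vanishes to order `M + n`, the right side vanishes to order `M + 1`,
hence so does `f⁽ⁿ⁾`, and `f` gains one order; repeat. -/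
theorem analyticOrderAt_eq_top_of_hypOp_eq_zero (ρ : Fin n → ℝ) {f : ℂ → ℂ} {w : ℂ}
    (hf : AnalyticAt ℂ f w) (hw : Complex.exp w ≠ 1) (h : ∀ᶠ z in 𝓝 w, hypOp ρ f z = 0)
    (h0 : ∀ p < n, iteratedDeriv p f w = 0) : analyticOrderAt f w = ⊤ := by
  rw [ENat.eq_top_iff_forall_ge]
  suffices H : ∀ M : ℕ, ((M + n : ℕ) : ℕ∞) ≤ analyticOrderAt f w from fun M =>
    le_trans (by exact_mod_cast Nat.le_add_right M n) (H M)
  intro M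
  induction M with
  | zero =>
    rw [zero_add, natCast_le_analyticOrderAt_iff_iteratedDeriv_eq_zero hf]
    exact h0
  | succ M ih =>
    have h1 := le_analyticOrderAt_shiftProd_sub hf (List.ofFn ρ) (M := M) (by simpa using ih)
    rw [List.length_ofFn] at h1
    have hd := hf.iterated_deriv n
    have hs : AnalyticAt ℂ (shiftProd (List.ofFn ρ) f) w :=
      AnalyticOnNhd.shiftProd (U := {w}) (by simpa [AnalyticOnNhd] using hf) _ w rfl
    have e : (fun z => 1 - Complex.exp z) * deriv^[n] f =ᶠ[𝓝 w]
        Complex.exp * (shiftProd (List.ofFn ρ) f - deriv^[n] f) := by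
      filter_upwards [h] with z hz
      rw [hypOp, shiftProd_replicate_zero] at hz
      simp only [Pi.mul_apply, Pi.sub_apply]
      linear_combination hz
    have e1 : analyticOrderAt (fun z => 1 - Complex.exp z) w = 0 :=
      (analyticOrderAt_eq_zero.mpr (.inr (sub_ne_zero.mpr hw.symm)))
    have h2 := analyticOrderAt_congr e
    have ha : AnalyticAt ℂ (fun z => 1 - Complex.exp z) w := analyticAt_const.sub analyticAt_cexp
    rw [analyticOrderAt_mul ha hd, e1, zero_add,
      analyticOrderAt_mul analyticAt_cexp (hs.sub hd)] at h2
    have h3 : ((M + 1 : ℕ) : ℕ∞) ≤ analyticOrderAt (deriv^[n] f) w :=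
      h2 ▸ h1.trans le_add_self
    rw [natCast_le_analyticOrderAt_iff_iteratedDeriv_eq_zero hd] at h3
    rw [natCast_le_analyticOrderAt_iff_iteratedDeriv_eq_zero hf]
    intro i hi
    rcases lt_or_ge i n with hin | hin
    · exact h0 i hin
    · have := h3 (i - n) (by omega)
      rwa [iteratedDeriv_eq_iterate, ← Function.iterate_add_apply, Nat.sub_add_cancel hin,
        ← iteratedDeriv_eq_iterate] at this

theorem eqOn_zero_of_hypOp_eq_zero (ρ : Fin n → ℝ) {f : ℂ → ℂ} {U : Set ℂ} (hU : IsOpen U)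
    (hc : IsPreconnected U) (hf : AnalyticOnNhd ℂ f U) (h : ∀ z ∈ U, hypOp ρ f z = 0)
    {w : ℂ} (hwU : w ∈ U) (hw : Complex.exp w ≠ 1)
    (h0 : ∀ p < n, iteratedDeriv p f w = 0) : ∀ z ∈ U, f z = 0 := by
  have := analyticOrderAt_eq_top_of_hypOp_eq_zero ρ (hf w hwU) hw
    (Filter.eventually_of_mem (hU.mem_nhds hwU) h) h0
  exact hf.eqOn_zero_of_preconnected_of_eventuallyEq_zero hc hwU (analyticOrderAt_eq_top.mp this)

theorem iteratedDeriv_sum_const_mul {ι : Type*} (s : Finset ι) {U : Set ℂ} (hU : IsOpen U)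
    {F : ι → ℂ → ℂ} (hF : ∀ i ∈ s, AnalyticOnNhd ℂ (F i) U) (c : ι → ℂ) (p : ℕ) {w : ℂ}
    (hw : w ∈ U) : iteratedDeriv p (fun w => ∑ i ∈ s, c i * F i w) w =
      ∑ i ∈ s, c i * iteratedDeriv p (F i) w := by
  have := shiftProd_sum s hU hF c (List.replicate p 0) hw
  simpa only [shiftProd_replicate_zero, ← iteratedDeriv_eq_iterate] using this

/-- A system of `n` linearly independent solutions spans the space of solutions. -/
theorem exists_eq_sum_of_hypOp_eq_zero (ρ : Fin n → ℝ) {U : Set ℂ} (hU : IsOpen U)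
    (hc : IsPreconnected U) {w : ℂ} (hwU : w ∈ U) (hw : Complex.exp w ≠ 1)
    {X : Fin n → ℂ → ℂ} (hX : ∀ i, AnalyticOnNhd ℂ (X i) U)
    (hX0 : ∀ i, ∀ z ∈ U, hypOp ρ (X i) z = 0)
    (hind : ∀ c : Fin n → ℂ, (∀ z ∈ U, ∑ i, c i * X i z = 0) → c = 0)
    {f : ℂ → ℂ} (hf : AnalyticOnNhd ℂ f U) (hf0 : ∀ z ∈ U, hypOp ρ f z = 0) :
    ∃ c : Fin n → ℂ, ∀ z ∈ U, f z = ∑ i, c i * X i z := by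
  have hana : ∀ c : Fin n → ℂ, AnalyticOnNhd ℂ (fun z => ∑ i, c i * X i z) U := fun c =>
    Finset.analyticOnNhd_fun_sum _ fun i _ => analyticOnNhd_const.mul (hX i)
  have hop : ∀ c : Fin n → ℂ, ∀ z ∈ U, hypOp ρ (fun z => ∑ i, c i * X i z) z = 0 :=
    fun c z hz => by
      rw [hypOp_sum ρ Finset.univ hU (fun i _ => hX i) c hz]
      exact Finset.sum_eq_zero fun i _ => by rw [hX0 i z hz, mul_zero]
  -- The Wronskian matrix at `w`. Uniqueness and independence make it injective, hence surjective,
  -- so any initial data are matched by a combination of the `X i`.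
  let J : Matrix (Fin n) (Fin n) ℂ := Matrix.of fun p i => iteratedDeriv p (X i) w
  have hJ : ∀ c : Fin n → ℂ, ∀ p : Fin n, (J *ᵥ c) p =
      iteratedDeriv p (fun z => ∑ i, c i * X i z) w := fun c p => by
    rw [iteratedDeriv_sum_const_mul Finset.univ hU (fun i _ => hX i) c p hwU]
    simp [J, Matrix.mulVec, dotProduct, mul_comm]
  have hinj : Function.Injective J.mulVecLin := by
    rw [← LinearMap.ker_eq_bot, LinearMap.ker_eq_bot']
    intro c hc0
    refine hind c (eqOn_zero_of_hypOp_eq_zero ρ hU hc (hana c) (hop c) hwU hw fun p hp => ?_)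
    rw [← hJ c ⟨p, hp⟩]
    exact congrFun hc0 _
  obtain ⟨c, hcJ⟩ := LinearMap.injective_iff_surjective.mp hinj
    (fun p : Fin n => iteratedDeriv p f w)
  refine ⟨c, fun z hz => sub_eq_zero.mp ?_⟩
  refine eqOn_zero_of_hypOp_eq_zero ρ hU hc (hf.sub (hana c)) (fun z hz => ?_) hwU hw
    (fun p hp => ?_) z hz
  · rw [show (f - fun z => ∑ i, c i * X i z) = fun z => f z - ∑ i, c i * X i z from rfl,
      hypOp_sub ρ hU hf (hana c) hz]
    simp only [hf0 z hz, hop c z hz, sub_zero]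
  · rw [iteratedDeriv_sub (hf w hwU).contDiffAt (hana c w hwU).contDiffAt, ← hJ c ⟨p, hp⟩]
    exact sub_eq_zero.mpr (congrFun hcJ ⟨p, hp⟩).symm

/-! ### The logarithmic coordinate -/

/-- `∏ (θ + r)` over the list `l`, applied to `F`. -/
noncomputable def thetaList (l : List ℝ) (F : ℂ → ℂ) : ℂ → ℂ :=
  l.foldr (fun r G => fun t => theta G t + (r : ℂ) * G t) F

theorem thetaList_replicate_zero (n : ℕ) (F : ℂ → ℂ) :
    thetaList (List.replicate n 0) F = theta^[n] F := by
  induction n with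
  | zero => rfl
  | succ n ih =>
    rw [Function.iterate_succ_apply', ← ih]
    funext t
    simp [thetaList, List.replicate_succ]

theorem hasDerivAt_log_const_mul {C : ℝ} (hC : 0 < C) {t : ℂ} (ht : t ∈ Complex.slitPlane) :
    HasDerivAt (fun t : ℂ => Complex.log ((C : ℂ) * t)) t⁻¹ t := by
  have hC' : (C : ℂ) ≠ 0 := by exact_mod_cast hC.ne'
  have hCt : (C : ℂ) * t ∈ Complex.slitPlane := by
    rw [Complex.mem_slitPlane_iff] at ht ⊢
    simpa [hC, hC.ne'] using ht
  convert ((hasDerivAt_id t).const_mul (C : ℂ)).clog hCt using 1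
  · simp
  · rw [mul_one, id, div_mul_eq_div_div, div_self hC', one_div]

theorem thetaList_log {C : ℝ} (hC : 0 < C) {D U : Set ℂ} (hD : IsOpen D)
    (hDs : D ⊆ Complex.slitPlane) (hDU : ∀ t ∈ D, Complex.log ((C : ℂ) * t) ∈ U) {F Y : ℂ → ℂ}
    (hY : AnalyticOnNhd ℂ Y U) (h : Set.EqOn F (fun t => Y (Complex.log ((C : ℂ) * t))) D)
    (l : List ℝ) :
    Set.EqOn (thetaList l F) (fun t => shiftProd l Y (Complex.log ((C : ℂ) * t))) D := by
  induction l with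
  | nil => exact h
  | cons r l ih =>
    intro t ht
    have h1 : thetaList (r :: l) F t = theta (thetaList l F) t + r * thetaList l F t := rfl
    have h2 := (AnalyticOnNhd.shiftProd hY l _ (hDU t ht)).differentiableAt.hasDerivAt.comp t
      (hasDerivAt_log_const_mul hC (hDs ht))
    rw [h1, theta, (ih.eventuallyEq_of_mem (hD.mem_nhds ht)).deriv_eq, ih ht]
    simp only [shiftProd_cons]
    rw [show (fun t : ℂ => shiftProd l Y (Complex.log ((C : ℂ) * t))) =
      shiftProd l Y ∘ fun t : ℂ => Complex.log ((C : ℂ) * t) from rfl, h2.deriv]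
    field_simp [Complex.slitPlane_ne_zero (hDs ht)]

/-- With `e^w = C t` the factor `C t` of the rescaled equation is the `e^w` in `hypOp`; the cut
keeps the logarithm holomorphic. -/
theorem isSolutionOn_of_hypOp (ρ : Fin n → ℝ) {C : ℝ} (hC : 0 < C) {D U : Set ℂ} (hD : IsOpen D)
    (hDs : D ⊆ Complex.slitPlane) (hDU : ∀ t ∈ D, Complex.log ((C : ℂ) * t) ∈ U) {F Y : ℂ → ℂ}
    (hY : AnalyticOnNhd ℂ Y U) (h : Set.EqOn F (fun t => Y (Complex.log ((C : ℂ) * t))) D)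
    (hY0 : ∀ w ∈ U, hypOp ρ Y w = 0) : IsSolutionOn ρ C D F := by
  constructor
  · intro t ht
    have : DifferentiableOn ℂ F D := fun s hs => by
      refine DifferentiableWithinAt.congr ?_ h (h hs)
      exact (((hY _ (hDU s hs)).differentiableAt.hasDerivAt.comp s
        (hasDerivAt_log_const_mul hC (hDs hs))).differentiableAt).differentiableWithinAt
    exact this.analyticOnNhd hD t ht
  · intro t ht
    have hCt : (C : ℂ) * t ≠ 0 :=
      mul_ne_zero (by exact_mod_cast hC.ne') (Complex.slitPlane_ne_zero (hDs ht))
    rw [← thetaList_replicate_zero, show thetaProd ρ F t = thetaList (List.ofFn ρ) F t from rfl,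
      thetaList_log hC hD hDs hDU hY h _ ht, thetaList_log hC hD hDs hDU hY h _ ht]
    have := hY0 _ (hDU t ht)
    rwa [hypOp, Complex.exp_log hCt] at this

/-! ### A measure with prescribed exponential moments -/

open MeasureTheory ProbabilityTheory

/-- The law of `log x` for `x` Beta distributed with parameters `r` and `1 - r`. -/
noncomputable def logBeta (r : ℝ) : Measure ℝ := (betaMeasure r (1 - r)).map Real.log

theorem isProbabilityMeasure_logBeta {r : ℝ} (h0 : 0 < r) (h1 : r < 1) :
    IsProbabilityMeasure (logBeta r) := by
  have := isProbabilityMeasureBeta h0 (sub_pos.mpr h1)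
  exact Measure.isProbabilityMeasure_map Real.measurable_log.aemeasurable

theorem betaMeasure_eq_restrict (r : ℝ) : betaMeasure r (1 - r) =
    (volume.restrict (Set.Ioo 0 1)).withDensity (fun x => ENNReal.ofReal
      (1 / beta r (1 - r) * x ^ (r - 1) * (1 - x) ^ ((1 - r) - 1))) := by
  rw [← withDensity_indicator measurableSet_Ioo, betaMeasure]
  congr 1
  funext x
  by_cases hx : 0 < x ∧ x < 1
  · rw [Set.indicator_of_mem (show x ∈ Set.Ioo 0 1 from hx), betaPDF_eq, if_pos hx]
  · rw [Set.indicator_of_notMem (show x ∉ Set.Ioo 0 1 from hx), betaPDF_eq, if_neg hx,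
      ENNReal.ofReal_zero]

theorem ae_logBeta_neg {r : ℝ} : ∀ᵐ y ∂logBeta r, y < 0 := by
  rw [logBeta, ae_map_iff Real.measurable_log.aemeasurable measurableSet_Iio,
    betaMeasure_eq_restrict]
  refine (withDensity_absolutelyContinuous _ _).ae_le ?_
  exact (ae_restrict_mem measurableSet_Ioo).mono fun x hx => Real.log_neg hx.1 hx.2

/-- Since `e^{s log x} = x^s`, the exponential only shifts the first parameter of Euler's Beta
integrand from `r` to `r + s`. -/
theorem beta_smul_cexp_log {r : ℝ} (h0 : 0 < r) (h1 : r < 1) (s : ℂ) {x : ℝ}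
    (hx : x ∈ Set.Ioo (0 : ℝ) 1) :
    (ENNReal.ofReal (1 / beta r (1 - r) * x ^ (r - 1) * (1 - x) ^ ((1 - r) - 1))).toReal •
      Complex.exp (s * (Real.log x : ℂ)) =
    (1 / beta r (1 - r) : ℝ) * ((x : ℂ) ^ (((r : ℂ) + s) - 1) *
      (1 - (x : ℂ)) ^ ((1 - (r : ℂ)) - 1)) := by
  have hb := beta_pos h0 (sub_pos.mpr h1)
  have hx0 : (x : ℂ) ≠ 0 := by exact_mod_cast hx.1.ne'
  have hx1 : 0 < 1 - x := sub_pos.mpr hx.2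
  rw [ENNReal.toReal_ofReal (by have := hx.1; positivity), Complex.real_smul, Complex.ofReal_mul,
    Complex.ofReal_mul, Complex.ofReal_cpow hx.1.le, Complex.ofReal_cpow hx1.le,
    show ((r : ℂ) + s) - 1 = ((r - 1 : ℝ) : ℂ) + s by push_cast; ring, Complex.cpow_add _ _ hx0,
    Complex.cpow_def_of_ne_zero hx0 s, ← Complex.ofReal_log hx.1.le, mul_comm s]
  push_cast
  ring

theorem integrable_exp_logBeta {r : ℝ} (h0 : 0 < r) (h1 : r < 1) {s : ℂ} (hs : -r < s.re) :
    Integrable (fun y : ℝ => Complex.exp (s * (y : ℂ))) (logBeta r) := by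
  rw [logBeta, integrable_map_measure (by fun_prop) Real.measurable_log.aemeasurable,
    betaMeasure_eq_restrict, integrable_withDensity_iff_integrable_smul' (by fun_prop) (by simp)]
  have hc := (Complex.betaIntegral_convergent (u := (r : ℂ) + s) (v := 1 - (r : ℂ))
    (by simp; linarith) (by simpa using h1)).const_mul ((1 / beta r (1 - r) : ℝ) : ℂ)
  rw [intervalIntegrable_iff_integrableOn_Ioo_of_le zero_le_one] at hc
  refine (integrable_congr ?_).mp hc
  filter_upwards [ae_restrict_mem measurableSet_Ioo] with x hx
  exact (beta_smul_cexp_log h0 h1 s hx).symm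

/-- The moment is `B(r + s, 1 - r) / B(r, 1 - r)`. The parameters add up to `1 + s` and `1`, and
`Γ(1 - r)` cancels. -/
theorem integral_exp_logBeta {r : ℝ} (h0 : 0 < r) (h1 : r < 1) {s : ℂ} (hs : -r < s.re) :
    ∫ y : ℝ, Complex.exp (s * (y : ℂ)) ∂(logBeta r) =
      Complex.Gamma ((r : ℂ) + s) / (Complex.Gamma r * Complex.Gamma (1 + s)) := by
  rw [logBeta, integral_map Real.measurable_log.aemeasurable (by fun_prop),
    betaMeasure_eq_restrict, integral_withDensity_eq_integral_toReal_smul (by fun_prop) (by simp),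
    setIntegral_congr_fun measurableSet_Ioo (fun x hx => beta_smul_cexp_log h0 h1 s hx),
    integral_const_mul, ← integral_Ioc_eq_integral_Ioo,
    ← intervalIntegral.integral_of_le zero_le_one]
  have hb := Complex.Gamma_mul_Gamma_eq_betaIntegral (s := (r : ℂ) + s) (t := 1 - (r : ℂ))
    (by simp; linarith) (by simpa using h1)
  have h2 : (beta r (1 - r) : ℂ) = Complex.Gamma r * Complex.Gamma (1 - r) := by
    rw [beta]
    push_cast [← Complex.Gamma_ofReal]
    simp
  have hg1 : Complex.Gamma (1 - (r : ℂ)) ≠ 0 :=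
    Complex.Gamma_ne_zero_of_re_pos (by simpa using h1)
  have hg0 : Complex.Gamma (r : ℂ) ≠ 0 := Complex.Gamma_ne_zero_of_re_pos (by simpa using h0)
  have hg2 : Complex.Gamma (1 + s) ≠ 0 := Complex.Gamma_ne_zero_of_re_pos (by simp; linarith)
  rw [show (r : ℂ) + s + (1 - r) = 1 + s by ring] at hb
  rw [Complex.betaIntegral] at hb
  push_cast
  rw [h2]
  field_simp
  linear_combination -hb

/-- `φ(s) = ∏ᵢ Γ(ρᵢ + s) / (Γ(ρᵢ) Γ(1 + s))`. -/
noncomputable def gammaQuot (ρ : Fin n → ℝ) (s : ℂ) : ℂ :=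
  ∏ i, Complex.Gamma ((ρ i : ℂ) + s) / (Complex.Gamma (ρ i) * Complex.Gamma (1 + s))

/-- The measure on the negative half-line with exponential moments `gammaQuot ρ`. -/
noncomputable def hypMeasure (ρ : Fin n → ℝ) : Measure ℝ :=
  (Measure.pi fun i => logBeta (ρ i)).map fun y => ∑ i, y i

section

variable {ρ : Fin n → ℝ} (hρ : ∀ i, 0 < ρ i ∧ ρ i < 1)
include hρ

theorem isProbabilityMeasure_hypMeasure : IsProbabilityMeasure (hypMeasure ρ) := by
  have := fun i => isProbabilityMeasure_logBeta (hρ i).1 (hρ i).2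
  exact Measure.isProbabilityMeasure_map (by fun_prop)

/-- For `n = 0` the empty sum would give the point mass at `0`; this is where `1 ≤ n` matters. -/
theorem ae_hypMeasure_neg (hn : 1 ≤ n) : ∀ᵐ y ∂hypMeasure ρ, y < 0 := by
  have := fun i => isProbabilityMeasure_logBeta (hρ i).1 (hρ i).2
  rw [hypMeasure, ae_map_iff (by fun_prop) measurableSet_Iio]
  have : ∀ᵐ y ∂(Measure.pi fun i => logBeta (ρ i)), ∀ i, y i < 0 :=
    ae_all_iff.mpr fun i => (Measure.tendsto_eval_ae_ae
      (μ := fun i => logBeta (ρ i)) (i := i)).eventually (p := fun y => y < 0) ae_logBeta_neg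
  filter_upwards [this] with y hy
  exact Finset.sum_neg (fun i _ => hy i) ⟨⟨0, hn⟩, Finset.mem_univ _⟩

theorem integrable_exp_hypMeasure {s : ℂ} (hs : ∀ i, -ρ i < s.re) :
    Integrable (fun y : ℝ => Complex.exp (s * (y : ℂ))) (hypMeasure ρ) := by
  have := fun i => isProbabilityMeasure_logBeta (hρ i).1 (hρ i).2
  rw [hypMeasure, integrable_map_measure (by fun_prop) (by fun_prop)]
  refine (Integrable.fintype_prod (𝕜 := ℂ) (f := fun _ (y : ℝ) => Complex.exp (s * (y : ℂ)))
    fun i => integrable_exp_logBeta (hρ i).1 (hρ i).2 (hs i)).congr ?_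
  filter_upwards with y
  simp [← Complex.exp_sum, Finset.mul_sum]

/-- The exponential of a sum of independent variables: the moments multiply. -/
theorem integral_exp_hypMeasure {s : ℂ} (hs : ∀ i, -ρ i < s.re) :
    ∫ y : ℝ, Complex.exp (s * (y : ℂ)) ∂(hypMeasure ρ) = gammaQuot ρ s := by
  have := fun i => isProbabilityMeasure_logBeta (hρ i).1 (hρ i).2
  rw [hypMeasure, integral_map (by fun_prop) (by fun_prop), gammaQuot]
  rw [← Finset.prod_congr rfl fun i _ => integral_exp_logBeta (hρ i).1 (hρ i).2 (hs i),
    ← integral_fintype_prod_eq_prod (𝕜 := ℂ) (fun _ (y : ℝ) => Complex.exp (s * (y : ℂ)))]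
  refine integral_congr_ae ?_
  filter_upwards with y
  simp [← Complex.exp_sum, Finset.mul_sum]

theorem integrable_rexp_hypMeasure {s : ℝ} (hs : ∀ i, -ρ i < s) :
    Integrable (fun y : ℝ => Real.exp (s * y)) (hypMeasure ρ) := by
  refine (integrable_exp_hypMeasure hρ (s := (s : ℂ)) (by simpa using hs)).norm.congr ?_
  filter_upwards with y
  simp [Complex.norm_exp]

end

/-! ### Integrals of translates of a holomorphic kernel -/

section Translate

variable {U : Set ℂ} {h : ℂ → ℂ} {σ : ℝ}

/-- For `y` bounded below the translates fill a compact subset of `U`; for very negative `y` they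
lie in `Re ≤ -1`, where the growth hypothesis applies. -/
theorem exists_bound_translate (hU : IsOpen U) (hneg : ∀ w ∈ U, ∀ y : ℝ, y ≤ 0 → w + y ∈ U)
    (hh : ContinuousOn h U) (hσ : 0 ≤ σ)
    (hb : ∀ b : ℝ, ∃ C : ℝ, ∀ z ∈ U, z.re ≤ -1 → |z.im| ≤ b → ‖h z‖ ≤ C * Real.exp (-σ * z.re))
    {w : ℂ} (hw : w ∈ U) : ∃ δ > 0, Metric.closedBall w δ ⊆ U ∧ ∃ C : ℝ,
      ∀ z ∈ Metric.closedBall w δ, ∀ y : ℝ, y ≤ 0 → ‖h (z + y)‖ ≤ C * Real.exp (-σ * y) := by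
  obtain ⟨δ, hδ, hsub⟩ := Metric.nhds_basis_closedBall.mem_iff.mp (hU.mem_nhds hw)
  refine ⟨δ, hδ, hsub, ?_⟩
  -- `A` bounds `‖z‖` on the ball, so `y < -(A + 1)` forces `Re (z + y) ≤ -1`.
  set A := ‖w‖ + δ with hA
  have hA0 : 0 ≤ A := by positivity
  have hz : ∀ z ∈ Metric.closedBall w δ, ‖z‖ ≤ A := fun z hz => by
    have := norm_le_norm_add_norm_sub' z w
    rw [mem_closedBall_iff_norm] at hz
    linarith
  obtain ⟨C, hC⟩ := hb A
  let K : Set ℂ := (fun p : ℂ × ℝ => p.1 + (p.2 : ℂ)) ''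
    (Metric.closedBall w δ ×ˢ Set.Icc (-(A + 1)) 0)
  have hK : IsCompact K :=
    ((isCompact_closedBall w δ).prod isCompact_Icc).image (by fun_prop)
  have hKU : K ⊆ U := by
    rintro _ ⟨⟨z, y⟩, ⟨h1, h2⟩, rfl⟩
    exact hneg z (hsub h1) y h2.2
  obtain ⟨C', hC'⟩ := hK.exists_bound_of_continuousOn (hh.mono hKU)
  refine ⟨|C| * Real.exp (σ * A) + |C'|, fun z hzb y hy => ?_⟩
  have hzA := hz z hzb
  have he : 1 ≤ Real.exp (-σ * y) := Real.one_le_exp (by nlinarith)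
  rw [add_mul]
  rcases le_or_gt (-(A + 1)) y with h1 | h1
  · have h2 := hC' (z + y) ⟨(z, y), ⟨hzb, h1, hy⟩, rfl⟩
    have h3 : |C'| * 1 ≤ |C'| * Real.exp (-σ * y) :=
      mul_le_mul_of_nonneg_left he (abs_nonneg _)
    have h4 : 0 ≤ |C| * Real.exp (σ * A) * Real.exp (-σ * y) := by positivity
    linarith [le_abs_self C']
  · have hre : |z.re| ≤ A := (Complex.abs_re_le_norm z).trans hzA
    have h2 := hC (z + y) (hneg z (hsub hzb) y hy)
      (by simp only [Complex.add_re, Complex.ofReal_re]; linarith [(abs_le.mp hre).2])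
      (by simpa using (Complex.abs_im_le_norm z).trans hzA)
    have h3 : Real.exp (-σ * (z + y).re) ≤ Real.exp (σ * A) * Real.exp (-σ * y) := by
      rw [← Real.exp_add, Real.exp_le_exp]
      simp only [Complex.add_re, Complex.ofReal_re]
      nlinarith [(abs_le.mp hre).1]
    have h4 : C * Real.exp (-σ * (z + y).re) ≤ |C| * (Real.exp (σ * A) * Real.exp (-σ * y)) :=
      mul_le_mul (le_abs_self C) h3 (Real.exp_pos _).le (abs_nonneg C)
    have h5 : 0 ≤ |C'| * Real.exp (-σ * y) := by positivity
    linarith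

variable {ν : Measure ℝ}

theorem aestronglyMeasurable_translate (hneg : ∀ w ∈ U, ∀ y : ℝ, y ≤ 0 → w + y ∈ U)
    (hh : ContinuousOn h U) (hν : ∀ᵐ y ∂ν, y < 0) {w : ℂ} (hw : w ∈ U) :
    AEStronglyMeasurable (fun y : ℝ => h (w + y)) ν := by
  have hc : ContinuousOn (fun y : ℝ => h (w + y)) (Set.Iio 0) :=
    hh.comp (by fun_prop) fun y hy => hneg w hw y (le_of_lt hy)
  have := hc.aestronglyMeasurable (μ := ν) measurableSet_Iio
  rwa [Measure.restrict_eq_self_of_ae_mem (s := Set.Iio (0 : ℝ)) hν] at this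

theorem integrable_translate (hU : IsOpen U) (hneg : ∀ w ∈ U, ∀ y : ℝ, y ≤ 0 → w + y ∈ U)
    (hh : ContinuousOn h U) (hσ : 0 ≤ σ)
    (hb : ∀ b : ℝ, ∃ C : ℝ, ∀ z ∈ U, z.re ≤ -1 → |z.im| ≤ b → ‖h z‖ ≤ C * Real.exp (-σ * z.re))
    (hν : ∀ᵐ y ∂ν, y < 0) (hi : Integrable (fun y => Real.exp (-σ * y)) ν) {w : ℂ} (hw : w ∈ U) :
    Integrable (fun y : ℝ => h (w + y)) ν := by
  obtain ⟨δ, hδ, hsub, C, hC⟩ := exists_bound_translate hU hneg hh hσ hb hw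
  refine (hi.const_mul C).mono' (aestronglyMeasurable_translate hneg hh hν hw) ?_
  filter_upwards [hν] with y hy
  exact hC w (Metric.mem_closedBall_self hδ.le) y hy.le

/-- Differentiation under the integral sign. The derivative of the kernel is dominated through
Cauchy's estimate on discs of radius `δ / 2`, so no separate growth bound for it is needed. -/
theorem differentiableOn_integral_translate (hU : IsOpen U)
    (hneg : ∀ w ∈ U, ∀ y : ℝ, y ≤ 0 → w + y ∈ U)
    (hh : DifferentiableOn ℂ h U) (hσ : 0 ≤ σ)
    (hb : ∀ b : ℝ, ∃ C : ℝ, ∀ z ∈ U, z.re ≤ -1 → |z.im| ≤ b → ‖h z‖ ≤ C * Real.exp (-σ * z.re))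
    (hν : ∀ᵐ y ∂ν, y < 0) (hi : Integrable (fun y => Real.exp (-σ * y)) ν) :
    DifferentiableOn ℂ (fun w => ∫ y : ℝ, h (w + y) ∂ν) U := by
  intro w hw
  obtain ⟨δ, hδ, hsub, C, hC⟩ := exists_bound_translate hU hneg hh.continuousOn hσ hb hw
  refine (DifferentiableAt.differentiableWithinAt ?_)
  refine (hasDerivAt_integral_of_dominated_loc_of_deriv_le (F := fun w (y : ℝ) => h (w + y))
    (F' := fun w (y : ℝ) => deriv h (w + y))
    (bound := fun y => C * Real.exp (-σ * y) / (δ / 2))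
    (Metric.ball_mem_nhds w (half_pos hδ)) ?_ ?_ ?_ ?_ ?_ ?_).2.differentiableAt
  · exact Filter.eventually_of_mem (hU.mem_nhds hw) fun z hz =>
      aestronglyMeasurable_translate hneg hh.continuousOn hν hz
  · exact integrable_translate hU hneg hh.continuousOn hσ hb hν hi hw
  · exact aestronglyMeasurable_translate hneg (hh.deriv hU).continuousOn hν hw
  · filter_upwards [hν] with y hy z hz
    have hsub' : Metric.closedBall z (δ / 2) ⊆ Metric.closedBall w δ := by
      intro x hx
      rw [Metric.mem_closedBall] at hx ⊢
      rw [Metric.mem_ball] at hz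
      linarith [dist_triangle x z w]
    have := Complex.norm_deriv_le_of_forall_mem_sphere_norm_le (f := fun x => h (x + y)) (c := z)
      (half_pos hδ) (C := C * Real.exp (-σ * y)) ?_
      (fun x hx => hC x (hsub' (Metric.sphere_subset_closedBall hx)) y hy.le)
    · rwa [deriv_comp_add_const] at this
    · refine DifferentiableOn.diffContOnCl_ball (U := U) (fun x hx => ?_) (hsub'.trans hsub)
      exact ((hh.differentiableAt (hU.mem_nhds (hneg x hx y hy.le))).hasDerivAt.comp_add_const
        x (y : ℂ)).differentiableAt.differentiableWithinAt
  · exact (hi.const_mul C).div_const _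
  · filter_upwards [hν] with y hy z hz
    have hzU : z + y ∈ U := hneg z (hsub (Metric.ball_subset_closedBall
      (Metric.ball_subset_ball (by linarith) hz))) y hy.le
    exact (hh.differentiableAt (hU.mem_nhds hzU)).hasDerivAt.comp_add_const z (y : ℂ)

end Translate

/-! ### The kernels `zʲ e^{εz} / (1 - e^z)` -/

/-- The points `w` with `e^w ∉ [1, ∞)`. -/
def cutSet : Set ℂ := {w | 1 - Complex.exp w ∈ Complex.slitPlane}

theorem isOpen_cutSet : IsOpen cutSet :=
  Complex.isOpen_slitPlane.preimage (by fun_prop)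

theorem mem_cutSet_iff {w : ℂ} :
    w ∈ cutSet ↔ (Complex.exp w).re < 1 ∨ (Complex.exp w).im ≠ 0 := by
  simp [cutSet, Complex.mem_slitPlane_iff]

/-- Adding `y ≤ 0` moves `e^w` towards `0` along its ray, which cannot enter `[1, ∞)` from outside.
All integrals over translates therefore make sense on `cutSet`. -/
theorem add_mem_cutSet {w : ℂ} (hw : w ∈ cutSet) {y : ℝ} (hy : y ≤ 0) : w + y ∈ cutSet := by
  rw [mem_cutSet_iff] at *
  rw [Complex.exp_add, ← Complex.ofReal_exp, Complex.re_mul_ofReal, Complex.im_mul_ofReal]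
  have h1 : Real.exp y ≤ 1 := Real.exp_le_one_iff.mpr hy
  rcases hw with h | h
  · left
    nlinarith [Real.exp_pos y]
  · exact Or.inr (mul_ne_zero h (Real.exp_pos y).ne')

theorem exp_ne_one_of_mem_cutSet {w : ℂ} (hw : w ∈ cutSet) : Complex.exp w ≠ 1 := by
  intro h
  simp [mem_cutSet_iff, h] at hw

theorem mem_cutSet_of_re_neg {w : ℂ} (hw : w.re < 0) : w ∈ cutSet := by
  refine mem_cutSet_iff.mpr (Or.inl (lt_of_le_of_lt (Complex.re_le_norm _) ?_))
  rwa [Complex.norm_exp, Real.exp_lt_one_iff]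

/-- In this range `e^w` is real only for `Im w = ±π`, and there it is negative. -/
theorem mem_cutSet_of_im {w : ℂ} (h1 : -(2 * Real.pi) < w.im) (h2 : w.im < 2 * Real.pi)
    (h0 : w.im ≠ 0) : w ∈ cutSet := by
  rw [mem_cutSet_iff, or_iff_not_imp_right, not_not]
  intro h
  rw [Complex.exp_im, mul_eq_zero, or_iff_right (Real.exp_pos _).ne', Real.sin_eq_zero_iff] at h
  obtain ⟨k, hk⟩ := h
  have hp := Real.pi_pos
  have hk1 : (k : ℝ) < 2 := by nlinarith
  have hk2 : (-2 : ℝ) < k := by nlinarith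
  have hk0 : k ≠ 0 := by
    rintro rfl
    exact h0 (by simpa using hk.symm)
  have hk1' : k < 2 := by exact_mod_cast hk1
  have hk2' : -2 < k := by exact_mod_cast hk2
  have hc : Real.cos w.im = -1 := by
    rcases (show k = 1 ∨ k = -1 by omega) with rfl | rfl
    · rw [← hk]; simp
    · rw [← hk]; simp
  rw [Complex.exp_re, hc]
  linarith [Real.exp_pos w.re]

/-- `zʲ e^{εz} / (1 - e^z)`. -/
noncomputable def hypKernel (j : ℕ) (ε z : ℂ) : ℂ := z ^ j * Complex.exp (ε * z) / (1 - Complex.exp z)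

theorem differentiableOn_hypKernel (j : ℕ) (ε : ℂ) :
    DifferentiableOn ℂ (hypKernel j ε) cutSet := by
  refine DifferentiableOn.div (by fun_prop) (by fun_prop) fun z hz => ?_
  exact sub_ne_zero.mpr (exp_ne_one_of_mem_cutSet hz).symm

/-- The margin `τ` pays for the polynomial: `(τ‖z‖)^j / j! ≤ e^{τ‖z‖}`. The denominator is harmless
since `|1 - e^z| ≥ 1/2` for `Re z ≤ -1`. -/
theorem norm_hypKernel_le (j : ℕ) {ε : ℂ} {σ τ : ℝ} (hτ : 0 < τ) (hστ : τ - σ ≤ ε.re) (b : ℝ) :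
    ∃ C : ℝ, ∀ z : ℂ, z.re ≤ -1 → |z.im| ≤ b →
      ‖hypKernel j ε z‖ ≤ C * Real.exp (-σ * z.re) := by
  refine ⟨(j ! / τ ^ j * Real.exp (τ * b)) * Real.exp (|ε.im| * b) * 2, fun z hre him => ?_⟩
  have hz : ‖z‖ ≤ -z.re + b := by
    have := Complex.norm_le_abs_re_add_abs_im z
    rw [abs_of_neg (by linarith)] at this
    linarith
  have h1 : ‖z‖ ^ j ≤ j ! / τ ^ j * Real.exp (τ * b) * Real.exp (-τ * z.re) := by
    have h := Real.pow_div_factorial_le_exp (τ * ‖z‖) (by positivity) j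
    have h' : Real.exp (τ * ‖z‖) ≤ Real.exp (τ * b) * Real.exp (-τ * z.re) := by
      rw [← Real.exp_add, Real.exp_le_exp]
      nlinarith
    rw [mul_pow, div_le_iff₀ (by positivity)] at h
    rw [mul_assoc, div_mul_eq_mul_div, le_div_iff₀ (by positivity), mul_comm (‖z‖ ^ j)]
    refine h.trans ?_
    rw [mul_comm]
    exact mul_le_mul_of_nonneg_left h' (by positivity)
  have h2 : ‖Complex.exp (ε * z)‖ ≤ Real.exp (|ε.im| * b) * Real.exp ((τ - σ) * z.re) := by
    rw [Complex.norm_exp, ← Real.exp_add, Real.exp_le_exp, Complex.mul_re]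
    have : -(ε.im * z.im) ≤ |ε.im| * b := by
      refine (neg_le_abs _).trans ?_
      rw [abs_mul]
      exact mul_le_mul_of_nonneg_left him (abs_nonneg _)
    nlinarith
  have h3 : (1 / 2 : ℝ) ≤ ‖1 - Complex.exp z‖ := by
    have := norm_sub_norm_le (1 : ℂ) (Complex.exp z)
    rw [norm_one, Complex.norm_exp] at this
    have h5 : Real.exp z.re ≤ Real.exp (-1) := Real.exp_le_exp.mpr hre
    have h6 : Real.exp (-1) < 1 / 2 := by
      rw [Real.exp_neg, inv_lt_comm₀ (Real.exp_pos 1) (by norm_num)]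
      linarith [Real.exp_one_gt_d9]
    linarith
  rw [hypKernel, norm_div, norm_mul, norm_pow, div_le_iff₀ (by linarith)]
  have h4 : Real.exp (-σ * z.re) = Real.exp (-τ * z.re) * Real.exp ((τ - σ) * z.re) := by
    rw [← Real.exp_add]
    congr 1
    ring
  have h5 := mul_le_mul h1 h2 (norm_nonneg _) (by positivity)
  refine h5.trans ?_
  rw [h4]
  have h6 : 0 ≤ j ! / τ ^ j * Real.exp (τ * b) * Real.exp (-τ * z.re) *
    (Real.exp (|ε.im| * b) * Real.exp ((τ - σ) * z.re)) := by positivity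
  calc _ ≤ (j ! / τ ^ j * Real.exp (τ * b) * Real.exp (-τ * z.re) *
    (Real.exp (|ε.im| * b) * Real.exp ((τ - σ) * z.re))) * (2 * ‖1 - Complex.exp z‖) :=
        le_mul_of_one_le_right h6 (by linarith)
    _ = _ := by ring

/-- `∫ zʲ e^{εz} / (1 - e^z)` at `z = w + y`. -/
noncomputable def hypInt (ρ : Fin n → ℝ) (j : ℕ) (ε w : ℂ) : ℂ :=
  ∫ y : ℝ, hypKernel j ε (w + y) ∂(hypMeasure ρ)

/-! ### Convergence of the integrals, and their dependence on `w` and `ε` -/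

section

variable {ρ : Fin n → ℝ} (hρ : ∀ i, 0 < ρ i ∧ ρ i < 1)
include hρ

/-- Take `σ` slightly above `max 0 (-Re ε)`, still below every `ρᵢ`, so that the moment of order
`-σ` exists; `τ` is the remaining margin. The bound `τ - σ ≤ 0` lets the same pair serve the
exponent `0` in the jump kernel. -/
theorem exists_exponent {ε : ℂ} (hε : ∀ i, -ρ i < ε.re) :
    ∃ σ τ : ℝ, 0 ≤ σ ∧ 0 < τ ∧ τ - σ ≤ ε.re ∧ τ - σ ≤ 0 ∧ ∀ i, -ρ i < -σ := by
  have h : ∀ᶠ σ in 𝓝[>] (max 0 (-ε.re)), ∀ i, σ < ρ i :=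
    Filter.eventually_all.mpr fun i => nhdsWithin_le_nhds
      (eventually_lt_nhds (max_lt (hρ i).1 (by linarith [hε i])))
  obtain ⟨σ, hσ, hσ'⟩ := (h.and self_mem_nhdsWithin).exists
  have h0 : max 0 (-ε.re) < σ := hσ'
  have h1 := (max_lt_iff.mp h0).1
  have h2 := (max_lt_iff.mp h0).2
  exact ⟨σ, min σ (ε.re + σ), h1.le, lt_min h1 (by linarith),
    by linarith [min_le_right σ (ε.re + σ)], by linarith [min_le_left σ (ε.re + σ)],
    fun i => neg_lt_neg (hσ i)⟩

theorem integrable_hypKernel (hn : 1 ≤ n) (j : ℕ) {ε w : ℂ} (hε : ∀ i, -ρ i < ε.re)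
    (hw : w ∈ cutSet) : Integrable (fun y : ℝ => hypKernel j ε (w + y)) (hypMeasure ρ) := by
  obtain ⟨σ, τ, h0, h1, h2, -, h3⟩ := exists_exponent hρ hε
  refine integrable_translate isOpen_cutSet (fun w hw y hy => add_mem_cutSet hw hy)
    (differentiableOn_hypKernel j ε).continuousOn h0 (fun b => ?_) (ae_hypMeasure_neg hρ hn)
    (integrable_rexp_hypMeasure hρ h3) hw
  obtain ⟨C, hC⟩ := norm_hypKernel_le j h1 h2 b
  exact ⟨C, fun z _ => hC z⟩

theorem analyticOnNhd_hypInt (hn : 1 ≤ n) (j : ℕ) {ε : ℂ} (hε : ∀ i, -ρ i < ε.re) :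
    AnalyticOnNhd ℂ (hypInt ρ j ε) cutSet := by
  obtain ⟨σ, τ, h0, h1, h2, -, h3⟩ := exists_exponent hρ hε
  refine DifferentiableOn.analyticOnNhd ?_ isOpen_cutSet
  refine differentiableOn_integral_translate isOpen_cutSet (fun w hw y hy => add_mem_cutSet hw hy)
    (differentiableOn_hypKernel j ε) h0 (fun b => ?_) (ae_hypMeasure_neg hρ hn)
    (integrable_rexp_hypMeasure hρ h3)
  obtain ⟨C, hC⟩ := norm_hypKernel_le j h1 h2 b
  exact ⟨C, fun z _ => hC z⟩

/-- Differentiating `e^{εz}` brings down one factor `z`. For exponents within `r` of `ε` the kernel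
is dominated by those at the two real shifts `ε ± r`, up to the factor `e^{r |Im w|}`, because `Im
(w + y)` does not depend on `y`. -/
theorem hasDerivAt_hypInt (hn : 1 ≤ n) (j : ℕ) {ε w : ℂ} (hε : ∀ i, -ρ i < ε.re)
    (hw : w ∈ cutSet) :
    HasDerivAt (fun ε => hypInt ρ j ε w) (hypInt ρ (j + 1) ε w) ε := by
  have hr : ∀ᶠ r in 𝓝[>] (0 : ℝ), ∀ i, -ρ i < ε.re - r :=
    Filter.eventually_all.mpr fun i => nhdsWithin_le_nhds
      (((continuous_const.sub continuous_id).tendsto 0).eventually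
        (lt_mem_nhds (by simpa using hε i)))
  obtain ⟨r, hr, hr0⟩ := (hr.and self_mem_nhdsWithin).exists
  have hr0 : 0 < r := hr0
  have hint : ∀ ε' : ℂ, (∀ i, -ρ i < ε'.re) → Integrable (fun y : ℝ =>
      hypKernel (j + 1) ε' (w + y)) (hypMeasure ρ) := fun ε' h =>
    integrable_hypKernel hρ hn (j + 1) h hw
  refine (hasDerivAt_integral_of_dominated_loc_of_deriv_le
    (F := fun ε (y : ℝ) => hypKernel j ε (w + y))
    (F' := fun ε (y : ℝ) => hypKernel (j + 1) ε (w + y))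
    (bound := fun y : ℝ => Real.exp (r * |w.im|) * (‖hypKernel (j + 1) (ε + r) (w + y)‖ +
      ‖hypKernel (j + 1) (ε - r) (w + y)‖))
    (Metric.ball_mem_nhds ε hr0) ?_ ?_ ?_ ?_ ?_ ?_).2
  · refine Filter.Eventually.of_forall fun z => aestronglyMeasurable_translate
      (fun w hw y hy => add_mem_cutSet hw hy) (differentiableOn_hypKernel j z).continuousOn
      (ae_hypMeasure_neg hρ hn) hw
  · exact integrable_hypKernel hρ hn j hε hw
  · exact (hint ε hε).aestronglyMeasurable
  · refine Filter.Eventually.of_forall fun y z hz => ?_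
    set x : ℂ := w + y with hx
    have him : x.im = w.im := by simp [hx]
    have key : ‖Complex.exp (z * x)‖ ≤ Real.exp (r * |w.im|) *
        (‖Complex.exp ((ε + r) * x)‖ + ‖Complex.exp ((ε - r) * x)‖) := by
      have e1 : ‖Complex.exp (z * x)‖ = ‖Complex.exp (ε * x)‖ * ‖Complex.exp ((z - ε) * x)‖ := by
        rw [← norm_mul, ← Complex.exp_add]
        ring_nf
      have e2 : ‖Complex.exp ((ε + r) * x)‖ = ‖Complex.exp (ε * x)‖ * Real.exp (r * x.re) := by
        rw [add_mul, Complex.exp_add, norm_mul, Complex.norm_exp ((r : ℂ) * x), Complex.re_ofReal_mul]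
      have e3 : ‖Complex.exp ((ε - r) * x)‖ = ‖Complex.exp (ε * x)‖ * Real.exp (-(r * x.re)) := by
        rw [sub_mul, sub_eq_add_neg, Complex.exp_add, norm_mul, Complex.norm_exp (-((r : ℂ) * x)),
          Complex.neg_re, Complex.re_ofReal_mul]
      rw [e1, e2, e3, ← mul_add, mul_left_comm]
      refine mul_le_mul_of_nonneg_left ?_ (norm_nonneg _)
      have h1 : ((z - ε) * x).re ≤ r * |w.im| + |r * x.re| := by
        rw [mem_ball_iff_norm] at hz
        calc ((z - ε) * x).re ≤ ‖(z - ε) * x‖ := Complex.re_le_norm _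
          _ ≤ r * (|x.re| + |x.im|) := by
              rw [norm_mul]
              exact mul_le_mul hz.le (Complex.norm_le_abs_re_add_abs_im x) (norm_nonneg _) hr0.le
          _ = _ := by rw [him, abs_mul, abs_of_pos hr0]; ring
      rw [Complex.norm_exp]
      refine (Real.exp_le_exp.mpr h1).trans ?_
      rw [Real.exp_add]
      refine mul_le_mul_of_nonneg_left ?_ (Real.exp_pos _).le
      rcases abs_cases (r * x.re) with ⟨h, -⟩ | ⟨h, -⟩ <;> rw [h] <;>
        linarith [Real.exp_pos (r * x.re), Real.exp_pos (-(r * x.re))]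
    simp only [hypKernel, norm_div, norm_mul, norm_pow]
    calc ‖x‖ ^ (j + 1) * ‖Complex.exp (z * x)‖ / ‖1 - Complex.exp x‖
        = ‖x‖ ^ (j + 1) / ‖1 - Complex.exp x‖ * ‖Complex.exp (z * x)‖ := by ring
      _ ≤ ‖x‖ ^ (j + 1) / ‖1 - Complex.exp x‖ * (Real.exp (r * |w.im|) *
        (‖Complex.exp ((ε + r) * x)‖ + ‖Complex.exp ((ε - r) * x)‖)) :=
          mul_le_mul_of_nonneg_left key (by positivity)
      _ = _ := by ring
  · refine ((hint _ fun i => ?_).norm.add (hint _ fun i => ?_).norm).const_mul _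
    · simp only [Complex.add_re, Complex.ofReal_re]
      linarith [hε i]
    · simpa using hr i
  · refine Filter.Eventually.of_forall fun y z _ => ?_
    have := ((((hasDerivAt_id z).mul_const (w + (y : ℂ))).cexp.const_mul ((w + (y : ℂ)) ^ j)).div_const
      (1 - Complex.exp (w + y)))
    refine this.congr_deriv ?_
    simp only [hypKernel, id]
    ring

/-! ### The jump across the real axis -/

/-- The strip `|Im w| < 2π`. -/
def bigStrip : Set ℂ := {w | |w.im| < 2 * Real.pi}

omit hρ in
theorem isOpen_bigStrip : IsOpen bigStrip :=
  isOpen_lt (by fun_prop) continuous_const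

/-- The holomorphic extension of `(e^{εz} - 1) / (1 - e^z)` to the strip `|Im z| < 2π`. -/
noncomputable def jumpKernel (ε z : ℂ) : ℂ :=
  -(dslope (fun z => Complex.exp (ε * z)) 0 z / dslope Complex.exp 0 z)

omit hρ in
theorem jumpKernel_of_ne {ε z : ℂ} (hz : z ≠ 0) :
    jumpKernel ε z = hypKernel 0 ε z - hypKernel 0 0 z := by
  rw [jumpKernel, dslope_of_ne _ hz, dslope_of_ne _ hz, slope_def_field, slope_def_field, hypKernel,
    hypKernel]
  simp only [sub_zero, mul_zero, zero_mul, Complex.exp_zero, pow_zero, one_mul]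
  rw [div_div_div_cancel_right₀ hz, ← sub_div, ← div_neg, neg_sub]

omit hρ in
-- In this strip `0` is the only zero of `e^z - 1`, and it is simple. The numerator vanishes there
-- too, so both are divided by `z`.
theorem differentiableOn_jumpKernel (ε : ℂ) : DifferentiableOn ℂ (jumpKernel ε) bigStrip := by
  have h : ∀ f : ℂ → ℂ, Differentiable ℂ f → DifferentiableOn ℂ (dslope f 0) bigStrip :=
    fun f hf => ((Complex.differentiableOn_dslope (s := Set.univ) Filter.univ_mem).mpr
      hf.differentiableOn).mono (Set.subset_univ _)
  refine ((h _ (by fun_prop)).div (h _ Complex.differentiable_exp) fun z hz => ?_).neg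
  rcases eq_or_ne z 0 with rfl | hz0
  · simp [dslope_same]
  · rw [dslope_of_ne _ hz0, slope_def_field]
    refine div_ne_zero (sub_ne_zero.mpr ?_) (sub_ne_zero.mpr hz0)
    rw [Complex.exp_zero]
    intro h1
    obtain ⟨k, hk⟩ := Complex.exp_eq_one_iff.mp h1
    have h2 : z.im = k * (2 * Real.pi) := by rw [hk]; simp
    have h3 : |(k : ℝ)| * (2 * Real.pi) < 1 * (2 * Real.pi) := by
      have : |z.im| < 2 * Real.pi := hz
      rwa [h2, abs_mul, abs_of_pos Real.two_pi_pos, ← one_mul (2 * Real.pi), ← mul_assoc,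
        mul_one] at this
    have h4 : |(k : ℝ)| < 1 := lt_of_mul_lt_mul_right h3 Real.two_pi_pos.le
    have h5 : k = 0 := by
      rw [← Int.abs_lt_one_iff]
      exact_mod_cast h4
    exact hz0 (by rw [hk, h5]; simp)

/-- The holomorphic extension of `hypInt ρ 0 ε - hypInt ρ 0 0` to the strip `|Im w| < 2π`. -/
noncomputable def hypJump (ρ : Fin n → ℝ) (ε w : ℂ) : ℂ :=
  ∫ y : ℝ, jumpKernel ε (w + y) ∂(hypMeasure ρ)

theorem analyticOnNhd_hypJump (hn : 1 ≤ n) {ε : ℂ} (hε : ∀ i, -ρ i < ε.re) :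
    AnalyticOnNhd ℂ (hypJump ρ ε) bigStrip := by
  obtain ⟨σ, τ, h0, h1, h2, h2', h3⟩ := exists_exponent hρ hε
  refine DifferentiableOn.analyticOnNhd ?_ isOpen_bigStrip
  refine differentiableOn_integral_translate isOpen_bigStrip
    (fun w hw y hy => by simpa [bigStrip] using hw)
    (differentiableOn_jumpKernel ε) h0 (fun b => ?_) (ae_hypMeasure_neg hρ hn)
    (integrable_rexp_hypMeasure hρ h3)
  obtain ⟨C, hC⟩ := norm_hypKernel_le 0 h1 h2 b
  obtain ⟨C', hC'⟩ := norm_hypKernel_le 0 (ε := 0) h1 (by simpa using h2') b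
  refine ⟨C + C', fun z _ hz hz' => ?_⟩
  rw [jumpKernel_of_ne (by rintro rfl; norm_num at hz), add_mul]
  exact (norm_sub_le _ _).trans (add_le_add (hC z hz hz') (hC' z hz hz'))

/-- This carries the difference of two integrals across the half-line `Im w = 0`, `Re w ≥ 0`, which
is missing from `cutSet`. -/
theorem hypJump_eq (hn : 1 ≤ n) {ε w : ℂ} (hε : ∀ i, -ρ i < ε.re) (hw : w ∈ cutSet) :
    hypJump ρ ε w = hypInt ρ 0 ε w - hypInt ρ 0 0 w := by
  rw [hypInt, hypInt, ← integral_sub (integrable_hypKernel hρ hn 0 hε hw)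
    (integrable_hypKernel hρ hn 0 (fun i => by simpa using (hρ i).1) hw), hypJump]
  refine integral_congr_ae ?_
  filter_upwards [ae_hypMeasure_neg hρ hn] with y hy
  refine jumpKernel_of_ne fun h => ?_
  exact exp_ne_one_of_mem_cutSet (add_mem_cutSet hw hy.le) (by rw [h, Complex.exp_zero])

end

/-! ### Geometric series of holomorphic functions -/

theorem LocDominated.of_geometric {U : Set ℂ} (hU : IsOpen U) {q : ℂ → ℂ}
    (hq : DifferentiableOn ℂ q U) (hq1 : ∀ w ∈ U, ‖q w‖ < 1) {f : ℕ → ℂ → ℂ}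
    (hf : ∀ k, DifferentiableOn ℂ (f k) U)
    (hb : ∀ w ∈ U, ∃ C : ℝ, ∀ᶠ z in 𝓝 w, ∀ k, ‖f k z‖ ≤ C) :
    LocDominated U fun k w => f k w * q w ^ k where
  differentiableOn k := (hf k).mul (hq.pow k)
  bound w hw := by
    obtain ⟨C, hC⟩ := hb w hw
    have h1 : ∀ᶠ z in 𝓝 w, ‖q z‖ < (1 + ‖q w‖) / 2 :=
      (hq.continuousOn.continuousAt (hU.mem_nhds hw)).norm.eventually
        (gt_mem_nhds (by linarith [hq1 w hw]))
    obtain ⟨δ, hδ, hsub⟩ := Metric.mem_nhds_iff.mp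
      (Filter.inter_mem (hU.mem_nhds hw) (Filter.inter_mem hC h1))
    refine ⟨δ, hδ, fun z hz => (hsub hz).1, fun k => C * ((1 + ‖q w‖) / 2) ^ k,
      (summable_geometric_of_lt_one (by positivity) (by linarith [hq1 w hw])).mul_left C,
      fun k z hz => ?_⟩
    obtain ⟨-, h2, h3⟩ := hsub hz
    rw [norm_mul, norm_pow]
    have h4 : ‖q z‖ < (1 + ‖q w‖) / 2 := h3
    exact mul_le_mul (h2 k) (pow_le_pow_left₀ (norm_nonneg _) h4.le k) (by positivity)
      ((norm_nonneg _).trans (h2 k))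

theorem shiftProd_replicate_exp (n : ℕ) (c s w : ℂ) :
    shiftProd (List.replicate n 0) (fun w => c * Complex.exp (s * w)) w =
      s ^ n * (c * Complex.exp (s * w)) := by
  rw [shiftProd_exp]
  simp

theorem shiftProd_ofFn_exp (ρ : Fin n → ℝ) (c s w : ℂ) :
    shiftProd (List.ofFn ρ) (fun w => c * Complex.exp (s * w)) w =
      (∏ i, (s + (ρ i : ℂ))) * (c * Complex.exp (s * w)) := by
  rw [shiftProd_exp, List.map_ofFn, List.prod_ofFn]
  rfl

/-! ### The Gamma quotient -/

/-- The exponents for which the moments of `hypMeasure ρ` converge. -/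
def expSet (ρ : Fin n → ℝ) : Set ℂ := {ε | ∀ i, -ρ i < ε.re}

theorem isOpen_expSet (ρ : Fin n → ℝ) : IsOpen (expSet ρ) := by
  simp only [expSet, Set.ofPred_forall]
  exact isOpen_iInter_of_finite fun i => isOpen_lt continuous_const Complex.continuous_re

theorem add_natCast_mem_expSet {ρ : Fin n → ℝ} {ε : ℂ} (hε : ε ∈ expSet ρ) (k : ℕ) :
    (k : ℂ) + ε ∈ expSet ρ := fun i => by
  have := hε i
  simp only [Complex.add_re, Complex.natCast_re]
  linarith [k.cast_nonneg (α := ℝ)]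

section

variable {ρ : Fin n → ℝ} (hρ : ∀ i, 0 < ρ i ∧ ρ i < 1)
include hρ

theorem zero_mem_expSet : (0 : ℂ) ∈ expSet ρ := fun i => by simpa using (hρ i).1

theorem re_pos_of_mem_expSet {ε : ℂ} (hε : ε ∈ expSet ρ) (i : Fin n) :
    0 < ((ρ i : ℂ) + ε).re ∧ 0 < (1 + ε).re := by
  have h1 := hε i
  have h2 := hρ i
  simp only [Complex.add_re, Complex.ofReal_re, Complex.one_re]
  constructor <;> linarith

theorem gammaQuot_ne_zero {ε : ℂ} (hε : ε ∈ expSet ρ) : gammaQuot ρ ε ≠ 0 := by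
  refine Finset.prod_ne_zero_iff.mpr fun i _ => div_ne_zero ?_ (mul_ne_zero ?_ ?_)
  · exact Complex.Gamma_ne_zero_of_re_pos (re_pos_of_mem_expSet hρ hε i).1
  · exact Complex.Gamma_ne_zero_of_re_pos (by simpa using (hρ i).1)
  · exact Complex.Gamma_ne_zero_of_re_pos (re_pos_of_mem_expSet hρ hε i).2

theorem gammaQuot_zero : gammaQuot ρ 0 = 1 := by
  refine Finset.prod_eq_one fun i _ => ?_
  rw [add_zero, add_zero, Complex.Gamma_one, mul_one, div_self]
  exact Complex.Gamma_ne_zero_of_re_pos (by simpa using (hρ i).1)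

theorem differentiableOn_gammaQuot : DifferentiableOn ℂ (gammaQuot ρ) (expSet ρ) := by
  have hG : ∀ s : ℂ, 0 < s.re → DifferentiableAt ℂ Complex.Gamma s := fun s hs =>
    Complex.differentiableAt_Gamma s fun m h => by
      rw [h] at hs
      simp at hs
      linarith [m.cast_nonneg (α := ℝ)]
  intro ε hε
  refine DifferentiableAt.differentiableWithinAt ?_
  refine DifferentiableAt.fun_finsetProd fun i _ => ?_
  have h := re_pos_of_mem_expSet hρ hε i
  have h1 : DifferentiableAt ℂ (fun s => Complex.Gamma ((ρ i : ℂ) + s)) ε :=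
    (hG _ h.1).comp ε (by fun_prop)
  have h2 : DifferentiableAt ℂ (fun s => Complex.Gamma (1 + s)) ε :=
    (hG _ h.2).comp ε (by fun_prop)
  refine h1.div (h2.const_mul _) (mul_ne_zero ?_ ?_)
  · exact Complex.Gamma_ne_zero_of_re_pos (by simpa using (hρ i).1)
  · exact Complex.Gamma_ne_zero_of_re_pos h.2

omit hρ in
-- The functional equation of `Γ`, applied factor by factor, is exactly the recursion that makes the
-- series at the origin telescope.
theorem gammaQuot_add_one {s : ℂ} (hs : ∀ i, (ρ i : ℂ) + s ≠ 0) (hs1 : 1 + s ≠ 0) :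
    (s + 1) ^ n * gammaQuot ρ (s + 1) = (∏ i, (s + (ρ i : ℂ))) * gammaQuot ρ s := by
  have e : (s + 1) ^ n = ∏ _i : Fin n, (s + 1) := by simp
  rw [e, gammaQuot, gammaQuot, ← Finset.prod_mul_distrib, ← Finset.prod_mul_distrib]
  refine Finset.prod_congr rfl fun i _ => ?_
  rw [← add_assoc, Complex.Gamma_add_one _ (hs i), ← add_assoc, add_right_comm,
    show (1 : ℂ) + 1 + s = (1 + s) + 1 by ring, Complex.Gamma_add_one _ hs1]
  have : s + 1 ≠ 0 := by rwa [add_comm]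
  field_simp
  ring

theorem gammaQuot_add_one_of_mem {s : ℂ} (hs : s ∈ expSet ρ) (hs0 : 1 + s ≠ 0) :
    (s + 1) ^ n * gammaQuot ρ (s + 1) = (∏ i, (s + (ρ i : ℂ))) * gammaQuot ρ s := by
  refine gammaQuot_add_one (fun i h => ?_) hs0
  have := (re_pos_of_mem_expSet hρ hs i).1
  simp [h] at this

theorem one_add_ne_zero_of_mem (hn : 1 ≤ n) {s : ℂ} (hs : s ∈ expSet ρ) : 1 + s ≠ 0 := fun h => by
  have := (re_pos_of_mem_expSet hρ hs ⟨0, hn⟩).2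
  simp [h] at this

/-- The measure sits on `y < 0`, so moments decrease as `Re s` grows. This bounds all coefficients
`φ(k + ε)` uniformly in `k` without asymptotics of `Γ`. -/
theorem norm_gammaQuot_le (hn : 1 ≤ n) {σ : ℝ} (hσ : ∀ i, -ρ i < -σ) {s : ℂ} (hs : -σ ≤ s.re) :
    ‖gammaQuot ρ s‖ ≤ ∫ y : ℝ, Real.exp (-σ * y) ∂(hypMeasure ρ) := by
  rw [← integral_exp_hypMeasure hρ fun i => (hσ i).trans_le hs]
  refine norm_integral_le_of_norm_le (integrable_rexp_hypMeasure hρ hσ) ?_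
  filter_upwards [ae_hypMeasure_neg hρ hn] with y hy
  rw [Complex.norm_exp, Complex.re_mul_ofReal, Real.exp_le_exp]
  nlinarith

/-! ### The series at `Re w = -∞` -/

/-- Expand `1 / (1 - e^{w+y})` geometrically and integrate term by term; the norms are dominated by
a geometric series of ratio `e^{Re w}`. -/
theorem hasSum_hypInt (hn : 1 ≤ n) {ε w : ℂ} (hε : ε ∈ expSet ρ) (hw : w.re < 0) :
    HasSum (fun k : ℕ => gammaQuot ρ (k + ε) * Complex.exp ((k + ε) * w)) (hypInt ρ 0 ε w) := by
  have hν := ae_hypMeasure_neg hρ hn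
  let F : ℕ → ℝ → ℂ := fun k y => Complex.exp ((k + ε) * w) * Complex.exp ((k + ε) * (y : ℂ))
  have hint : ∀ k, Integrable (F k) (hypMeasure ρ) := fun k =>
    (integrable_exp_hypMeasure hρ (add_natCast_mem_expSet hε k)).const_mul _
  have hle : ∀ k, ∫ y, ‖F k y‖ ∂(hypMeasure ρ) ≤
      (‖Complex.exp (ε * w)‖ * ∫ y, ‖Complex.exp (ε * ((y : ℝ) : ℂ))‖ ∂(hypMeasure ρ)) *
        Real.exp w.re ^ k := fun k => by
    simp only [F, norm_mul]
    rw [integral_const_mul]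
    have h1 : ‖Complex.exp ((k + ε) * w)‖ = ‖Complex.exp (ε * w)‖ * Real.exp w.re ^ k := by
      rw [add_mul, Complex.exp_add, norm_mul, mul_comm, Complex.exp_nat_mul, norm_pow,
        Complex.norm_exp w]
    have h2 : ∫ y : ℝ, ‖Complex.exp ((k + ε) * (y : ℂ))‖ ∂(hypMeasure ρ) ≤
        ∫ y : ℝ, ‖Complex.exp (ε * (y : ℂ))‖ ∂(hypMeasure ρ) := by
      refine integral_mono_ae (integrable_exp_hypMeasure hρ (add_natCast_mem_expSet hε k)).norm
        (integrable_exp_hypMeasure hρ hε).norm ?_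
      filter_upwards [hν] with y hy
      simp only [Complex.norm_exp, Complex.re_mul_ofReal, Real.exp_le_exp, Complex.add_re,
        Complex.natCast_re]
      nlinarith [k.cast_nonneg (α := ℝ)]
    rw [h1]
    calc _ ≤ ‖Complex.exp (ε * w)‖ * Real.exp w.re ^ k *
          ∫ y : ℝ, ‖Complex.exp (ε * (y : ℂ))‖ ∂(hypMeasure ρ) :=
          mul_le_mul_of_nonneg_left h2 (by positivity)
      _ = _ := by ring
  have hsum : Summable fun k => ∫ y, ‖F k y‖ ∂(hypMeasure ρ) :=
    Summable.of_nonneg_of_le (fun k => integral_nonneg fun y => norm_nonneg _) hle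
      ((summable_geometric_of_lt_one (Real.exp_pos _).le (Real.exp_lt_one_iff.mpr hw)).mul_left _)
  have h := hasSum_integral_of_summable_integral_norm hint hsum
  have e1 : (fun k => ∫ y, F k y ∂(hypMeasure ρ)) =
      fun k : ℕ => gammaQuot ρ (k + ε) * Complex.exp ((k + ε) * w) := by
    funext k
    simp only [F]
    rw [integral_const_mul, integral_exp_hypMeasure hρ (add_natCast_mem_expSet hε k), mul_comm]
  have e2 : ∫ y, ∑' k, F k y ∂(hypMeasure ρ) = hypInt ρ 0 ε w := by
    refine integral_congr_ae ?_
    filter_upwards [hν] with y hy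
    have hlt : ‖Complex.exp (w + y)‖ < 1 := by
      rw [Complex.norm_exp, Real.exp_lt_one_iff]
      simp only [Complex.add_re, Complex.ofReal_re]
      linarith
    have : ∀ k : ℕ, F k y = Complex.exp (ε * (w + y)) * Complex.exp (w + y) ^ k := fun k => by
      simp only [F]
      rw [← Complex.exp_add, ← Complex.exp_nat_mul, ← Complex.exp_add]
      congr 1
      ring
    simp only [this]
    rw [tsum_mul_left, tsum_geometric_of_norm_lt_one hlt, hypKernel, pow_zero, one_mul,
      div_eq_mul_inv]
  rwa [e1, e2] at h

omit hρ in
theorem isOpen_re_neg : IsOpen {w : ℂ | w.re < 0} := isOpen_lt Complex.continuous_re continuous_const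

/-- The Frobenius method: with the exponent `ε` left free, everything telescopes except the indicial
contribution of the term `k = 0`. -/
theorem hypOp_hypInt_of_re_neg (hn : 1 ≤ n) {ε w : ℂ} (hε : ε ∈ expSet ρ) (hw : w.re < 0) :
    hypOp ρ (hypInt ρ 0 ε) w = ε ^ n * gammaQuot ρ ε * Complex.exp (ε * w) := by
  let u : ℕ → ℂ → ℂ := fun k w => gammaQuot ρ (k + ε) * Complex.exp ((k + ε) * w)
  obtain ⟨σ, τ, h0, h1, h2, -, h3⟩ := exists_exponent hρ hε
  have hdom : LocDominated {w : ℂ | w.re < 0} u := by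
    have e : u = fun (k : ℕ) w =>
        (gammaQuot ρ (k + ε) * Complex.exp (ε * w)) * Complex.exp w ^ k := by
      funext k w
      simp only [u]
      rw [mul_assoc, ← Complex.exp_nat_mul, ← Complex.exp_add]
      ring_nf
    rw [e]
    refine LocDominated.of_geometric isOpen_re_neg (by fun_prop) (fun w hw => ?_)
      (fun k => by fun_prop) (fun w _ => ?_)
    · rwa [Complex.norm_exp, Real.exp_lt_one_iff]
    · refine ⟨(∫ y : ℝ, Real.exp (-σ * y) ∂(hypMeasure ρ)) * (‖Complex.exp (ε * w)‖ + 1), ?_⟩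
      have hc : ContinuousAt (fun z => ‖Complex.exp (ε * z)‖) w := by fun_prop
      filter_upwards [hc.eventually (gt_mem_nhds (lt_add_one _))] with z hz k
      rw [norm_mul]
      refine mul_le_mul (norm_gammaQuot_le hρ hn h3 ?_) hz.le (norm_nonneg _)
        (integral_nonneg fun y => (Real.exp_pos _).le)
      simp only [Complex.add_re, Complex.natCast_re]
      linarith [k.cast_nonneg (α := ℝ)]
  have heq : Set.EqOn (hypInt ρ 0 ε) (fun w => ∑' k, u k w) {w : ℂ | w.re < 0} := fun z hz =>
    (hasSum_hypInt hρ hn hε hz).tsum_eq.symm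
  rw [hypOp_congr ρ isOpen_re_neg heq hw, hdom.hypOp_tsum_of_telescope ρ hw]
  · simp only [u]
    rw [shiftProd_replicate_exp, Nat.cast_zero, zero_add, mul_assoc]
  · intro k
    have hk := add_natCast_mem_expSet hε k
    simp only [u]
    rw [shiftProd_replicate_exp, shiftProd_ofFn_exp,
      show ((k + 1 : ℕ) : ℂ) + ε = k + ε + 1 by push_cast; ring, add_mul _ 1 w, one_mul,
      Complex.exp_add (_ * w) w]
    linear_combination (Complex.exp ((k + ε) * w) * Complex.exp w) *
      gammaQuot_add_one_of_mem hρ hk (one_add_ne_zero_of_mem hρ hn hk)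

end

/-! ### Derivatives in the exponent -/

/-- Used twice: to remove the inhomogeneity `ε^n φ(ε) e^{εw}`, and to remove the series at infinity
from the connection formula. -/
theorem iteratedDeriv_pow_mul_eq_zero {m n : ℕ} (hmn : m < n) {h : ℂ → ℂ} (hh : AnalyticAt ℂ h 0) :
    iteratedDeriv m (fun ε => ε ^ n * h ε) 0 = 0 := by
  have ha : AnalyticAt ℂ (fun ε : ℂ => ε ^ n * h ε) 0 := (analyticAt_id.pow n).mul hh
  refine (natCast_le_analyticOrderAt_iff_iteratedDeriv_eq_zero ha).mp ?_ m hmn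
  rw [natCast_le_analyticOrderAt ha]
  exact ⟨h, hh, by simp⟩

/-- `∂ᵐ/∂εᵐ [g(ε) e^{(κ + ε) w}]` at `ε = 0`. -/
noncomputable def expDeriv (m : ℕ) (κ : ℂ) (g : ℂ → ℂ) (w : ℂ) : ℂ :=
  iteratedDeriv m (fun ε => g ε * Complex.exp ((κ + ε) * w)) 0

theorem expDeriv_eq_sum (m : ℕ) (κ : ℂ) {g : ℂ → ℂ} (hg : AnalyticAt ℂ g 0) (w : ℂ) :
    expDeriv m κ g w = ∑ i ∈ Finset.range (m + 1),
      m.choose i * iteratedDeriv i g 0 * (w ^ (m - i) * Complex.exp (κ * w)) := by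
  have h : ∀ j : ℕ, iteratedDeriv j (fun ε => Complex.exp ((κ + ε) * w)) 0 =
      w ^ j * Complex.exp (κ * w) := fun j => by
    have e : (fun ε => Complex.exp ((κ + ε) * w)) =
        fun ε => Complex.exp (κ * w) * Complex.exp (w * ε) := by
      funext ε
      rw [← Complex.exp_add]
      ring_nf
    rw [e, iteratedDeriv_const_mul_field, iteratedDeriv_cexp_const_mul]
    simp [mul_comm]
  have ha : AnalyticAt ℂ (fun ε => Complex.exp ((κ + ε) * w)) 0 := by fun_prop
  rw [expDeriv, iteratedDeriv_fun_mul hg.contDiffAt ha.contDiffAt]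
  simp only [h]

theorem iteratedDeriv_id_mul {g : ℂ → ℂ} (hg : AnalyticAt ℂ g 0) (i : ℕ) :
    iteratedDeriv (i + 1) (fun ε => ε * g ε) 0 = (i + 1) * iteratedDeriv i g 0 := by
  rw [iteratedDeriv_fun_mul contDiffAt_fun_id hg.contDiffAt, Finset.sum_eq_single 1]
  · simp [iteratedDeriv_fun_id_zero]
  · intro b _ hb
    simp [iteratedDeriv_fun_id_zero, hb]
  · simp

/-- Differentiation in `w` commutes with `∂ᵐ/∂εᵐ` and multiplies the generating function by `κ + ε`.
The exchange is checked on the explicit form, a polynomial in `w` times `e^{κw}`, where it reduces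
to `(i + 1) C(m, i + 1) = (m - i) C(m, i)`. -/
theorem hasDerivAt_expDeriv (m : ℕ) (κ : ℂ) {g : ℂ → ℂ} (hg : AnalyticAt ℂ g 0) (w : ℂ) :
    HasDerivAt (expDeriv m κ g) (expDeriv m κ (fun ε => (κ + ε) * g ε) w) w := by
  have hid : AnalyticAt ℂ (fun ε : ℂ => ε * g ε) 0 := analyticAt_id.mul hg
  have hlin : expDeriv m κ (fun ε => (κ + ε) * g ε) w =
      κ * expDeriv m κ g w + expDeriv m κ (fun ε => ε * g ε) w := by
    simp only [expDeriv, add_mul, mul_assoc]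
    rw [iteratedDeriv_fun_add, iteratedDeriv_const_mul_field]
    · exact (AnalyticAt.contDiffAt (by fun_prop))
    · exact (AnalyticAt.contDiffAt (by fun_prop))
  have hsucc : expDeriv m κ (fun ε => ε * g ε) w = ∑ i ∈ Finset.range (m + 1),
      m.choose i * iteratedDeriv i g 0 * (((m - i : ℕ) : ℂ) * w ^ (m - i - 1) *
        Complex.exp (κ * w)) := by
    rw [expDeriv_eq_sum m κ hid, Finset.sum_range_succ', Finset.sum_range_succ]
    simp only [iteratedDeriv_zero, zero_mul, mul_zero, add_zero, Nat.sub_self, Nat.cast_zero]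
    refine Finset.sum_congr rfl fun i hi => ?_
    have hc : ((m.choose (i + 1) : ℕ) : ℂ) * (i + 1) = m.choose i * ((m - i : ℕ) : ℂ) := by
      exact_mod_cast Nat.choose_succ_right_eq m i
    rw [iteratedDeriv_id_mul hg, Nat.sub_sub]
    linear_combination (iteratedDeriv i g 0 * (w ^ (m - (i + 1)) * Complex.exp (κ * w))) * hc
  have hfun : expDeriv m κ g = fun w => ∑ i ∈ Finset.range (m + 1),
      m.choose i * iteratedDeriv i g 0 * (w ^ (m - i) * Complex.exp (κ * w)) :=
    funext fun w => expDeriv_eq_sum m κ hg w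
  rw [hlin, hsucc, expDeriv_eq_sum m κ hg, hfun, Finset.mul_sum, ← Finset.sum_add_distrib]
  refine HasDerivAt.fun_sum fun i _ => ?_
  have h1 := (hasDerivAt_pow (m - i) w).mul ((hasDerivAt_id w).const_mul κ).cexp
  refine (h1.const_mul (m.choose i * iteratedDeriv i g 0)).congr_deriv ?_
  simp only [id]
  ring

theorem shiftProd_expDeriv (l : List ℝ) (m : ℕ) (κ : ℂ) {g : ℂ → ℂ} (hg : AnalyticAt ℂ g 0) :
    shiftProd l (expDeriv m κ g) =
      expDeriv m κ (fun ε => (l.map fun r : ℝ => κ + ε + (r : ℂ)).prod * g ε) := by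
  induction l with
  | nil => simp [shiftProd_nil]
  | cons r l ih =>
    have hP : AnalyticAt ℂ (fun ε => (l.map fun r : ℝ => κ + ε + (r : ℂ)).prod) 0 := by
      clear ih
      induction l with
      | nil => exact analyticAt_const
      | cons r l ih =>
        have : AnalyticAt ℂ (fun ε : ℂ => κ + ε + (r : ℂ)) 0 := by fun_prop
        simpa using! this.mul ih
    have hPg := hP.fun_mul hg
    funext w
    simp only [shiftProd_cons, ih]
    rw [(hasDerivAt_expDeriv m κ hPg w).deriv]
    simp only [expDeriv]
    rw [← iteratedDeriv_const_mul_field, ← iteratedDeriv_fun_add]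
    · congr 1
      funext ε
      simp only [List.map_cons, List.prod_cons]
      ring
    · exact ((((analyticAt_const.fun_add analyticAt_id).fun_mul hPg).mul (by fun_prop))).contDiffAt
    · exact (analyticAt_const.mul (hPg.mul (by fun_prop))).contDiffAt

/-! ### The solutions at the origin -/

/-- `C^{-ε} ∏ᵢ Γ(ρᵢ) Γ(1 + ε) / Γ(ρᵢ + ε)`. -/
noncomputable def expFactor (ρ : Fin n → ℝ) (C : ℝ) (ε : ℂ) : ℂ :=
  (C : ℂ) ^ (-ε) * (gammaQuot ρ ε)⁻¹

/-- The solutions `f̃ₘ` in the coordinate `w = log (C t)`. -/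
noncomputable def logSolZero (ρ : Fin n → ℝ) (C : ℝ) (m : ℕ) (w : ℂ) : ℂ :=
  iteratedDeriv m (fun ε => expFactor ρ C ε * hypInt ρ 0 ε w) 0
    / ((2 * (Real.pi : ℂ) * Complex.I) ^ m * (m ! : ℂ))

section

variable {ρ : Fin n → ℝ} (hρ : ∀ i, 0 < ρ i ∧ ρ i < 1)
include hρ

theorem analyticAt_gammaQuot {ε : ℂ} (hε : ε ∈ expSet ρ) : AnalyticAt ℂ (gammaQuot ρ) ε :=
  (differentiableOn_gammaQuot hρ).analyticAt ((isOpen_expSet ρ).mem_nhds hε)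

theorem analyticAt_expFactor {C : ℝ} (hC : 0 < C) {ε : ℂ} (hε : ε ∈ expSet ρ) :
    AnalyticAt ℂ (expFactor ρ C) ε := by
  have hC' : (C : ℂ) ∈ Complex.slitPlane := Complex.ofReal_mem_slitPlane.mpr hC
  exact (analyticAt_const.cpow analyticAt_id.neg hC').mul
    ((analyticAt_gammaQuot hρ hε).inv (gammaQuot_ne_zero hρ hε))

theorem analyticAt_hypInt_exponent (hn : 1 ≤ n) (j : ℕ) {ε w : ℂ} (hε : ε ∈ expSet ρ)
    (hw : w ∈ cutSet) : AnalyticAt ℂ (fun ε => hypInt ρ j ε w) ε := by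
  have : DifferentiableOn ℂ (fun ε => hypInt ρ j ε w) (expSet ρ) := fun ε hε =>
    (hasDerivAt_hypInt hρ hn j hε hw).differentiableAt.differentiableWithinAt
  exact this.analyticAt ((isOpen_expSet ρ).mem_nhds hε)

theorem iteratedDeriv_hypInt (hn : 1 ≤ n) (j : ℕ) {ε w : ℂ} (hε : ε ∈ expSet ρ)
    (hw : w ∈ cutSet) : iteratedDeriv j (fun ε => hypInt ρ 0 ε w) ε = hypInt ρ j ε w := by
  induction j generalizing ε with
  | zero => simp
  | succ j ih =>
    rw [iteratedDeriv_succ]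
    have : iteratedDeriv j (fun ε => hypInt ρ 0 ε w) =ᶠ[𝓝 ε] fun ε => hypInt ρ j ε w :=
      Filter.eventually_of_mem ((isOpen_expSet ρ).mem_nhds hε) fun z hz => ih hz
    rw [this.deriv_eq, (hasDerivAt_hypInt hρ hn j hε hw).deriv]

/-- Leibniz' rule writes `f̃ₘ` as a finite combination of the integrals with kernels `zʲ / (1 -
e^z)`, which are holomorphic on all of `cutSet`. -/
theorem analyticOnNhd_logSolZero (hn : 1 ≤ n) {C : ℝ} (hC : 0 < C) (m : ℕ) :
    AnalyticOnNhd ℂ (logSolZero ρ C m) cutSet := by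
  have h0 := zero_mem_expSet hρ
  have heq : Set.EqOn (logSolZero ρ C m) (fun w => (∑ i ∈ Finset.range (m + 1),
      m.choose i * iteratedDeriv i (expFactor ρ C) 0 * hypInt ρ (m - i) 0 w)
      / ((2 * (Real.pi : ℂ) * Complex.I) ^ m * (m ! : ℂ))) cutSet := fun w hw => by
    rw [logSolZero, iteratedDeriv_fun_mul (analyticAt_expFactor hρ hC h0).contDiffAt
      (analyticAt_hypInt_exponent hρ hn 0 h0 hw).contDiffAt]
    simp only [iteratedDeriv_hypInt hρ hn _ h0 hw]
  refine AnalyticOnNhd.congr isOpen_cutSet ?_ heq.symm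
  exact (Finset.analyticOnNhd_fun_sum _ fun i _ =>
    analyticOnNhd_const.mul (analyticOnNhd_hypInt hρ hn _ h0)).div analyticOnNhd_const
      fun _ _ => mul_ne_zero (pow_ne_zero _ Complex.two_pi_I_ne_zero)
        (by exact_mod_cast m.factorial_ne_zero)

/-- The `m`-th `ε`-derivative at `0` of the Frobenius equation: its right side is divisible by `ε^n`
and `m < n`. The derivative is taken term by term, with Cauchy estimates on a circle of radius `σ`
around `ε = 0`. -/
theorem hypOp_logSolZero (hn : 1 ≤ n) {C : ℝ} (hC : 0 < C) {m : ℕ} (hm : m < n) {w : ℂ}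
    (hw : w.re < 0) : hypOp ρ (logSolZero ρ C m) w = 0 := by
  have h0 := zero_mem_expSet hρ
  obtain ⟨σ, τ, hσ0, hτ, hτσ, -, hσ⟩ := exists_exponent hρ h0
  have hσ' : 0 < σ := by
    simp only [Complex.zero_re] at hτσ
    linarith
  have hball : ∀ ε ∈ Metric.closedBall (0 : ℂ) σ, -σ ≤ ε.re := fun ε hε => by
    rw [mem_closedBall_zero_iff] at hε
    linarith [neg_abs_le ε.re, Complex.abs_re_le_norm ε]
  have hballE : Metric.closedBall (0 : ℂ) σ ⊆ expSet ρ := fun ε hε i =>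
    (hσ i).trans_le (hball ε hε)
  have hgd : ∀ (k : ℕ) ε, ε ∈ expSet ρ →
      AnalyticAt ℂ (fun ε => expFactor ρ C ε * gammaQuot ρ (k + ε)) ε := fun k ε hε =>
    (analyticAt_expFactor hρ hC hε).mul ((analyticAt_gammaQuot hρ
      (add_natCast_mem_expSet hε k)).comp_of_eq (analyticAt_const.add analyticAt_id) rfl)
  obtain ⟨M, hM⟩ := (isCompact_closedBall (0 : ℂ) σ).exists_bound_of_continuousOn
    (f := expFactor ρ C) (fun ε hε =>
      (analyticAt_expFactor hρ hC (hballE hε)).continuousAt.continuousWithinAt)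
  set K := ∫ y : ℝ, Real.exp (-σ * y) ∂(hypMeasure ρ) with hK
  have hK0 : 0 ≤ K := integral_nonneg fun y => (Real.exp_pos _).le
  have hM0 : 0 ≤ M := (norm_nonneg _).trans (hM 0 (Metric.mem_closedBall_self hσ0))
  have hgb : ∀ (k : ℕ) ε, ε ∈ Metric.closedBall (0 : ℂ) σ →
      ‖expFactor ρ C ε * gammaQuot ρ (k + ε)‖ ≤ M * K := fun k ε hε => by
    rw [norm_mul]
    refine mul_le_mul (hM ε hε) (norm_gammaQuot_le hρ hn hσ ?_) (norm_nonneg _) hM0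
    simp only [Complex.add_re, Complex.natCast_re]
    linarith [k.cast_nonneg (α := ℝ), hball ε hε]
  have hexp : ∀ (z : ℂ) ε, ε ∈ Metric.closedBall (0 : ℂ) σ →
      ‖Complex.exp (ε * z)‖ ≤ Real.exp (σ * ‖z‖) := fun z ε hε => by
    rw [Complex.norm_exp, Real.exp_le_exp]
    refine (Complex.re_le_norm _).trans ?_
    rw [norm_mul]
    exact mul_le_mul_of_nonneg_right (mem_closedBall_zero_iff.mp hε) (norm_nonneg z)
  let g : ℕ → ℂ → ℂ := fun k ε => expFactor ρ C ε * gammaQuot ρ (k + ε)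
  have hg0 : ∀ k, AnalyticAt ℂ (g k) 0 := fun k => hgd k 0 h0
  -- Splitting off `e^{kz}`, which does not depend on `ε`, leaves factors bounded uniformly in `k`
  -- and displays the geometric decay.
  have hpull : ∀ (k : ℕ) z, expDeriv m k (g k) z = expDeriv m 0 (g k) z * Complex.exp z ^ k :=
    fun k z => by
      rw [expDeriv, expDeriv, ← Complex.exp_nat_mul, mul_comm (iteratedDeriv _ _ _),
        ← iteratedDeriv_const_mul_field]
      congr 1
      funext ε
      rw [mul_left_comm, ← Complex.exp_add]
      ring_nf
  have hder : ∀ (k : ℕ) (κ w : ℂ), DifferentiableAt ℂ (expDeriv m κ (g k)) w := fun k κ w =>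
    (hasDerivAt_expDeriv m κ (hg0 k) w).differentiableAt
  have hw_dom : LocDominated {w : ℂ | w.re < 0} fun k => expDeriv m k (g k) := by
    rw [show (fun (k : ℕ) => expDeriv m k (g k)) =
      fun k z => expDeriv m 0 (g k) z * Complex.exp z ^ k from funext fun k => funext (hpull k)]
    refine LocDominated.of_geometric isOpen_re_neg (by fun_prop) (fun w hw => ?_)
      (fun k z _ => (hder k 0 z).differentiableWithinAt) (fun w _ => ?_)
    · rwa [Complex.norm_exp, Real.exp_lt_one_iff]
    · refine ⟨m ! * (M * K * Real.exp (σ * (‖w‖ + 1))) / σ ^ m, ?_⟩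
      filter_upwards [continuous_norm.continuousAt.eventually (gt_mem_nhds (lt_add_one ‖w‖))]
        with z hz k
      refine Complex.norm_iteratedDeriv_le_of_forall_mem_sphere_norm_le m hσ' ?_ fun ε hε => ?_
      · refine DifferentiableOn.diffContOnCl_ball (U := expSet ρ) (fun ε hε => ?_) hballE
        exact ((hgd k ε hε).differentiableAt.mul (by fun_prop)).differentiableWithinAt
      · have hε' := Metric.sphere_subset_closedBall hε
        rw [norm_mul, zero_add]
        refine mul_le_mul (hgb k ε hε') ((hexp z ε hε').trans ?_) (norm_nonneg _) (by positivity)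
        rw [Real.exp_le_exp]
        exact mul_le_mul_of_nonneg_left hz.le hσ0
  set c : ℂ := ((2 * (Real.pi : ℂ) * Complex.I) ^ m * (m ! : ℂ))⁻¹ with hc
  -- The sum over the one-element set `{0}` serves to pull the constant `c` out by `hypOp_sum`.
  have heq : Set.EqOn (logSolZero ρ C m)
      (fun w => ∑ _i ∈ ({0} : Finset ℕ), c * ∑' k : ℕ, expDeriv m k (g k) w)
      {w : ℂ | w.re < 0} := fun z hz => by
    have hz' : ‖Complex.exp z‖ < 1 := by
      rw [Complex.norm_exp, Real.exp_lt_one_iff]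
      exact hz
    have hdom : LocDominated (Metric.ball (0 : ℂ) σ)
        fun k ε => (g k ε * Complex.exp (ε * z)) * Complex.exp z ^ k := by
      refine LocDominated.of_geometric Metric.isOpen_ball (by fun_prop) (fun _ _ => hz')
        (fun k ε hε => ?_) (fun ε hε => ⟨M * K * Real.exp (σ * ‖z‖), ?_⟩)
      · exact ((hgd k ε (hballE (Metric.ball_subset_closedBall hε))).differentiableAt.mul
          (by fun_prop)).differentiableWithinAt
      · refine Filter.eventually_of_mem (Metric.isOpen_ball.mem_nhds hε) fun ε hε k => ?_
        have hε' := Metric.ball_subset_closedBall hε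
        rw [norm_mul]
        exact mul_le_mul (hgb k ε hε') (hexp z ε hε') (norm_nonneg _) (by positivity)
    have h1 : (fun ε => expFactor ρ C ε * hypInt ρ 0 ε z) =ᶠ[𝓝 0]
        fun ε => ∑' k, (g k ε * Complex.exp (ε * z)) * Complex.exp z ^ k := by
      refine Filter.eventually_of_mem ((isOpen_expSet ρ).mem_nhds h0) fun ε hε => ?_
      beta_reduce
      rw [← (hasSum_hypInt hρ hn hε hz).tsum_eq, ← tsum_mul_left]
      refine tsum_congr fun k => ?_
      simp only [g]
      rw [add_mul, Complex.exp_add, Complex.exp_nat_mul]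
      ring
    simp only [Finset.sum_singleton]
    rw [logSolZero, h1.iteratedDeriv_eq, hdom.iteratedDeriv_tsum m (Metric.mem_ball_self hσ'),
      div_eq_inv_mul]
    congr 1
    refine tsum_congr fun k => ?_
    rw [expDeriv]
    congr 1
    funext ε
    rw [add_mul, Complex.exp_add, Complex.exp_nat_mul]
    ring
  rw [hypOp_congr ρ isOpen_re_neg heq hw, hypOp_sum ρ {0} isOpen_re_neg
    (F := fun _ w => ∑' k : ℕ, expDeriv m k (g k) w)
    (fun _ _ => hw_dom.analyticOnNhd_tsum) (fun _ => c) hw]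
  simp only [Finset.sum_singleton]
  rw [hw_dom.hypOp_tsum_of_telescope ρ hw]
  · rw [shiftProd_expDeriv _ _ _ (hg0 0), expDeriv]
    refine mul_eq_zero_of_right _ ?_
    have : ∀ ε : ℂ, ((List.replicate n (0 : ℝ)).map fun r : ℝ => ((0 : ℕ) : ℂ) + ε + (r : ℂ)).prod
        * g 0 ε * Complex.exp ((((0 : ℕ) : ℂ) + ε) * w) =
        ε ^ n * (g 0 ε * Complex.exp ((((0 : ℕ) : ℂ) + ε) * w)) := fun ε => by simp [mul_assoc]
    simp only [this]
    exact iteratedDeriv_pow_mul_eq_zero hm ((hg0 0).fun_mul (by fun_prop))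
  · intro k
    rw [shiftProd_expDeriv _ _ _ (hg0 k), shiftProd_expDeriv _ _ _ (hg0 (k + 1)),
      expDeriv, expDeriv, ← iteratedDeriv_const_mul_field]
    refine Filter.EventuallyEq.iteratedDeriv_eq _ ?_
    refine Filter.eventually_of_mem ((isOpen_expSet ρ).mem_nhds h0) fun ε hε => ?_
    have hk := add_natCast_mem_expSet hε k
    have hrec := gammaQuot_add_one_of_mem hρ hk (one_add_ne_zero_of_mem hρ hn hk)
    simp only [g]
    rw [List.map_ofFn, List.prod_ofFn, List.map_replicate, List.prod_replicate,
      show ((k + 1 : ℕ) : ℂ) + ε = k + ε + 1 by push_cast; ring, add_mul _ 1 w, one_mul,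
      Complex.exp_add (_ * w) w, Complex.ofReal_zero, add_zero]
    simp only [Function.comp_apply]
    linear_combination (expFactor ρ C ε * Complex.exp ((k + ε) * w) * Complex.exp w) * hrec

/-! ### Identification with the generating function -/

theorem gammaQuot_add_natCast (hn : 1 ≤ n) {ε : ℂ} (hε : ε ∈ expSet ρ) (k : ℕ) :
    gammaQuot ρ (k + ε) = gammaQuot ρ ε * ((∏ i, (ascPochhammer ℂ k).eval ((ρ i : ℂ) + ε))
      / ((ascPochhammer ℂ k).eval (1 + ε)) ^ n) := by
  have hne : ∀ k : ℕ, (ascPochhammer ℂ k).eval (1 + ε) ≠ 0 := fun k => by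
    induction k with
    | zero => simp
    | succ k ih =>
      rw [ascPochhammer_succ_eval]
      refine mul_ne_zero ih ?_
      have := one_add_ne_zero_of_mem hρ hn (add_natCast_mem_expSet hε k)
      rwa [add_assoc, add_comm ε]
  induction k with
  | zero => simp
  | succ k ih =>
    have hk := add_natCast_mem_expSet hε k
    have h1 := one_add_ne_zero_of_mem hρ hn hk
    have hrec := gammaQuot_add_one_of_mem hρ hk h1
    have h1' : (k + ε + 1 : ℂ) ^ n ≠ 0 := pow_ne_zero _ (by rwa [add_comm])
    rw [show ((k + 1 : ℕ) : ℂ) + ε = k + ε + 1 by push_cast; ring]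
    refine mul_left_cancel₀ h1' ?_
    rw [hrec, ih]
    simp only [ascPochhammer_succ_eval, Finset.prod_mul_distrib, mul_pow]
    rw [show (1 : ℂ) + ε + k = k + ε + 1 by ring, Finset.prod_congr rfl fun i _ =>
      show (k : ℂ) + ε + ρ i = ρ i + ε + k by ring]
    have := pow_ne_zero n (hne k)
    field_simp

theorem gammaQuot_mul_genFun (hn : 1 ≤ n) {ε t : ℂ} (hε : ε ∈ expSet ρ) (ht : t ≠ 0)
    (ht1 : ‖t‖ < 1) : gammaQuot ρ ε * genFun ρ ε t = hypInt ρ 0 ε (Complex.log t) := by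
  have hw : (Complex.log t).re < 0 := by
    rw [Complex.log_re]
    exact Real.log_neg (norm_pos_iff.mpr ht) ht1
  rw [← (hasSum_hypInt hρ hn hε hw).tsum_eq, genFun, ← mul_assoc, ← tsum_mul_left]
  refine tsum_congr fun k => ?_
  rw [gammaQuot_add_natCast hρ hn hε, add_mul, Complex.exp_add, Complex.exp_nat_mul,
    Complex.exp_log ht, Complex.cpow_def_of_ne_zero ht, mul_comm ε]
  ring

theorem solZero_eq_logSolZero (hn : 1 ≤ n) {C : ℝ} (hC : 0 < C) (m : ℕ) {t : ℂ} (ht : t ≠ 0)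
    (ht1 : ‖t‖ < 1 / C) : solZero ρ C m t = logSolZero ρ C m (Complex.log ((C : ℂ) * t)) := by
  rw [solZero, logSolZero]
  congr 1
  refine Filter.EventuallyEq.iteratedDeriv_eq _ ?_
  refine Filter.eventually_of_mem ((isOpen_expSet ρ).mem_nhds (zero_mem_expSet hρ)) fun ε hε => ?_
  have hCt : (C : ℂ) * t ≠ 0 := mul_ne_zero (by exact_mod_cast hC.ne') ht
  have hCt1 : ‖(C : ℂ) * t‖ < 1 := by
    rw [norm_mul, Complex.norm_real, Real.norm_of_nonneg hC.le, mul_comm]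
    exact (lt_div_iff₀ hC).mp ht1
  have := gammaQuot_ne_zero hρ hε
  simp only [expFactor]
  rw [← gammaQuot_mul_genFun hρ hn hε hCt hCt1]
  field_simp

/-! ### Monodromy and linear independence at the origin -/

omit hρ in
theorem exp_two_pi_I_mul_natCast (k : ℕ) : Complex.exp (2 * Real.pi * Complex.I * k) = 1 := by
  rw [mul_comm]
  exact Complex.exp_nat_mul_two_pi_mul_I k

omit hρ in
-- The denominator of the kernel is `2πi`-periodic; only `e^{εz}` changes, by a factor independent
-- of the integration variable.
theorem hypInt_zero_add (ε w : ℂ) (k : ℕ) :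
    hypInt ρ 0 ε (w + 2 * Real.pi * Complex.I * k) =
      Complex.exp (2 * Real.pi * Complex.I * k * ε) * hypInt ρ 0 ε w := by
  rw [hypInt, hypInt, ← integral_const_mul]
  congr 1
  funext y
  simp only [hypKernel, pow_zero, one_mul]
  rw [add_right_comm, Complex.exp_add (_ + _), exp_two_pi_I_mul_natCast, mul_add ε, Complex.exp_add]
  ring_nf

/-- Leibniz' rule for the factor `e^{2πikε}`; the normalisation by `(2πi)^m m!` turns its
coefficients into `k^j / j!`. -/
theorem logSolZero_add (hn : 1 ≤ n) {C : ℝ} (hC : 0 < C) (m : ℕ) {w : ℂ} (hw : w ∈ cutSet)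
    (k : ℕ) : logSolZero ρ C m (w + 2 * Real.pi * Complex.I * k) =
      ∑ j ∈ Finset.range (m + 1), (k : ℂ) ^ j / j ! * logSolZero ρ C (m - j) w := by
  have h0 := zero_mem_expSet hρ
  have h1 : AnalyticAt ℂ (fun ε => expFactor ρ C ε * hypInt ρ 0 ε w) 0 :=
    (analyticAt_expFactor hρ hC h0).mul (analyticAt_hypInt_exponent hρ hn 0 h0 hw)
  have h2 : AnalyticAt ℂ (fun ε => Complex.exp (2 * Real.pi * Complex.I * k * ε)) 0 := by
    fun_prop
  have h3 : ∀ ε, expFactor ρ C ε * (Complex.exp (2 * Real.pi * Complex.I * k * ε) *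
      hypInt ρ 0 ε w) = Complex.exp (2 * Real.pi * Complex.I * k * ε) *
      (expFactor ρ C ε * hypInt ρ 0 ε w) := fun ε => by ring
  simp only [logSolZero, hypInt_zero_add, h3]
  rw [iteratedDeriv_fun_mul h2.contDiffAt h1.contDiffAt, Finset.sum_div]
  refine Finset.sum_congr rfl fun j hj => ?_
  have hj' : j ≤ m := Nat.lt_succ_iff.mp (Finset.mem_range.mp hj)
  rw [iteratedDeriv_cexp_const_mul, Nat.cast_choose ℂ hj']
  simp only [mul_zero, Complex.exp_zero, mul_one]
  have e : (2 * (Real.pi : ℂ) * Complex.I) ^ m =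
      (2 * Real.pi * Complex.I) ^ j * (2 * Real.pi * Complex.I) ^ (m - j) := by
    rw [← pow_add, Nat.add_sub_cancel' hj']
  have hp := Complex.two_pi_I_ne_zero
  have hp1 := pow_ne_zero j hp
  have hp2 := pow_ne_zero (m - j) hp
  have hf1 : (m ! : ℂ) ≠ 0 := by exact_mod_cast m.factorial_ne_zero
  have hf2 : (j ! : ℂ) ≠ 0 := by exact_mod_cast j.factorial_ne_zero
  have hf3 : ((m - j)! : ℂ) ≠ 0 := by exact_mod_cast (m - j).factorial_ne_zero
  rw [e, mul_pow _ (k : ℂ)]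
  generalize (2 * (Real.pi : ℂ) * Complex.I) ^ j = a at *
  generalize (2 * (Real.pi : ℂ) * Complex.I) ^ (m - j) = b at *
  field_simp

/-- On the negative axis the kernel `1 / (1 - e^{x+y})` is at least `1`, and the measure has mass
one. -/
theorem logSolZero_zero_ne_zero (hn : 1 ≤ n) {C : ℝ} (hC : 0 < C) {x : ℝ} (hx : x < 0) :
    logSolZero ρ C 0 x ≠ 0 := by
  have := isProbabilityMeasure_hypMeasure hρ
  have hxc : (x : ℂ) ∈ cutSet := mem_cutSet_of_re_neg (by simpa using hx)
  have hi := integrable_hypKernel hρ hn 0 (ε := 0) (zero_mem_expSet hρ) hxc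
  have hre : 1 ≤ (hypInt ρ 0 0 x).re := by
    rw [hypInt, ← RCLike.re_to_complex, ← integral_re hi]
    have h1 : ∫ _y : ℝ, (1 : ℝ) ∂(hypMeasure ρ) = 1 := by simp
    rw [← h1]
    refine integral_mono_ae (integrable_const _) hi.re ?_
    filter_upwards [ae_hypMeasure_neg hρ hn] with y hy
    have h2 : hypKernel 0 0 ((x : ℂ) + (y : ℂ)) = ((1 / (1 - Real.exp (x + y)) : ℝ) : ℂ) := by
      simp [hypKernel]
    have h3 : Real.exp (x + y) < 1 := Real.exp_lt_one_iff.mpr (by linarith)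
    rw [h2, RCLike.re_to_complex, Complex.ofReal_re, le_div_iff₀ (by linarith)]
    linarith [Real.exp_pos (x + y)]
  have hne : hypInt ρ 0 0 x ≠ 0 := fun h => by
    rw [h, Complex.zero_re] at hre
    linarith
  have hC' : (C : ℂ) ≠ 0 := by exact_mod_cast hC.ne'
  simpa [logSolZero, expFactor, gammaQuot_zero hρ, hC'] using hne

/-- Along `w = -1 + 2πik` a linear relation is polynomial in `k`. It vanishes for all natural `k`,
hence identically, but its coefficient at the largest index `M` with `c M ≠ 0` is a nonzero multiple
of `f̃₀`. -/
theorem logSolZero_linearIndependent (hn : 1 ≤ n) {C : ℝ} (hC : 0 < C) {c : Fin n → ℂ}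
    (hc : ∀ w : ℂ, w.re < 0 → ∑ m, c m * logSolZero ρ C m w = 0) : c = 0 := by
  classical
  by_contra hne
  obtain ⟨i, hi⟩ := Function.ne_iff.mp hne
  obtain ⟨M, hM, hmax⟩ := (Finset.univ.filter fun m => c m ≠ 0).exists_max_image id
    ⟨i, by simpa using hi⟩
  have hxre : ((-1 : ℝ) : ℂ).re < 0 := by simp
  have hxc := mem_cutSet_of_re_neg hxre
  let p : Polynomial ℂ := ∑ m : Fin n, ∑ j ∈ Finset.range ((m : ℕ) + 1),
    Polynomial.C (c m / j ! * logSolZero ρ C (m - j) ((-1 : ℝ) : ℂ)) * Polynomial.X ^ j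
  have hp : p = 0 := by
    refine Polynomial.eq_zero_of_infinite_isRoot p (Set.Infinite.mono ?_
      (Set.infinite_range_of_injective (Nat.cast_injective (R := ℂ))))
    rintro _ ⟨k, rfl⟩
    have h := hc (((-1 : ℝ) : ℂ) + 2 * Real.pi * Complex.I * k) (by simp)
    change p.eval (k : ℂ) = 0
    rw [← h]
    simp only [p, Polynomial.eval_finsetSum, Polynomial.eval_mul, Polynomial.eval_C,
      Polynomial.eval_pow, Polynomial.eval_X]
    refine Finset.sum_congr rfl fun m _ => ?_
    rw [logSolZero_add hρ hn hC _ hxc, Finset.mul_sum]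
    exact Finset.sum_congr rfl fun j _ => by ring
  have hcoeff : p.coeff M = c M / (M : ℕ)! * logSolZero ρ C 0 ((-1 : ℝ) : ℂ) := by
    simp only [p, Polynomial.finsetSum_coeff, Polynomial.coeff_C_mul_X_pow]
    rw [Finset.sum_eq_single M]
    · simp
    · intro m _ hmM
      rcases lt_or_gt_of_ne hmM with h | h
      · refine Finset.sum_eq_zero fun j hj => if_neg fun hj' => ?_
        have := Finset.mem_range.mp hj
        have h' : (m : ℕ) < M := h
        omega
      · have : c m = 0 := by
          by_contra hcm
          exact absurd (hmax m (by simpa using hcm)) (not_le.mpr h)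
        simp [this]
    · simp
  rw [hp, Polynomial.coeff_zero] at hcoeff
  have hf : ((M : ℕ)! : ℂ) ≠ 0 := by exact_mod_cast (M : ℕ).factorial_ne_zero
  have := mul_ne_zero (div_ne_zero (by simpa using hM) hf)
    (logSolZero_zero_ne_zero hρ hn hC (x := -1) (by norm_num))
  exact this hcoeff.symm

end

/-! ### The solutions at infinity -/

/-- The coefficients `∏_{j < k} (j + 1 - ε)ⁿ / ∏ᵢ (j + 2 - ρᵢ - ε)`. -/
noncomputable def infCoeff (ρ : Fin n → ℝ) (ε : ℂ) (k : ℕ) : ℂ :=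
  ∏ j ∈ Finset.range k, ((j : ℂ) + 1 - ε) ^ n / ∏ i, ((j : ℂ) + 2 - ρ i - ε)

/-- The series `∑ₖ cₖ(ε) e^{(ε - 1 - k) w}` with the coefficients `infCoeff`. -/
noncomputable def infSeries (ρ : Fin n → ℝ) (ε w : ℂ) : ℂ :=
  ∑' k : ℕ, infCoeff ρ ε k * Complex.exp ((ε - 1 - k) * w)

/-- The solutions `F̃_r` in the coordinate `w = log (C t)`. -/
noncomputable def logSolInfty (ρ : Fin n → ℝ) (r : Fin n) (w : ℂ) : ℂ :=
  coeffA ρ r * infSeries ρ (1 - ρ r) w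

theorem isOpen_re_pos : IsOpen {w : ℂ | 0 < w.re} := isOpen_lt continuous_const Complex.continuous_re

theorem infSeries_add_two_pi_I (ρ : Fin n → ℝ) (ε w : ℂ) :
    infSeries ρ ε (w + 2 * Real.pi * Complex.I) =
      Complex.exp (2 * Real.pi * Complex.I * ε) * infSeries ρ ε w := by
  rw [infSeries, infSeries, ← tsum_mul_left]
  refine tsum_congr fun k => ?_
  have h : Complex.exp (2 * Real.pi * Complex.I * ε) =
      Complex.exp ((ε - 1 - k) * (2 * Real.pi * Complex.I)) := by
    rw [Complex.exp_eq_exp_iff_exists_int]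
    -- The exponents `ε` and `ε - 1 - k` differ by the integer `k + 1`.
    exact ⟨k + 1, by push_cast; ring⟩
  rw [h, mul_add, Complex.exp_add]
  ring

theorem logSolInfty_add_two_pi_I (ρ : Fin n → ℝ) (r : Fin n) (w : ℂ) :
    logSolInfty ρ r (w + 2 * Real.pi * Complex.I) =
      Complex.exp (-(2 * Real.pi * Complex.I * ρ r)) * logSolInfty ρ r w := by
  have h : Complex.exp (2 * Real.pi * Complex.I * (1 - ρ r)) =
      Complex.exp (-(2 * Real.pi * Complex.I * ρ r)) := by
    rw [Complex.exp_eq_exp_iff_exists_int]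
    exact ⟨1, by push_cast; ring⟩
  rw [logSolInfty, infSeries_add_two_pi_I, h, logSolInfty]
  ring

section

variable {ρ : Fin n → ℝ} (hρ : ∀ i, 0 < ρ i ∧ ρ i < 1)
include hρ

theorem infCoeff_denom_ne_zero {ε : ℂ} (hε : ε.re < 1) (j : ℕ) (i : Fin n) :
    (j : ℂ) + 2 - ρ i - ε ≠ 0 := fun h => by
  have := congrArg Complex.re h
  simp at this
  linarith [(hρ i).2, j.cast_nonneg (α := ℝ)]

/-- Since `j + 1 - ε` has positive real part, adding the positive number `1 - ρᵢ` increases its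
modulus; each numerator factor is therefore at most its denominator factor. -/
theorem norm_infCoeff_le_one {ε : ℂ} (hε : ε.re < 1) (k : ℕ) : ‖infCoeff ρ ε k‖ ≤ 1 := by
  rw [infCoeff, norm_prod]
  refine Finset.prod_le_one (fun _ _ => norm_nonneg _) fun j _ => ?_
  rw [norm_div, norm_pow, norm_prod]
  refine div_le_one_of_le₀ ?_ (Finset.prod_nonneg fun _ _ => norm_nonneg _)
  have : ‖(j : ℂ) + 1 - ε‖ ^ n = ∏ _i : Fin n, ‖(j : ℂ) + 1 - ε‖ := by simp
  rw [this]
  refine Finset.prod_le_prod (fun _ _ => norm_nonneg _) fun i _ => ?_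
  have h1 := (hρ i).2
  have h2 := j.cast_nonneg (α := ℝ)
  rw [← sq_le_sq₀ (norm_nonneg _) (norm_nonneg _), Complex.sq_norm, Complex.sq_norm,
    Complex.normSq_apply, Complex.normSq_apply]
  simp only [Complex.sub_re, Complex.add_re, Complex.natCast_re, Complex.one_re, Complex.sub_im,
    Complex.add_im, Complex.natCast_im, Complex.one_im, Complex.re_ofNat, Complex.im_ofNat,
    Complex.ofReal_re, Complex.ofReal_im]
  nlinarith

theorem infCoeff_succ {ε : ℂ} (hε : ε.re < 1) (k : ℕ) :
    (∏ i, (ε - 1 - (k + 1 : ℕ) + (ρ i : ℂ))) * infCoeff ρ ε (k + 1) =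
      (ε - 1 - k) ^ n * infCoeff ρ ε k := by
  have h1 : ∏ i, (ε - 1 - (k + 1 : ℕ) + (ρ i : ℂ)) =
      (-1) ^ n * ∏ i, ((k : ℂ) + 2 - ρ i - ε) := by
    have : ((-1 : ℂ)) ^ n = ∏ _i : Fin n, (-1 : ℂ) := by simp
    rw [this, ← Finset.prod_mul_distrib]
    refine Finset.prod_congr rfl fun i _ => ?_
    push_cast
    ring
  have h2 : (ε - 1 - k) ^ n = (-1) ^ n * ((k : ℂ) + 1 - ε) ^ n := by
    rw [← mul_pow]
    ring
  have h3 : ∏ i, ((k : ℂ) + 2 - ρ i - ε) ≠ 0 :=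
    Finset.prod_ne_zero_iff.mpr fun i _ => infCoeff_denom_ne_zero hρ hε k i
  rw [h1, h2, infCoeff, Finset.prod_range_succ, ← infCoeff]
  field_simp

theorem differentiableAt_infCoeff {ε : ℂ} (hε : ε.re < 1) (k : ℕ) :
    DifferentiableAt ℂ (fun ε => infCoeff ρ ε k) ε := by
  refine DifferentiableAt.fun_finsetProd fun j _ => DifferentiableAt.div (by fun_prop)
    (DifferentiableAt.fun_finsetProd fun i _ => by fun_prop) ?_
  exact Finset.prod_ne_zero_iff.mpr fun i _ => infCoeff_denom_ne_zero hρ hε j i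

theorem locDominated_infSeries {ε : ℂ} (hε : ε.re < 1) : LocDominated {w : ℂ | 0 < w.re}
    fun k w => infCoeff ρ ε k * Complex.exp ((ε - 1 - k) * w) := by
  have e : (fun (k : ℕ) w => infCoeff ρ ε k * Complex.exp ((ε - 1 - k) * w)) =
      fun k w => (infCoeff ρ ε k * Complex.exp ((ε - 1) * w)) * Complex.exp (-w) ^ k := by
    funext k w
    rw [mul_assoc, ← Complex.exp_nat_mul, ← Complex.exp_add]
    ring_nf
  rw [e]
  refine LocDominated.of_geometric isOpen_re_pos (by fun_prop) (fun w hw => ?_)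
    (fun k => by fun_prop) (fun w _ => ⟨‖Complex.exp ((ε - 1) * w)‖ + 1, ?_⟩)
  · rw [Complex.norm_exp, Real.exp_lt_one_iff, Complex.neg_re, neg_lt_zero]
    exact hw
  · have hc : ContinuousAt (fun z => ‖Complex.exp ((ε - 1) * z)‖) w := by fun_prop
    filter_upwards [hc.eventually (gt_mem_nhds (lt_add_one _))] with z hz k
    rw [norm_mul]
    calc _ ≤ 1 * ‖Complex.exp ((ε - 1) * z)‖ :=
          mul_le_mul_of_nonneg_right (norm_infCoeff_le_one hρ hε k) (norm_nonneg _)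
      _ ≤ _ := by rw [one_mul]; exact hz.le

theorem analyticOnNhd_infSeries {ε : ℂ} (hε : ε.re < 1) :
    AnalyticOnNhd ℂ (infSeries ρ ε) {w : ℂ | 0 < w.re} :=
  (locDominated_infSeries hρ hε).analyticOnNhd_tsum

/-- The coefficients are chosen to telescope, now towards decreasing exponents. The remainder
vanishes exactly at the local exponents `ε = 1 - ρ_r`. -/
theorem hypOp_infSeries {ε w : ℂ} (hε : ε.re < 1) (hw : 0 < w.re) :
    hypOp ρ (infSeries ρ ε) w = -((∏ i, (ε - 1 + (ρ i : ℂ))) * Complex.exp (ε * w)) := by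
  refine ((locDominated_infSeries hρ hε).hypOp_tsum_of_telescope' ρ hw fun k => ?_).trans ?_
  · rw [shiftProd_replicate_exp, shiftProd_ofFn_exp, ← mul_assoc ((ε - 1 - k) ^ n),
      ← infCoeff_succ hρ hε, show (ε - 1 - k) * w = (ε - 1 - (k + 1 : ℕ)) * w + w by
        push_cast; ring, Complex.exp_add]
    ring
  · rw [shiftProd_ofFn_exp]
    have : Complex.exp (ε * w) = Complex.exp w * Complex.exp ((ε - 1 - (0 : ℕ)) * w) := by
      rw [← Complex.exp_add]
      congr 1
      push_cast
      ring
    rw [this]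
    simp [infCoeff]
    ring

theorem analyticAt_infSeries_exponent {ε w : ℂ} (hε : ε.re < 1) (hw : 0 < w.re) :
    AnalyticAt ℂ (fun ε => infSeries ρ ε w) ε := by
  have hU : IsOpen {ε : ℂ | ε.re < 1} := isOpen_lt Complex.continuous_re continuous_const
  have e : (fun ε => infSeries ρ ε w) = fun ε => ∑' k : ℕ,
      (infCoeff ρ ε k * Complex.exp ((ε - 1) * w)) * Complex.exp (-w) ^ k := by
    funext ε
    refine tsum_congr fun k => ?_
    rw [mul_assoc, ← Complex.exp_nat_mul, ← Complex.exp_add]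
    ring_nf
  rw [e]
  refine (LocDominated.of_geometric hU (q := fun _ => Complex.exp (-w)) (by fun_prop)
    (fun _ _ => ?_) (fun k ε hε => ?_) (fun ε hε => ?_)).analyticOnNhd_tsum ε hε
  · rw [Complex.norm_exp, Real.exp_lt_one_iff, Complex.neg_re, neg_lt_zero]
    exact hw
  · exact ((differentiableAt_infCoeff hρ hε k).mul (by fun_prop)).differentiableWithinAt
  · refine ⟨‖Complex.exp ((ε - 1) * w)‖ + 1, ?_⟩
    have hc : ContinuousAt (fun z => ‖Complex.exp ((z - 1) * w)‖) ε := by fun_prop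
    filter_upwards [hc.eventually (gt_mem_nhds (lt_add_one _)), hU.mem_nhds hε] with z hz hz1 k
    rw [norm_mul]
    calc _ ≤ 1 * ‖Complex.exp ((z - 1) * w)‖ :=
          mul_le_mul_of_nonneg_right (norm_infCoeff_le_one hρ hz1 k) (norm_nonneg _)
      _ ≤ _ := by rw [one_mul]; exact hz.le

theorem one_sub_re_lt_one (r : Fin n) : (1 - (ρ r : ℂ)).re < 1 := by
  simpa using (hρ r).1

theorem analyticOnNhd_logSolInfty (r : Fin n) :
    AnalyticOnNhd ℂ (logSolInfty ρ r) {w : ℂ | 0 < w.re} :=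
  analyticOnNhd_const.mul (analyticOnNhd_infSeries hρ (one_sub_re_lt_one hρ r))

theorem hypOp_logSolInfty (r : Fin n) {w : ℂ} (hw : 0 < w.re) :
    hypOp ρ (logSolInfty ρ r) w = 0 := by
  have e : logSolInfty ρ r = fun w => ∑ _i ∈ ({0} : Finset ℕ),
      coeffA ρ r * infSeries ρ (1 - ρ r) w := by
    funext w
    simp [logSolInfty]
  rw [e, hypOp_sum ρ {0} isOpen_re_pos (F := fun _ => infSeries ρ (1 - ρ r))
    (fun _ _ => analyticOnNhd_infSeries hρ (one_sub_re_lt_one hρ r)) (fun _ => coeffA ρ r) hw]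
  simp only [Finset.sum_singleton]
  rw [hypOp_infSeries hρ (one_sub_re_lt_one hρ r) hw, Finset.prod_eq_zero (Finset.mem_univ r)]
  · simp
  · ring

/-! ### Identification with the hypergeometric series -/

/-- At `ε = 1 - ρ_r` the denominator factor with `i = r` becomes `j + 1`; these factors build the
`k!`. -/
theorem infCoeff_eq_ascPochhammer (r : Fin n) (k : ℕ) :
    infCoeff ρ (1 - ρ r) k = (∏ _i : Fin n, (ascPochhammer ℂ k).eval (ρ r : ℂ)) /
      (∏ j : {i : Fin n // i ≠ r}, (ascPochhammer ℂ k).eval (1 + (ρ r : ℂ) - ρ j)) / (k ! : ℂ) := by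
  have hne : ∀ (k : ℕ) (i : Fin n), (1 + (ρ r : ℂ) - ρ i) + k ≠ 0 := fun k i h => by
    have := congrArg Complex.re h
    simp at this
    linarith [(hρ i).2, (hρ r).1, k.cast_nonneg (α := ℝ)]
  induction k with
  | zero => simp [infCoeff]
  | succ k ih =>
    have h1 : ∏ i, ((k : ℂ) + 2 - ρ i - (1 - ρ r)) =
        (k + 1) * ∏ j : {i : Fin n // i ≠ r}, ((1 + (ρ r : ℂ) - ρ j) + k) := by
      rw [Fintype.prod_eq_mul_prod_subtype_ne _ r]
      congr 1
      · ring
      · exact Finset.prod_congr rfl fun j _ => by ring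
    rw [infCoeff, Finset.prod_range_succ, ← infCoeff, ih, h1]
    simp only [ascPochhammer_succ_eval, Finset.prod_mul_distrib, Nat.factorial_succ, Nat.cast_mul,
      Nat.cast_succ, Finset.prod_const, Finset.card_univ, Fintype.card_fin]
    rw [show (k : ℂ) + 1 - (1 - ρ r) = ρ r + k by ring]
    simp only [div_eq_mul_inv, mul_inv]
    ring

theorem solInfty_eq_logSolInfty {C : ℝ} (hC : 0 < C) (r : Fin n) {t : ℂ} (ht : t ≠ 0) :
    solInfty ρ C r t = logSolInfty ρ r (Complex.log ((C : ℂ) * t)) := by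
  have hCt : (C : ℂ) * t ≠ 0 := mul_ne_zero (by exact_mod_cast hC.ne') ht
  rw [solInfty, logSolInfty, mul_assoc, hypergeometricSeries, infSeries, ← tsum_mul_left]
  congr 1
  refine tsum_congr fun k => ?_
  rw [infCoeff_eq_ascPochhammer hρ, Complex.cpow_def_of_ne_zero hCt, one_div,
    show (1 - (ρ r : ℂ) - 1 - k) * Complex.log (C * t) =
      Complex.log (C * t) * -(ρ r : ℂ) + k * -Complex.log (C * t) by ring, Complex.exp_add,
    Complex.exp_nat_mul, Complex.exp_neg (Complex.log _), Complex.exp_log hCt]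
  ring

/-! ### Linear independence at infinity -/

/-- At `w = 2` the first term dominates: the coefficients are at most `1` in modulus and `e^{-2} <
1/2`, so the tail is smaller than the leading `1`. -/
theorem infSeries_ne_zero {ε : ℂ} (hε : ε.re < 1) : infSeries ρ ε (2 : ℝ) ≠ 0 := by
  have hq : ‖Complex.exp (-((2 : ℝ) : ℂ))‖ < 1 / 2 := by
    rw [Complex.norm_exp, Complex.neg_re, Complex.ofReal_re, Real.exp_neg,
      inv_lt_comm₀ (Real.exp_pos 2) (by norm_num)]
    linarith [Real.add_one_lt_exp (x := 2) (by norm_num)]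
  set q := Complex.exp (-((2 : ℝ) : ℂ)) with hqdef
  have hb : ∀ k, ‖infCoeff ρ ε (k + 1) * q ^ (k + 1)‖ ≤ ‖q‖ * ‖q‖ ^ k := fun k => by
    rw [norm_mul, norm_pow, ← pow_succ']
    exact mul_le_of_le_one_left (by positivity) (norm_infCoeff_le_one hρ hε _)
  have hg := (summable_geometric_of_lt_one (norm_nonneg q) (by linarith)).mul_left ‖q‖
  have hs : Summable fun k => infCoeff ρ ε (k + 1) * q ^ (k + 1) := Summable.of_norm_bounded hg hb
  have hs' : Summable fun k => infCoeff ρ ε k * q ^ k := (summable_nat_add_iff 1).mp hs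
  have e : infSeries ρ ε (2 : ℝ) =
      Complex.exp ((ε - 1) * (2 : ℝ)) * ∑' k, infCoeff ρ ε k * q ^ k := by
    rw [infSeries, ← tsum_mul_left]
    refine tsum_congr fun k => ?_
    rw [mul_left_comm, hqdef, ← Complex.exp_nat_mul, ← Complex.exp_add]
    ring_nf
  rw [e]
  refine mul_ne_zero (Complex.exp_ne_zero _) fun h => ?_
  rw [hs'.tsum_eq_zero_add] at h
  have h1 : ‖∑' k, infCoeff ρ ε (k + 1) * q ^ (k + 1)‖ < 1 := by
    refine (tsum_of_norm_bounded hg.hasSum hb).trans_lt ?_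
    rw [tsum_mul_left, tsum_geometric_of_lt_one (norm_nonneg q) (by linarith),
      ← div_eq_mul_inv, div_lt_one (by linarith)]
    linarith
  have h2 : infCoeff ρ ε 0 * q ^ 0 = 1 := by simp [infCoeff]
  rw [h2, add_comm, ← eq_neg_iff_add_eq_zero] at h
  rw [h, norm_neg, norm_one] at h1
  exact lt_irrefl _ h1

/-- In Lean `Γ` takes the value `0` at its poles, but `ρᵢ - ρ_r` is a nonzero number in `(-1, 1)`
and so never a pole. -/
theorem coeffA_ne_zero (hinj : Function.Injective ρ) (r : Fin n) : coeffA ρ r ≠ 0 := by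
  refine mul_ne_zero (Complex.exp_ne_zero _) (Finset.prod_ne_zero_iff.mpr fun i hi => ?_)
  have hir : i ≠ r := (Finset.mem_erase.mp hi).1
  have h1 := hρ i
  have h2 := hρ r
  refine div_ne_zero (Complex.Gamma_ne_zero fun m h => ?_) (mul_ne_zero
    (Complex.Gamma_ne_zero_of_re_pos (by simpa using h1.1))
    (Complex.Gamma_ne_zero_of_re_pos (by simpa using h2.2)))
  have h3 : ρ i - ρ r = -(m : ℝ) := by exact_mod_cast h
  rcases m.eq_zero_or_pos with rfl | hm
  · exact hir (hinj (by simpa [sub_eq_zero] using h3))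
  · have : (1 : ℝ) ≤ m := by exact_mod_cast hm
    linarith

theorem exp_injective_of_mem_Ioo (hinj : Function.Injective ρ) :
    Function.Injective fun r => Complex.exp (-(2 * Real.pi * Complex.I * ρ r)) := by
  intro r s h
  obtain ⟨k, hk⟩ := Complex.exp_eq_exp_iff_exists_int.mp h
  have h1 : (ρ r : ℂ) = ρ s - k := by
    refine mul_left_cancel₀ Complex.two_pi_I_ne_zero ?_
    linear_combination -hk
  have h2 : ρ r = ρ s - k := by exact_mod_cast h1
  have h3 : |(k : ℝ)| < 1 := abs_lt.mpr ⟨by linarith [(hρ r).2, (hρ s).1], by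
    linarith [(hρ r).1, (hρ s).2]⟩
  have h4 : k = 0 := by
    rw [← Int.abs_lt_one_iff]
    exact_mod_cast h3
  exact hinj (by simpa [h4] using h2)

/-- The relation spreads from `O` to the half-plane. Translating by multiples of `2πi` multiplies
the terms by powers of the distinct numbers `e^{-2πiρ_r}`, so a Vandermonde determinant makes each
term vanish at `w = 2`. -/
theorem logSolInfty_linearIndependent (hinj : Function.Injective ρ) {O : Set ℂ} (hO : IsOpen O)
    (hne : O.Nonempty) (hOR : ∀ w ∈ O, 0 < w.re) {c : Fin n → ℂ}
    (hc : ∀ w ∈ O, ∑ r, c r * logSolInfty ρ r w = 0) : c = 0 := by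
  have hconv : IsPreconnected {w : ℂ | 0 < w.re} :=
    (convex_halfSpace_re_gt 0).isPreconnected
  have hana : AnalyticOnNhd ℂ (fun w => ∑ r, c r * logSolInfty ρ r w) {w : ℂ | 0 < w.re} :=
    Finset.analyticOnNhd_fun_sum _ fun r _ =>
      analyticOnNhd_const.mul (analyticOnNhd_logSolInfty hρ r)
  obtain ⟨w₀, hw₀⟩ := hne
  have hzero := hana.eqOn_zero_of_preconnected_of_eventuallyEq_zero hconv (hOR w₀ hw₀)
    (Filter.eventually_of_mem (hO.mem_nhds hw₀) hc)
  have hshift : ∀ (r : Fin n) (j : ℕ) (w : ℂ),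
      logSolInfty ρ r (w + j * (2 * Real.pi * Complex.I)) =
      Complex.exp (-(2 * Real.pi * Complex.I * ρ r)) ^ j * logSolInfty ρ r w := fun r j w => by
    induction j with
    | zero => simp
    | succ j ih =>
      rw [show w + ((j + 1 : ℕ) : ℂ) * (2 * Real.pi * Complex.I) =
        w + j * (2 * Real.pi * Complex.I) + 2 * Real.pi * Complex.I by push_cast; ring,
        logSolInfty_add_two_pi_I, ih]
      ring
  have h2 : (0 : ℝ) < ((2 : ℝ) : ℂ).re := by simp
  have hv := Matrix.eq_zero_of_mulVec_eq_zero (M := (Matrix.vandermonde fun r =>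
      Complex.exp (-(2 * Real.pi * Complex.I * ρ r)))ᵀ)
    (v := fun r => c r * logSolInfty ρ r (2 : ℝ)) (by
      rw [Matrix.det_transpose]
      exact Matrix.det_vandermonde_ne_zero_iff.mpr (exp_injective_of_mem_Ioo hρ hinj)) (by
      funext j
      have := hzero (x := (2 : ℝ) + (j : ℕ) * (2 * Real.pi * Complex.I)) (by
        simp)
      simp only [hshift, Pi.zero_apply] at this
      rw [Pi.zero_apply, ← this]
      simp only [Matrix.mulVec, dotProduct, Matrix.transpose_apply, Matrix.vandermonde_apply]
      exact Finset.sum_congr rfl fun r _ => by ring)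
  funext r
  have := congrFun hv r
  simp only [Pi.zero_apply, mul_eq_zero] at this
  refine this.resolve_right (mul_ne_zero (coeffA_ne_zero hρ hinj r) ?_)
  exact infSeries_ne_zero hρ (one_sub_re_lt_one hρ r)

end

/-! ### The connection formula -/

/-- The strip `-2π < Im w < 0`. -/
def lowerStrip : Set ℂ := {w | -(2 * Real.pi) < w.im ∧ w.im < 0}

/-- The strip `0 < Im w < 2π`. -/
def upperStrip : Set ℂ := {w | 0 < w.im ∧ w.im < 2 * Real.pi}

theorem isOpen_lowerStrip : IsOpen lowerStrip :=
  (isOpen_lt continuous_const Complex.continuous_im).inter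
    (isOpen_lt Complex.continuous_im continuous_const)

theorem isOpen_upperStrip : IsOpen upperStrip :=
  (isOpen_lt continuous_const Complex.continuous_im).inter
    (isOpen_lt Complex.continuous_im continuous_const)

theorem convex_lowerStrip : Convex ℝ lowerStrip :=
  (convex_halfSpace_im_gt _).inter (convex_halfSpace_im_lt _)

theorem convex_upperStrip : Convex ℝ upperStrip :=
  (convex_halfSpace_im_gt _).inter (convex_halfSpace_im_lt _)

theorem convex_bigStrip : Convex ℝ bigStrip := by
  have : bigStrip = {w : ℂ | -(2 * Real.pi) < w.im} ∩ {w : ℂ | w.im < 2 * Real.pi} := by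
    ext w
    exact abs_lt (a := w.im) (b := 2 * Real.pi)
  rw [this]
  exact (convex_halfSpace_im_gt _).inter (convex_halfSpace_im_lt _)

theorem lowerStrip_subset_cutSet : lowerStrip ⊆ cutSet := fun w hw =>
  mem_cutSet_of_im hw.1 (by linarith [hw.2, Real.pi_pos]) hw.2.ne

theorem upperStrip_subset_cutSet : upperStrip ⊆ cutSet := fun w hw =>
  mem_cutSet_of_im (by linarith [hw.1, Real.pi_pos]) hw.2 hw.1.ne'

theorem lowerStrip_subset_bigStrip : lowerStrip ⊆ bigStrip := fun w hw =>
  abs_lt.mpr ⟨hw.1, by linarith [hw.2, Real.pi_pos]⟩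

theorem upperStrip_subset_bigStrip : upperStrip ⊆ bigStrip := fun w hw =>
  abs_lt.mpr ⟨by linarith [hw.1, Real.pi_pos], hw.2⟩

theorem mk_mem_lowerStrip (x : ℝ) : (⟨x, -Real.pi⟩ : ℂ) ∈ lowerStrip :=
  ⟨by simp [Real.pi_pos], by simp [Real.pi_pos]⟩

theorem mk_mem_upperStrip (x : ℝ) : (⟨x, Real.pi⟩ : ℂ) ∈ upperStrip :=
  ⟨by simp [Real.pi_pos], by simp [Real.pi_pos]⟩

theorem hypOp_add_const_mul (ρ : Fin n → ℝ) {U : Set ℂ} (hU : IsOpen U) {f g : ℂ → ℂ}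
    (hf : AnalyticOnNhd ℂ f U) (hg : AnalyticOnNhd ℂ g U) (a b : ℂ) {w : ℂ} (hw : w ∈ U) :
    hypOp ρ (fun w => a * f w + b * g w) w = a * hypOp ρ f w + b * hypOp ρ g w := by
  have := hypOp_sum ρ (Finset.univ : Finset (Fin 2)) hU (F := ![f, g])
    (fun i _ => by fin_cases i <;> assumption) ![a, b] hw
  simpa [Fin.sum_univ_two] using this

/-- `∏ᵢ (ε - 1 + ρᵢ)`. -/
noncomputable def normPoly (ρ : Fin n → ℝ) (ε : ℂ) : ℂ := ∏ i, (ε - 1 + (ρ i : ℂ))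

/-- A combination of `hypInt ρ 0 ε` and `infSeries ρ ε` that solves the homogeneous equation. -/
noncomputable def connFun (ρ : Fin n → ℝ) (ε w : ℂ) : ℂ :=
  normPoly ρ ε * hypInt ρ 0 ε w + (ε ^ n * gammaQuot ρ ε) * infSeries ρ ε w

theorem connFun_zero (ρ : Fin n → ℝ) (hn : 1 ≤ n) (w : ℂ) :
    connFun ρ 0 w = normPoly ρ 0 * hypInt ρ 0 0 w := by
  simp [connFun, show n ≠ 0 by omega]

theorem connFun_add_two_pi_I (ρ : Fin n → ℝ) (ε w : ℂ) :
    connFun ρ ε (w + 2 * Real.pi * Complex.I) =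
      Complex.exp (2 * Real.pi * Complex.I * ε) * connFun ρ ε w := by
  have := hypInt_zero_add (ρ := ρ) ε w 1
  simp only [Nat.cast_one, mul_one] at this
  rw [connFun, connFun, this, infSeries_add_two_pi_I]
  ring

section

variable {ρ : Fin n → ℝ} (hρ : ∀ i, 0 < ρ i ∧ ρ i < 1)
include hρ

theorem normPoly_zero_ne_zero : normPoly ρ 0 ≠ 0 :=
  Finset.prod_ne_zero_iff.mpr fun i _ h => by
    have := congrArg Complex.re h
    simp at this
    linarith [(hρ i).2]

/-- The identity theorem carries the equation from the left half-plane through the connected set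
`S`; the point `z` is where the two meet. -/
theorem hypOp_hypInt (hn : 1 ≤ n) {ε : ℂ} (hε : ε ∈ expSet ρ) {S : Set ℂ}
    (hSc : Convex ℝ S) (hScut : S ⊆ cutSet) {z : ℂ} (hzS : z ∈ S) (hz : z.re < 0) {w : ℂ}
    (hw : w ∈ S) :
    hypOp ρ (hypInt ρ 0 ε) w = ε ^ n * gammaQuot ρ ε * Complex.exp (ε * w) := by
  have h1 : AnalyticOnNhd ℂ (hypOp ρ (hypInt ρ 0 ε)) S := fun w hw =>
    AnalyticOnNhd.hypOp (analyticOnNhd_hypInt hρ hn 0 hε) ρ w (hScut hw)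
  have h2 : AnalyticOnNhd ℂ (fun w => ε ^ n * gammaQuot ρ ε * Complex.exp (ε * w)) S :=
    fun w _ => by fun_prop
  exact h1.eqOn_of_preconnected_of_eventuallyEq h2 hSc.isPreconnected hzS
    (Filter.eventually_of_mem (isOpen_re_neg.mem_nhds hz)
      fun w hw => hypOp_hypInt_of_re_neg hρ hn hε hw) hw

/-- The two inhomogeneities cancel, so `connFun` is a solution for `Re w > 0`, and the `F̃_r` span
the solutions there. -/
theorem exists_connFun_eq_sum (hn : 1 ≤ n) (hinj : Function.Injective ρ) {ε : ℂ}
    (hε : ε ∈ expSet ρ) (hε1 : ε.re < 1) {S : Set ℂ} (hS : IsOpen S) (hSc : Convex ℝ S)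
    (hScut : S ⊆ cutSet) {z : ℂ} (hzS : z ∈ S) (hz : z.re < 0) {x : ℂ} (hxS : x ∈ S)
    (hx : 0 < x.re) : ∃ c : Fin n → ℂ, ∀ w ∈ S, 0 < w.re →
      connFun ρ ε w = ∑ r, c r * logSolInfty ρ r w := by
  have hU : IsOpen (S ∩ {w : ℂ | 0 < w.re}) := hS.inter isOpen_re_pos
  have h1 : AnalyticOnNhd ℂ (hypInt ρ 0 ε) (S ∩ {w : ℂ | 0 < w.re}) := fun w hw =>
    analyticOnNhd_hypInt hρ hn 0 hε w (hScut hw.1)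
  have h2 : AnalyticOnNhd ℂ (infSeries ρ ε) (S ∩ {w : ℂ | 0 < w.re}) := fun w hw =>
    analyticOnNhd_infSeries hρ hε1 w hw.2
  obtain ⟨c, hc⟩ := exists_eq_sum_of_hypOp_eq_zero ρ hU
    (hSc.inter (convex_halfSpace_re_gt 0)).isPreconnected (w := x) ⟨hxS, hx⟩
    (exp_ne_one_of_mem_cutSet (hScut hxS)) (X := logSolInfty ρ) (f := connFun ρ ε)
    (fun r w hw => analyticOnNhd_logSolInfty hρ r w hw.2)
    (fun r w hw => hypOp_logSolInfty hρ r hw.2)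
    (fun c hc => logSolInfty_linearIndependent hρ hinj hU ⟨x, hxS, hx⟩ (fun w hw => hw.2) hc)
    ((analyticOnNhd_const.mul h1).add (analyticOnNhd_const.mul h2))
    (fun w hw => by
      refine (hypOp_add_const_mul ρ hU h1 h2 _ _ hw).trans ?_
      rw [hypOp_hypInt hρ hn hε hSc hScut hzS hz hw.1, hypOp_infSeries hρ hε1 hw.2, normPoly]
      ring)
  exact ⟨c, fun w hw hw' => hc w ⟨hw, hw'⟩⟩

/-- Two relations link the coefficients below and above the real axis: translation by `2πi`, and
continuation of `connFun ρ ε - (N(ε) / N(0)) connFun ρ 0` across the axis. Eliminating the upper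
ones leaves a jump whose dependence on `ε` is only through `normPoly`. -/
theorem exists_connection_constants (hn : 1 ≤ n) (hinj : Function.Injective ρ) :
    ∃ d : Fin n → ℂ, ∀ ε ∈ expSet ρ, ε.re < 1 → ∃ c : Fin n → ℂ,
      (∀ w ∈ lowerStrip, 0 < w.re → connFun ρ ε w = ∑ r, c r * logSolInfty ρ r w) ∧
      ∀ r, c r * (Complex.exp (2 * Real.pi * Complex.I * (ρ r + ε)) - 1) = normPoly ρ ε * d r := by
  have h0 := zero_mem_expSet hρ
  have h01 : (0 : ℂ).re < 1 := by simp
  have hN := normPoly_zero_ne_zero hρ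
  have hlow : ∀ ε ∈ expSet ρ, ε.re < 1 → ∃ c : Fin n → ℂ, ∀ w ∈ lowerStrip, 0 < w.re →
      connFun ρ ε w = ∑ r, c r * logSolInfty ρ r w := fun ε hε hε1 =>
    exists_connFun_eq_sum hρ hn hinj hε hε1 isOpen_lowerStrip convex_lowerStrip
      lowerStrip_subset_cutSet (mk_mem_lowerStrip (-1)) (by simp) (mk_mem_lowerStrip 1) (by simp)
  have hupp : ∀ ε ∈ expSet ρ, ε.re < 1 → ∃ c : Fin n → ℂ, ∀ w ∈ upperStrip, 0 < w.re →
      connFun ρ ε w = ∑ r, c r * logSolInfty ρ r w := fun ε hε hε1 =>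
    exists_connFun_eq_sum hρ hn hinj hε hε1 isOpen_upperStrip convex_upperStrip
      upperStrip_subset_cutSet (mk_mem_upperStrip (-1)) (by simp) (mk_mem_upperStrip 1) (by simp)
  obtain ⟨a, ha⟩ := hlow 0 h0 h01
  obtain ⟨b, hb⟩ := hupp 0 h0 h01
  -- The jump of the coefficients at `ε = 0`, normalised; it serves as reference for all other `ε`.
  refine ⟨fun r => (b r - a r) / normPoly ρ 0, fun ε hε hε1 => ?_⟩
  obtain ⟨c, hc⟩ := hlow ε hε hε1
  obtain ⟨e, he⟩ := hupp ε hε hε1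
  refine ⟨c, hc, ?_⟩
  have hlo : IsOpen (lowerStrip ∩ {w : ℂ | 0 < w.re}) := isOpen_lowerStrip.inter isOpen_re_pos
  have hup : IsOpen (upperStrip ∩ {w : ℂ | 0 < w.re}) := isOpen_upperStrip.inter isOpen_re_pos
  -- translation by `2πi`
  have hshift : ∀ r, e r = Complex.exp (2 * Real.pi * Complex.I * (ρ r + ε)) * c r := by
    have := logSolInfty_linearIndependent hρ hinj hlo ⟨_, mk_mem_lowerStrip 1, by simp⟩
      (fun w hw => hw.2) (c := fun r => e r * Complex.exp (-(2 * Real.pi * Complex.I * ρ r)) -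
        Complex.exp (2 * Real.pi * Complex.I * ε) * c r) (fun w hw => by
      have hw' : w + 2 * Real.pi * Complex.I ∈ upperStrip := by
        have h1 := hw.1.1
        have h2 := hw.1.2
        simp only [upperStrip, Set.mem_ofPred_eq, Complex.add_im, Complex.mul_im, Complex.re_ofNat,
          Complex.ofReal_im, mul_zero, Complex.im_ofNat, Complex.ofReal_re, zero_mul, add_zero,
          Complex.I_re, Complex.I_im, mul_one, Complex.mul_re, sub_zero]
        constructor <;> linarith
      have h1 := he _ hw' (by simpa using hw.2)
      rw [connFun_add_two_pi_I, hc w hw.1 hw.2] at h1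
      simp only [logSolInfty_add_two_pi_I, Finset.mul_sum] at h1
      simp only [sub_mul, Finset.sum_sub_distrib, mul_assoc] at h1 ⊢
      rw [h1, sub_self])
    intro r
    have h := congrFun this r
    simp only [Pi.zero_apply, sub_eq_zero] at h
    have h2 : Complex.exp (2 * Real.pi * Complex.I * (ρ r + ε)) =
        Complex.exp (2 * Real.pi * Complex.I * ρ r) * Complex.exp (2 * Real.pi * Complex.I * ε) := by
      rw [← Complex.exp_add]
      ring_nf
    rw [h2, mul_assoc, ← h, mul_left_comm, ← Complex.exp_add]
    simp
  -- continuation across the real axis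
  have hjump : ∀ r, e r - normPoly ρ ε / normPoly ρ 0 * b r =
      c r - normPoly ρ ε / normPoly ρ 0 * a r := by
    let κ := normPoly ρ ε / normPoly ρ 0
    -- With `hypJump` in place of the difference of integrals, this function is holomorphic on both
    -- sides of the real axis and on it.
    let J : ℂ → ℂ := fun w =>
      normPoly ρ ε * hypJump ρ ε w + (ε ^ n * gammaQuot ρ ε) * infSeries ρ ε w
    have hJ : ∀ w ∈ cutSet, J w = connFun ρ ε w - κ * connFun ρ 0 w := fun w hw => by
      simp only [J, κ]
      rw [connFun_zero ρ hn, hypJump_eq hρ hn hε hw, connFun]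
      field_simp
      ring
    have hJana : AnalyticOnNhd ℂ J (bigStrip ∩ {w : ℂ | 0 < w.re}) := fun w hw =>
      (analyticAt_const.mul (analyticOnNhd_hypJump hρ hn hε w hw.1)).add
        (analyticAt_const.mul (analyticOnNhd_infSeries hρ hε1 w hw.2))
    have hsum : AnalyticOnNhd ℂ (fun w => ∑ r, (c r - κ * a r) * logSolInfty ρ r w)
        (bigStrip ∩ {w : ℂ | 0 < w.re}) := Finset.analyticOnNhd_fun_sum _ fun r _ w hw =>
      analyticAt_const.mul (analyticOnNhd_logSolInfty hρ r w hw.2)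
    have hEq := hJana.eqOn_of_preconnected_of_eventuallyEq hsum
      (convex_bigStrip.inter (convex_halfSpace_re_gt 0)).isPreconnected (z₀ := ⟨1, -Real.pi⟩)
      ⟨lowerStrip_subset_bigStrip (mk_mem_lowerStrip 1), by simp⟩
      (Filter.eventually_of_mem (hlo.mem_nhds ⟨mk_mem_lowerStrip 1, by simp⟩) fun w hw => by
        rw [hJ w (lowerStrip_subset_cutSet hw.1), hc w hw.1 hw.2, ha w hw.1 hw.2]
        simp only [sub_mul, Finset.sum_sub_distrib, Finset.mul_sum, mul_assoc])
    have := logSolInfty_linearIndependent hρ hinj hup ⟨_, mk_mem_upperStrip 1, by simp⟩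
      (fun w hw => hw.2) (c := fun r => (e r - κ * b r) - (c r - κ * a r)) (fun w hw => by
      have h1 := hEq ⟨upperStrip_subset_bigStrip hw.1, hw.2⟩
      rw [hJ w (upperStrip_subset_cutSet hw.1), he w hw.1 hw.2, hb w hw.1 hw.2] at h1
      simp only [sub_mul, Finset.sum_sub_distrib, Finset.mul_sum, mul_assoc] at h1 ⊢
      rw [h1, sub_self])
    exact fun r => sub_eq_zero.mp (congrFun this r)
  intro r
  have h1 := hjump r
  rw [hshift r] at h1
  field_simp at h1 ⊢
  linear_combination h1

/-! ### The value of the connection constants -/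

omit hρ in
theorem exp_two_pi_I_sub_one (z : ℂ) : Complex.exp (2 * Real.pi * Complex.I * z) - 1 =
    2 * Complex.I * Complex.exp (Real.pi * Complex.I * z) * Complex.sin (Real.pi * z) := by
  have h1 : Complex.exp (2 * Real.pi * Complex.I * z) =
      Complex.exp (Real.pi * Complex.I * z) * Complex.exp (Real.pi * Complex.I * z) := by
    rw [← Complex.exp_add]
    ring_nf
  have h2 : Complex.exp (Real.pi * Complex.I * z) * Complex.exp (-(Real.pi * Complex.I * z)) = 1 := by
    rw [← Complex.exp_add]
    simp
  rw [Complex.sin, h1, show -((Real.pi : ℂ) * z) * Complex.I = -(Real.pi * Complex.I * z) by ring,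
    show (Real.pi : ℂ) * z * Complex.I = Real.pi * Complex.I * z by ring]
  linear_combination (-Complex.I ^ 2) * h2 +
    (Complex.exp (Real.pi * Complex.I * z) ^ 2 - 1) * Complex.I_sq

omit hρ in
theorem sin_pi_mul_ne_zero {x : ℝ} (h0 : 0 < x) (h1 : x < 1) :
    Complex.sin ((Real.pi : ℂ) * (x : ℂ)) ≠ 0 := by
  rw [← Complex.ofReal_mul, ← Complex.ofReal_sin, Complex.ofReal_ne_zero]
  exact (Real.sin_pos_of_pos_of_lt_pi (by positivity) (by nlinarith [Real.pi_pos])).ne'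

/-- At the exponent `1 - ρ_s` the factor `i = s` of `φ` gives `sin(πρ_s) / π` by the reflection
formula. The others, by `Γ(x + 1) = x Γ(x)`, give `ρᵢ - ρ_s` times the factors of `A_s`; `e^{πiρ_s}`
undoes the phase in `A_s`. -/
theorem pow_mul_gammaQuot_one_sub (hinj : Function.Injective ρ) (s : Fin n) :
    (1 - (ρ s : ℂ)) ^ n * gammaQuot ρ (1 - ρ s) =
      Complex.sin (Real.pi * ρ s) / Real.pi * Complex.exp (Real.pi * Complex.I * ρ s) *
        (∏ i ∈ Finset.univ.erase s, ((ρ i : ℂ) - ρ s)) * coeffA ρ s := by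
  have hs := hρ s
  have h1 : (1 : ℂ) - ρ s ≠ 0 := by
    rw [← Complex.ofReal_one, ← Complex.ofReal_sub, Complex.ofReal_ne_zero]
    linarith
  have hG1 : Complex.Gamma (1 - ρ s) ≠ 0 :=
    Complex.Gamma_ne_zero_of_re_pos (by simpa using hs.2)
  have e : (1 - (ρ s : ℂ)) ^ n = ∏ _i : Fin n, (1 - (ρ s : ℂ)) := by simp
  have hfac : ∀ i ∈ Finset.univ.erase s, (1 - (ρ s : ℂ)) * (Complex.Gamma ((ρ i : ℂ) + (1 - ρ s)) /
      (Complex.Gamma (ρ i) * Complex.Gamma (1 + (1 - ρ s)))) =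
      ((ρ i : ℂ) - ρ s) * (Complex.Gamma ((ρ i : ℂ) - ρ s) /
        (Complex.Gamma (ρ i) * Complex.Gamma (1 - ρ s))) := fun i hi => by
    have hne : (ρ i : ℂ) - ρ s ≠ 0 := by
      rw [← Complex.ofReal_sub, Complex.ofReal_ne_zero, sub_ne_zero]
      exact fun h => (Finset.mem_erase.mp hi).1 (hinj h)
    have hGi : Complex.Gamma (ρ i) ≠ 0 :=
      Complex.Gamma_ne_zero_of_re_pos (by simpa using (hρ i).1)
    rw [show (ρ i : ℂ) + (1 - ρ s) = (ρ i - ρ s) + 1 by ring, Complex.Gamma_add_one _ hne,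
      show (1 : ℂ) + (1 - ρ s) = (1 - ρ s) + 1 by ring, Complex.Gamma_add_one _ h1]
    field_simp
  have hGs : Complex.Gamma (ρ s) ≠ 0 :=
    Complex.Gamma_ne_zero_of_re_pos (by simpa using hs.1)
  have hsfac : (1 - (ρ s : ℂ)) * (Complex.Gamma ((ρ s : ℂ) + (1 - ρ s)) /
      (Complex.Gamma (ρ s) * Complex.Gamma (1 + (1 - ρ s)))) =
      Complex.sin (Real.pi * ρ s) / Real.pi := by
    have hr := Complex.Gamma_mul_Gamma_one_sub (ρ s)
    have hsin := sin_pi_mul_ne_zero hs.1 hs.2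
    have hpi : (Real.pi : ℂ) ≠ 0 := by exact_mod_cast Real.pi_ne_zero
    rw [show (ρ s : ℂ) + (1 - ρ s) = 1 by ring, Complex.Gamma_one,
      show (1 : ℂ) + (1 - ρ s) = (1 - ρ s) + 1 by ring, Complex.Gamma_add_one _ h1]
    rw [eq_div_iff hsin] at hr
    generalize Complex.sin (Real.pi * ρ s) = S at *
    field_simp
    linear_combination -hr
  rw [e, gammaQuot, ← Finset.prod_mul_distrib, ← Finset.mul_prod_erase _ _ (Finset.mem_univ s),
    Finset.prod_congr rfl hfac, hsfac, coeffA, Finset.prod_mul_distrib]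
  have hexp : Complex.exp (Real.pi * Complex.I * ρ s) *
      Complex.exp (-(Real.pi * Complex.I * ρ s)) = 1 := by
    rw [← Complex.exp_add]
    simp
  linear_combination (-(Complex.sin (Real.pi * ρ s) / Real.pi *
    (∏ i ∈ Finset.univ.erase s, ((ρ i : ℂ) - ρ s)) *
    ∏ i ∈ Finset.univ.erase s, Complex.Gamma ((ρ i : ℂ) - ρ s) /
      (Complex.Gamma (ρ i) * Complex.Gamma (1 - ρ s)))) * hexp

/-- The connection constants are `2i e^{πiρ_s} sin(πρ_s)`. -/
theorem connection_constants_eq (hn : 1 ≤ n) (hinj : Function.Injective ρ) {d : Fin n → ℂ}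
    (hd : ∀ ε ∈ expSet ρ, ε.re < 1 → ∃ c : Fin n → ℂ,
      (∀ w ∈ lowerStrip, 0 < w.re → connFun ρ ε w = ∑ r, c r * logSolInfty ρ r w) ∧
      ∀ r, c r * (Complex.exp (2 * Real.pi * Complex.I * (ρ r + ε)) - 1) = normPoly ρ ε * d r)
    (s : Fin n) : d s = 2 * Complex.I * Complex.exp (Real.pi * Complex.I * ρ s) *
      Complex.sin (Real.pi * ρ s) := by
  have hs := hρ s
  have hlo : IsOpen (lowerStrip ∩ {w : ℂ | 0 < w.re}) := isOpen_lowerStrip.inter isOpen_re_pos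
  obtain ⟨w, hw, hws⟩ : ∃ w ∈ lowerStrip ∩ {w : ℂ | 0 < w.re}, logSolInfty ρ s w ≠ 0 := by
    by_contra! h
    have := logSolInfty_linearIndependent hρ hinj hlo ⟨_, mk_mem_lowerStrip 1, by simp⟩
      (fun w hw => hw.2) (c := Pi.single s 1) (fun w hw => by
        simp [Pi.single_apply, h w hw])
    simpa using congrFun this s
  have hwcut := lowerStrip_subset_cutSet hw.1
  set ε₀ : ℂ := 1 - ρ s with hε₀
  have hε₀E : ε₀ ∈ expSet ρ := fun i => by
    simp only [hε₀, Complex.sub_re, Complex.one_re, Complex.ofReal_re]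
    linarith [(hρ i).1]
  have hε₀1 : ε₀.re < 1 := one_sub_re_lt_one hρ s
  -- `D(x) = (e^{2πix} - 1) / x`, extended over `0`. As `ε → 1 - ρ_s`, the factor `ε - 1 + ρ_s` of
  -- `normPoly` and the exponential factor multiplying `c s` both have a simple zero; `D` permits
  -- cancelling them.
  let D : ℂ → ℂ := dslope (fun x => Complex.exp (2 * Real.pi * Complex.I * x)) 0
  have hDcont : Continuous D := by
    have : Differentiable ℂ D := by
      rw [← differentiableOn_univ]
      exact (Complex.differentiableOn_dslope Filter.univ_mem).mpr (by fun_prop)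
    exact this.continuous
  have hD0 : D 0 = 2 * Real.pi * Complex.I := by
    have : HasDerivAt (fun x : ℂ => Complex.exp (2 * Real.pi * Complex.I * x))
        (2 * Real.pi * Complex.I) 0 := by
      simpa using ((hasDerivAt_id (0 : ℂ)).const_mul (2 * Real.pi * Complex.I)).cexp
    simp only [D]
    rw [dslope_same, this.deriv]
  have hDmul : ∀ x, x * D x = Complex.exp (2 * Real.pi * Complex.I * x) - 1 := fun x => by
    have := sub_smul_dslope (fun x => Complex.exp (2 * Real.pi * Complex.I * x)) (0 : ℂ) x
    simpa using this
  have hDne : ∀ r, D (ε₀ - 1 + ρ r) ≠ 0 := fun r => by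
    have e1 : ε₀ - 1 + ρ r = ((ρ r - ρ s : ℝ) : ℂ) := by
      simp only [hε₀]
      push_cast
      ring
    rcases eq_or_ne r s with rfl | hrs
    · rw [e1, sub_self, Complex.ofReal_zero, hD0]
      exact Complex.two_pi_I_ne_zero
    · intro h
      have h1 := hDmul (ε₀ - 1 + ρ r)
      rw [h, mul_zero, e1] at h1
      have h2 := exp_injective_of_mem_Ioo hρ hinj (a₁ := s) (a₂ := r) (by
        have : Complex.exp (-(2 * Real.pi * Complex.I * ρ s)) =
          Complex.exp (-(2 * Real.pi * Complex.I * ρ r)) *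
            Complex.exp (2 * Real.pi * Complex.I * ((ρ r - ρ s : ℝ) : ℂ)) := by
          rw [← Complex.exp_add]
          push_cast
          ring_nf
        show Complex.exp _ = Complex.exp _
        rw [this, sub_eq_zero.mp h1.symm, mul_one])
      exact hrs h2.symm
  -- The expansion of `connFun` with `c r` solved for and the common zero cancelled. Unlike the `c
  -- r`, it is continuous at `ε₀` by construction, so the value there is read off as a limit through
  -- `ε ≠ ε₀`.
  let g : ℂ → ℂ := fun ε => ∑ r, (d r * (∏ i ∈ Finset.univ.erase r, (ε - 1 + (ρ i : ℂ))) /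
    D (ε - 1 + ρ r)) * logSolInfty ρ r w
  have hgcont : ContinuousAt g ε₀ := by
    refine tendsto_finsetSum _ fun r _ => ?_
    refine ContinuousAt.mul (ContinuousAt.div (by fun_prop) ?_ (hDne r)) continuousAt_const
    exact (hDcont.comp (by fun_prop : Continuous fun ε : ℂ => ε - 1 + ρ r)).continuousAt
  have hFcont : ContinuousAt (fun ε => connFun ρ ε w) ε₀ := by
    simp only [connFun, normPoly]
    have h1 := (analyticAt_hypInt_exponent hρ hn 0 hε₀E hwcut).continuousAt
    have h2 := (analyticAt_gammaQuot hρ hε₀E).continuousAt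
    have h3 := (analyticAt_infSeries_exponent hρ hε₀1 hw.2).continuousAt
    exact ((by fun_prop : ContinuousAt (fun ε : ℂ => ∏ i, (ε - 1 + (ρ i : ℂ))) ε₀).mul h1).add
      (((by fun_prop : ContinuousAt (fun ε : ℂ => ε ^ n) ε₀).mul h2).mul h3)
  have heq : ∀ᶠ ε : ℂ in 𝓝[≠] ε₀, connFun ρ ε w = g ε := by
    have hD' : ∀ᶠ ε : ℂ in 𝓝[≠] ε₀, ∀ r, D (ε - 1 + ρ r) ≠ 0 :=
      Filter.eventually_all.mpr fun r => nhdsWithin_le_nhds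
        ((hDcont.comp (by fun_prop : Continuous fun ε : ℂ => ε - 1 + ρ r)).continuousAt.eventually_ne
          (hDne r))
    have hx' : ∀ᶠ ε : ℂ in 𝓝[≠] ε₀, ∀ r, ε - 1 + ρ r ≠ 0 :=
      Filter.eventually_all.mpr fun r => by
        rcases eq_or_ne r s with rfl | hrs
        · filter_upwards [self_mem_nhdsWithin] with ε hε h
          refine hε ?_
          simp only [Set.mem_singleton_iff, hε₀]
          linear_combination h
        · refine nhdsWithin_le_nhds ((by fun_prop : ContinuousAt (fun ε : ℂ => ε - 1 + ρ r)
            ε₀).eventually_ne ?_)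
          rw [hε₀, show (1 : ℂ) - ρ s - 1 + ρ r = ((ρ r - ρ s : ℝ) : ℂ) by push_cast; ring,
            Complex.ofReal_ne_zero, sub_ne_zero]
          exact fun h => hrs (hinj h)
    filter_upwards [hD', hx', nhdsWithin_le_nhds ((isOpen_expSet ρ).mem_nhds hε₀E),
      nhdsWithin_le_nhds ((isOpen_lt Complex.continuous_re continuous_const).mem_nhds hε₀1)]
      with ε h1 h2 h3 h4
    obtain ⟨c, hc, hcd⟩ := hd ε h3 h4
    rw [hc w hw.1 hw.2]
    refine Finset.sum_congr rfl fun r _ => ?_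
    congr 1
    rw [eq_div_iff (h1 r)]
    refine mul_left_cancel₀ (h2 r) ?_
    have e1 : Complex.exp (2 * Real.pi * Complex.I * (ρ r + ε)) =
        Complex.exp (2 * Real.pi * Complex.I * (ε - 1 + ρ r)) := by
      rw [Complex.exp_eq_exp_iff_exists_int]
      exact ⟨1, by push_cast; ring⟩
    have h5 := hcd r
    rw [e1, ← hDmul, normPoly, ← Finset.mul_prod_erase _ _ (Finset.mem_univ r)] at h5
    linear_combination h5
  have hlim := tendsto_nhds_unique (hFcont.mono_left nhdsWithin_le_nhds)
    ((hgcont.mono_left nhdsWithin_le_nhds).congr' (heq.mono fun _ h => h.symm))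
  have hF0 : connFun ρ ε₀ w = (ε₀ ^ n * gammaQuot ρ ε₀) * infSeries ρ ε₀ w := by
    rw [connFun, normPoly, Finset.prod_eq_zero (Finset.mem_univ s), zero_mul, zero_add]
    simp only [hε₀]
    ring
  have hg0 : g ε₀ = (d s * (∏ i ∈ Finset.univ.erase s, ((ρ i : ℂ) - ρ s)) /
      (2 * Real.pi * Complex.I)) * logSolInfty ρ s w := by
    simp only [g]
    -- For `r ≠ s` the product over `i ≠ r` still contains the factor `i = s`, which is zero at
    -- `ε₀`.
    rw [Finset.sum_eq_single s]
    · rw [show ε₀ - 1 + (ρ s : ℂ) = 0 by rw [hε₀]; ring, hD0, Finset.prod_congr rfl fun i _ =>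
        show ε₀ - 1 + (ρ i : ℂ) = ρ i - ρ s by rw [hε₀]; ring]
    · intro r _ hrs
      rw [Finset.prod_eq_zero (Finset.mem_erase.mpr ⟨hrs.symm, Finset.mem_univ s⟩)]
      · simp
      · rw [hε₀]; ring
    · simp
  simp only [] at hlim
  rw [hF0, hg0, hε₀, pow_mul_gammaQuot_one_sub hρ hinj] at hlim
  have hprod : ∏ i ∈ Finset.univ.erase s, ((ρ i : ℂ) - ρ s) ≠ 0 :=
    Finset.prod_ne_zero_iff.mpr fun i hi => by
      rw [← Complex.ofReal_sub, Complex.ofReal_ne_zero, sub_ne_zero]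
      exact fun h => (Finset.mem_erase.mp hi).1 (hinj h)
  have hpi : (Real.pi : ℂ) ≠ 0 := by exact_mod_cast Real.pi_ne_zero
  have hI := Complex.I_ne_zero
  have h6 : Complex.sin (Real.pi * ρ s) / Real.pi * Complex.exp (Real.pi * Complex.I * ρ s) *
      (∏ i ∈ Finset.univ.erase s, ((ρ i : ℂ) - ρ s)) * logSolInfty ρ s w =
      d s * (∏ i ∈ Finset.univ.erase s, ((ρ i : ℂ) - ρ s)) /
      (2 * Real.pi * Complex.I) * logSolInfty ρ s w := by
    rw [← hlim, logSolInfty]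
    ring
  have h7 := mul_right_cancel₀ hws h6
  rw [eq_div_iff Complex.two_pi_I_ne_zero] at h7
  refine mul_right_cancel₀ hprod ?_
  rw [← h7]
  field_simp

/-! ### The transition coefficients -/

omit hρ in
theorem cpow_mul_funB (C : ℝ) (k : Fin n) (ε : ℂ) :
    (C : ℂ) ^ (-ε) * funB ρ k ε = expFactor ρ C ε *
      (Complex.exp (-((Real.pi : ℂ) * Complex.I * ε)) *
        (Complex.sin ((Real.pi : ℂ) * (ρ k : ℂ)) /
          Complex.sin ((Real.pi : ℂ) * (ρ k : ℂ) + (Real.pi : ℂ) * ε))) := by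
  rw [funB, expFactor, gammaQuot, ← Finset.prod_inv_distrib]
  simp only [inv_div]
  ring

theorem analyticAt_cpow_mul_funB {C : ℝ} (hC : 0 < C) (k : Fin n) :
    AnalyticAt ℂ (fun ε => (C : ℂ) ^ (-ε) * funB ρ k ε) 0 := by
  have hsin := sin_pi_mul_ne_zero (hρ k).1 (hρ k).2
  simp only [cpow_mul_funB]
  refine (analyticAt_expFactor hρ hC (zero_mem_expSet hρ)).mul (AnalyticAt.mul (by fun_prop)
    (analyticAt_const.div (by fun_prop) (by simpa using hsin)))

/-- The connection formula. -/
theorem logSolZero_eq_sum (hn : 1 ≤ n) (hinj : Function.Injective ρ) {C : ℝ} (hC : 0 < C) {m : ℕ}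
    (hm : m < n) {w : ℂ} (hw : w ∈ lowerStrip) (hw0 : 0 < w.re) :
    logSolZero ρ C m w = ∑ r, transitionCoeff ρ C m r * logSolInfty ρ r w := by
  have h0 := zero_mem_expSet hρ
  obtain ⟨d, hd⟩ := exists_connection_constants hρ hn hinj
  have hd' := connection_constants_eq hρ hn hinj hd
  have hN : ∀ᶠ ε in 𝓝 (0 : ℂ), normPoly ρ ε ≠ 0 := by
    have : ContinuousAt (normPoly ρ) 0 := by
      show ContinuousAt (fun ε : ℂ => ∏ i, (ε - 1 + (ρ i : ℂ))) 0
      fun_prop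
    exact this.eventually_ne (normPoly_zero_ne_zero hρ)
  have hS : ∀ᶠ ε in 𝓝 (0 : ℂ), ∀ k : Fin n,
      Complex.sin ((Real.pi : ℂ) * (ρ k : ℂ) + (Real.pi : ℂ) * ε) ≠ 0 :=
    Filter.eventually_all.mpr fun k => ContinuousAt.eventually_ne (by fun_prop)
      (by simpa using sin_pi_mul_ne_zero (hρ k).1 (hρ k).2)
  -- Solving `connFun` for `hypInt` and multiplying by `expFactor`, the series at infinity
  -- contributes `ε^n h(ε)`: the factor `φ(ε)` cancels, so `h` is holomorphic at `0`, and
  -- derivatives of order `m < n` do not see this term.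
  let h : ℂ → ℂ := fun ε => -((C : ℂ) ^ (-ε) * infSeries ρ ε w / normPoly ρ ε)
  have hh : AnalyticAt ℂ h 0 := by
    have hC' : (C : ℂ) ∈ Complex.slitPlane := Complex.ofReal_mem_slitPlane.mpr hC
    have h1 : AnalyticAt ℂ (normPoly ρ) 0 := by
      show AnalyticAt ℂ (fun ε : ℂ => ∏ i, (ε - 1 + (ρ i : ℂ))) 0
      exact Finset.analyticAt_fun_prod _ fun i _ => by fun_prop
    exact ((((analyticAt_const.cpow analyticAt_id.neg hC').mul
      (analyticAt_infSeries_exponent hρ (by simp) hw0)).div h1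
        (normPoly_zero_ne_zero hρ))).neg
  have heq : (fun ε => expFactor ρ C ε * hypInt ρ 0 ε w) =ᶠ[𝓝 0] fun ε => ε ^ n * h ε +
      ∑ r, logSolInfty ρ r w * ((C : ℂ) ^ (-ε) * funB ρ r ε) := by
    filter_upwards [hN, hS, (isOpen_expSet ρ).mem_nhds h0,
      (isOpen_lt Complex.continuous_re continuous_const).mem_nhds (show (0 : ℂ).re < 1 by simp)]
      with ε h1 h2 h3 h4
    obtain ⟨c, hc, hcd⟩ := hd ε h3 h4
    have hφ := gammaQuot_ne_zero hρ h3
    have h5 := hc w hw hw0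
    have h6 : ∀ r, logSolInfty ρ r w * ((C : ℂ) ^ (-ε) * funB ρ r ε) =
        expFactor ρ C ε / normPoly ρ ε * (c r * logSolInfty ρ r w) := fun r => by
      have h7 := hcd r
      rw [exp_two_pi_I_sub_one, hd' r, mul_add (Real.pi : ℂ)] at h7
      have hI := Complex.I_ne_zero
      have hE := Complex.exp_ne_zero (Real.pi * Complex.I * ρ r)
      have e1 : Complex.exp (Real.pi * Complex.I * (ρ r + ε)) *
          Complex.exp (-(Real.pi * Complex.I * ε)) = Complex.exp (Real.pi * Complex.I * ρ r) := by
        rw [← Complex.exp_add]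
        ring_nf
      have e2 : c r = normPoly ρ ε * (Complex.exp (-((Real.pi : ℂ) * Complex.I * ε)) *
          (Complex.sin ((Real.pi : ℂ) * (ρ r : ℂ)) /
            Complex.sin ((Real.pi : ℂ) * (ρ r : ℂ) + (Real.pi : ℂ) * ε))) := by
        have := h2 r
        rw [← e1] at h7 hE
        have hE' := left_ne_zero_of_mul hE
        rw [mul_div_assoc', mul_div_assoc', eq_div_iff this]
        refine mul_left_cancel₀ (mul_ne_zero (mul_ne_zero two_ne_zero hI) hE') ?_
        linear_combination h7
      rw [cpow_mul_funB, e2]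
      field_simp
    simp only [h6, ← Finset.mul_sum, ← h5, h, connFun, expFactor]
    field_simp
    ring
  have hana := analyticAt_cpow_mul_funB hρ hC
  rw [logSolZero, heq.iteratedDeriv_eq, iteratedDeriv_fun_add, iteratedDeriv_pow_mul_eq_zero hm hh,
    zero_add, iteratedDeriv_fun_sum, Finset.sum_div]
  · refine Finset.sum_congr rfl fun r _ => ?_
    rw [iteratedDeriv_const_mul_field, transitionCoeff]
    ring
  · exact fun r _ => (analyticAt_const.mul (hana r)).contDiffAt
  · exact (((analyticAt_id.pow n).mul hh)).contDiffAt
  · exact (Finset.analyticAt_fun_sum _ fun r _ => analyticAt_const.mul (hana r)).contDiffAt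

end

/-! ### Analytic continuation along paths -/

section Continuation

variable {x y z : ℂ} {γ : Path x y} {f f' g g' : ℂ → ℂ}

theorem IsAnalyticContinuationAlong.congr (h : IsAnalyticContinuationAlong γ f g)
    (hf : f =ᶠ[𝓝 x] f') (hg : g =ᶠ[𝓝 y] g') : IsAnalyticContinuationAlong γ f' g' := by
  obtain ⟨H, h1, h2, h3, h4⟩ := h
  exact ⟨H, h1, h2.trans hf, h3.trans hg, h4⟩

theorem isAnalyticContinuationAlong_of_analyticAt (hf : ∀ s, AnalyticAt ℂ f (γ s)) :
    IsAnalyticContinuationAlong γ f f :=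
  ⟨fun _ => f, hf, .rfl, .rfl, fun _ => .of_forall fun _ => .rfl⟩

theorem IsAnalyticContinuationAlong.sum {ι : Type*} [Fintype ι] (c : ι → ℂ) {f g : ι → ℂ → ℂ}
    (h : ∀ i, IsAnalyticContinuationAlong γ (f i) (g i)) :
    IsAnalyticContinuationAlong γ (fun t => ∑ i, c i * f i t) (fun t => ∑ i, c i * g i t) := by
  choose H h1 h2 h3 h4 using h
  have key : ∀ {p : ℂ} {u v : ι → ℂ → ℂ}, (∀ i, u i =ᶠ[𝓝 p] v i) →
      (fun t => ∑ i, c i * u i t) =ᶠ[𝓝 p] fun t => ∑ i, c i * v i t := fun huv => by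
    filter_upwards [Filter.eventually_all.mpr huv] with t ht
    simp only [ht]
  exact ⟨fun s t => ∑ i, c i * H i s t,
    fun s => Finset.analyticAt_fun_sum _ fun i _ => analyticAt_const.mul (h1 i s),
    key h2, key h3, fun s => (Filter.eventually_all.mpr fun i => h4 i s).mono fun _ hs => key hs⟩

theorem IsAnalyticContinuationAlong.symm (h : IsAnalyticContinuationAlong γ f g) :
    IsAnalyticContinuationAlong γ.symm g f := by
  obtain ⟨H, h1, h2, h3, h4⟩ := h
  refine ⟨fun s => H (unitInterval.symm s), fun s => h1 _, by simpa using h3, by simpa using h2,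
    fun s => ?_⟩
  exact (unitInterval.continuous_symm.tendsto s).eventually (h4 (unitInterval.symm s))

/-- Two families of germs along the two parts of a path that agree where the parts meet. -/
theorem isAnalyticContinuationAlong_of_glue (s₀ : unitInterval) (a b : unitInterval → ℂ → ℂ)
    (ha : ∀ s ≤ s₀, AnalyticAt ℂ (a s) (γ s)) (hb : ∀ s, s₀ ≤ s → AnalyticAt ℂ (b s) (γ s))
    (ha' : ∀ s ≤ s₀, ∀ᶠ s' in 𝓝[Set.Iic s₀] s, a s' =ᶠ[𝓝 (γ s')] a s)
    (hb' : ∀ s, s₀ ≤ s → ∀ᶠ s' in 𝓝[Set.Ici s₀] s, b s' =ᶠ[𝓝 (γ s')] b s)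
    (hab : a s₀ =ᶠ[𝓝 (γ s₀)] b s₀) (h0 : 0 ≤ s₀) (h1 : s₀ < 1) :
    IsAnalyticContinuationAlong γ (a 0) (b 1) := by
  classical
  refine ⟨fun s => if s ≤ s₀ then a s else b s, fun s => ?_, by simp [h0], by simp [h1.not_ge],
    fun s => ?_⟩
  · dsimp only
    split_ifs with hs
    · exact ha s hs
    · exact hb s (not_le.mp hs).le
  · rcases lt_trichotomy s s₀ with hs | hs | hs
    · have h := ha' s hs.le
      rw [nhdsWithin_eq_nhds.mpr (Iic_mem_nhds hs)] at h
      filter_upwards [h, Iic_mem_nhds hs] with s' h1 h2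
      simpa [Set.mem_Iic.mp h2, hs.le] using h1
    · subst hs
      have h1 := ha' s le_rfl
      have h2 := hb' s le_rfl
      -- The germs agree on a neighbourhood of the meeting point, hence also as germs at all nearby
      -- points of the path.
      have h3 := γ.continuous.continuousAt.eventually (eventually_eventually_nhds.mpr hab)
      rw [eventually_nhdsWithin_iff] at h1 h2
      filter_upwards [h1, h2, h3] with s' h1 h2 h3
      simp only [le_refl, if_true]
      split_ifs with hs'
      · exact h1 hs'
      · exact (h2 (not_le.mp hs').le).trans (Filter.EventuallyEq.symm h3)
    · have h := hb' s hs.le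
      rw [nhdsWithin_eq_nhds.mpr (Ici_mem_nhds hs)] at h
      filter_upwards [h, Ioi_mem_nhds hs] with s' h1 h2
      simpa [(Set.mem_Ioi.mp h2).not_ge, hs.not_ge] using h1

theorem IsAnalyticContinuationAlong.trans {γ' : Path y z} {k : ℂ → ℂ}
    (h : IsAnalyticContinuationAlong γ f g) (h' : IsAnalyticContinuationAlong γ' g k) :
    IsAnalyticContinuationAlong (γ.trans γ') f k := by
  obtain ⟨H, h1, h2, h3, h4⟩ := h
  obtain ⟨K, k1, k2, k3, k4⟩ := h'
  -- Clamping extends the parameters of the two halves continuously to the whole interval.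
  let σ : unitInterval → unitInterval := fun s => Set.projIcc 0 1 zero_le_one (2 * (s : ℝ))
  let τ : unitInterval → unitInterval := fun s => Set.projIcc 0 1 zero_le_one (2 * (s : ℝ) - 1)
  have hσ : Continuous σ := continuous_projIcc.comp (by fun_prop)
  have hτ : Continuous τ := continuous_projIcc.comp (by fun_prop)
  let s₀ : unitInterval := ⟨1 / 2, by norm_num, by norm_num⟩
  have hσ0 : σ 0 = 0 := Subtype.ext (by simp [σ])
  have hτ1 : τ 1 = 1 := Subtype.ext (by norm_num [τ, Set.coe_projIcc])
  have hσs : σ s₀ = 1 := Subtype.ext (by simp [σ, s₀])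
  have hτs : τ s₀ = 0 := Subtype.ext (by simp [τ, s₀])
  have hle : ∀ s ≤ s₀, γ.trans γ' s = γ (σ s) := fun s hs => by
    have : (s : ℝ) ≤ 1 / 2 := hs
    rw [Path.trans, Path.coe_mk_mk]
    simp only [Function.comp_apply, this, if_true]
    rfl
  have hge : ∀ s, s₀ ≤ s → γ.trans γ' s = γ' (τ s) := fun s hs => by
    rcases hs.eq_or_lt with rfl | hs
    · rw [hle _ le_rfl, hσs, hτs]
      simp
    · have : ¬ (s : ℝ) ≤ 1 / 2 := not_le.mpr hs
      rw [Path.trans, Path.coe_mk_mk]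
      simp only [Function.comp_apply, this, if_false]
      rfl
  have key := isAnalyticContinuationAlong_of_glue (γ := γ.trans γ') s₀ (fun s => H (σ s))
    (fun s => K (τ s)) (fun s hs => hle s hs ▸ h1 _) (fun s hs => hge s hs ▸ k1 _)
    (fun s hs => by
      filter_upwards [nhdsWithin_le_nhds ((hσ.tendsto s).eventually (h4 (σ s))),
        self_mem_nhdsWithin] with s' e1 e2
      rwa [hle s' e2])
    (fun s hs => by
      filter_upwards [nhdsWithin_le_nhds ((hτ.tendsto s).eventually (k4 (τ s))),
        self_mem_nhdsWithin] with s' e1 e2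
      rwa [hge s' e2])
    (by
      rw [hσs, hτs, hle _ le_rfl, hσs, γ.target]
      exact h3.trans k2.symm)
    s₀.2.1 (show (1 / 2 : ℝ) < 1 by norm_num)
  refine key.congr ?_ ?_
  · simpa only [hσ0] using h2
  · simpa only [hτ1] using k3

/-- Near `γ s` the branch `w s + log (t / γ s)` of the logarithm is centred at `log 1`, away from
the cut. Two such branches differ by a multiple of `2πi`, which is continuous and zero at `(s, γ
s)`, hence zero nearby. -/
theorem isAnalyticContinuationAlong_lift {w : unitInterval → ℂ} (hw : Continuous w) {C : ℂ}
    (hC : C ≠ 0) (hexp : ∀ s, Complex.exp (w s) = C * γ s) {Y : ℂ → ℂ} {U : Set ℂ}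
    (hY : AnalyticOnNhd ℂ Y U) (hwU : ∀ s, w s ∈ U) :
    IsAnalyticContinuationAlong γ (fun t => Y (w 0 + Complex.log (t / x)))
      (fun t => Y (w 1 + Complex.log (t / y))) := by
  have hγ0 : ∀ s, γ s ≠ 0 := fun s h => Complex.exp_ne_zero (w s) (by rw [hexp, h, mul_zero])
  refine ⟨fun s t => Y (w s + Complex.log (t / γ s)), fun s => ?_, by simp,
    by simp, fun s => ?_⟩
  · have h1 : AnalyticAt ℂ Y (w s + Complex.log (γ s / γ s)) := by
      rw [div_self (hγ0 s), Complex.log_one, add_zero]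
      exact hY _ (hwU s)
    refine h1.comp (f := fun t => w s + Complex.log (t / γ s)) (analyticAt_const.add
      (AnalyticAt.clog (analyticAt_id.div_const) ?_))
    simp [div_self (hγ0 s)]
  · let d : unitInterval × ℂ → ℂ := fun p =>
      w p.1 + Complex.log (p.2 / γ p.1) - (w s + Complex.log (p.2 / γ s))
    have hd0 : d (s, γ s) = 0 := by simp [d]
    have hdc : ContinuousAt d (s, γ s) := by
      have e1 : ContinuousAt (fun p : unitInterval × ℂ => p.2 / γ p.1) (s, γ s) :=
        continuousAt_snd.div (γ.continuous.comp continuous_fst).continuousAt (hγ0 s)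
      have e2 : ContinuousAt (fun p : unitInterval × ℂ => p.2 / γ s) (s, γ s) :=
        continuousAt_snd.div_const _
      refine ContinuousAt.sub (ContinuousAt.add (hw.comp continuous_fst).continuousAt (e1.clog ?_))
        (continuousAt_const.add (e2.clog ?_)) <;> simp [div_self (hγ0 s)]
    have hd : ∀ᶠ p in 𝓝 (s, γ s), d p = 0 := by
      have h1 : ∀ᶠ p in 𝓝 (s, γ s), ‖d p‖ < 2 * Real.pi :=
        hdc.norm.eventually_lt continuousAt_const (by simp [hd0, Real.pi_pos])
      have h2 : ∀ᶠ p : unitInterval × ℂ in 𝓝 (s, γ s), p.2 ≠ 0 :=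
        continuousAt_snd.eventually_ne (hγ0 s)
      filter_upwards [h1, h2] with p h1 h2
      have h3 : Complex.exp (d p) = 1 := by
        simp only [d]
        rw [Complex.exp_sub, Complex.exp_add, Complex.exp_add, hexp, hexp,
          Complex.exp_log (div_ne_zero h2 (hγ0 _)), Complex.exp_log (div_ne_zero h2 (hγ0 _))]
        have := hγ0 p.1
        have := hγ0 s
        field_simp
      obtain ⟨k, hk⟩ := Complex.exp_eq_one_iff.mp h3
      rw [hk, norm_mul, Complex.norm_intCast] at h1
      have h4 : ‖2 * (Real.pi : ℂ) * Complex.I‖ = 2 * Real.pi := by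
        simp [abs_of_pos Real.pi_pos]
      rw [h4, mul_lt_iff_lt_one_left (by positivity)] at h1
      have h5 : k = 0 := Int.abs_lt_one_iff.mp (by exact_mod_cast h1)
      rw [hk, h5]
      simp
    have hcont : Continuous fun s' => (s', γ s') := continuous_id.prodMk γ.continuous
    filter_upwards [hcont.continuousAt.eventually (eventually_eventually_nhds.mpr hd)] with s' h
    have hcont' : Continuous fun t : ℂ => (s', t) := by fun_prop
    filter_upwards [hcont'.continuousAt.eventually h] with t ht
    simp only [sub_eq_zero.mp ht]

end Continuation

/-! ### Continuation of tuples of germs -/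

section Tuples

variable {x y z : ℂ} {γ : Path x y} {f g k : Fin n → ℂ → ℂ} {A B : Matrix (Fin n) (Fin n) ℂ}

/-- Continuation is linear, so constant matrices pass through it and multiply in the order in which
the paths are run. -/
theorem ContinuesTo.trans {γ' : Path y z} (h : ContinuesTo γ f A g) (h' : ContinuesTo γ' g B k) :
    ContinuesTo (γ.trans γ') f (A * B) k := fun i => by
  refine ((h i).trans (IsAnalyticContinuationAlong.sum (A i) h')).congr .rfl (.of_eq ?_)
  funext t
  rw [← Matrix.mulVec_mulVec]
  rfl

theorem ContinuesTo.symm (h : ContinuesTo γ f A g) (hA : IsUnit A.det) :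
    ContinuesTo γ.symm g A⁻¹ f := fun i => by
  refine (IsAnalyticContinuationAlong.sum (A⁻¹ i) fun j => (h j).symm).congr (.of_eq ?_) .rfl
  funext t
  change (A⁻¹ *ᵥ (A *ᵥ fun l => g l t)) i = g i t
  rw [Matrix.mulVec_mulVec, Matrix.nonsing_inv_mul _ hA, Matrix.one_mulVec]

end Tuples

/-! ### The bases in the logarithmic coordinate -/

/-- The tuple `basisZero` in the coordinate `w = log (C t)`. -/
noncomputable def vecZero (ρ : Fin n → ℝ) (C : ℝ) (w : ℂ) : Fin n → ℂ :=
  fun i => logSolZero ρ C (Fin.rev i : Fin n) w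

/-- The tuple `basisInfty` in the coordinate `w = log (C t)`. -/
noncomputable def vecInfty (ρ : Fin n → ℝ) (w : ℂ) : Fin n → ℂ :=
  fun i => logSolInfty ρ (Fin.rev i) w

/-- `A *ᵥ vecInfty ρ w` in the right half-plane and `B *ᵥ vecZero ρ C w` elsewhere. -/
noncomputable def gluedSol (ρ : Fin n → ℝ) (C : ℝ) (A B : Matrix (Fin n) (Fin n) ℂ) (w : ℂ) :
    Fin n → ℂ := 
  open Classical in if 0 < w.re then A *ᵥ vecInfty ρ w else B *ᵥ vecZero ρ C w

theorem vecInfty_add_two_pi_I (ρ : Fin n → ℝ) (w : ℂ) :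
    vecInfty ρ (w + 2 * Real.pi * Complex.I) = monodromyInfty ρ *ᵥ vecInfty ρ w := by
  funext i
  rw [monodromyInfty, Matrix.mulVec_diagonal]
  exact logSolInfty_add_two_pi_I ρ _ w

theorem isUnit_det_monodromyZero (n : ℕ) : IsUnit (monodromyZero n).det := by
  rw [Matrix.det_of_isUpperTriangular (fun i j hij => by
    simpa [monodromyZero] using fun h => absurd hij (not_lt.mpr h))]
  simp [monodromyZero]

theorem log_re_neg {C : ℝ} (hC : 0 < C) {t : ℂ} (ht : t ≠ 0) (h : ‖t‖ < 1 / C) :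
    (Complex.log ((C : ℂ) * t)).re < 0 := by
  rw [Complex.log_re, norm_mul, Complex.norm_real, Real.norm_of_nonneg hC.le]
  refine Real.log_neg (by positivity) ?_
  rw [lt_div_iff₀ hC] at h
  linarith

theorem log_re_pos {C : ℝ} (hC : 0 < C) {t : ℂ} (h : 1 / C < ‖t‖) :
    0 < (Complex.log ((C : ℂ) * t)).re := by
  rw [Complex.log_re, norm_mul, Complex.norm_real, Real.norm_of_nonneg hC.le]
  refine Real.log_pos ?_
  rw [div_lt_iff₀ hC] at h
  linarith

theorem analyticAt_log_const_mul {C : ℝ} (hC : 0 < C) {t : ℂ} (ht : t ∈ Complex.slitPlane) :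
    AnalyticAt ℂ (fun t : ℂ => Complex.log ((C : ℂ) * t)) t := by
  refine (analyticAt_const.mul analyticAt_id).clog ?_
  rw [Complex.mem_slitPlane_iff] at ht ⊢
  simpa [hC, hC.ne'] using ht

theorem log_mem_lowerStrip {C : ℝ} (hC : 0 < C) {t : ℂ} (h : t.im < 0) :
    Complex.log ((C : ℂ) * t) ∈ lowerStrip := by
  rw [lowerStrip, Set.mem_ofPred_eq, Complex.log_im, Complex.arg_neg_iff, Complex.im_ofReal_mul]
  exact ⟨by linarith [Complex.neg_pi_lt_arg ((C : ℂ) * t), Real.pi_pos],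
    mul_neg_of_pos_of_neg hC h⟩

theorem log_mem_upperStrip {C : ℝ} (hC : 0 < C) {t : ℂ} (h : 0 < t.im) :
    Complex.log ((C : ℂ) * t) ∈ upperStrip := by
  have h1 : 0 < ((C : ℂ) * t).im := by
    rw [Complex.im_ofReal_mul]
    exact mul_pos hC h
  have h2 : ((C : ℂ) * t).arg ≠ 0 := fun h0 => h1.ne' (Complex.arg_eq_zero_iff.mp h0).2
  rw [upperStrip, Set.mem_ofPred_eq, Complex.log_im]
  exact ⟨lt_of_le_of_ne (Complex.arg_nonneg_iff.mpr h1.le) h2.symm,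
    by linarith [Complex.arg_le_pi ((C : ℂ) * t), Real.pi_pos]⟩

theorem log_mul_exp_div {C : ℝ} (hC : 0 < C) {w : ℂ} (h1 : -Real.pi < w.im) (h2 : w.im < Real.pi) :
    Complex.log ((C : ℂ) * (Complex.exp w / C)) = w := by
  have hC' : (C : ℂ) ≠ 0 := by exact_mod_cast hC.ne'
  rw [mul_div_cancel₀ _ hC', Complex.log_exp h1 h2.le]

theorem exp_div_mem_slitPlane {C : ℝ} (hC : 0 < C) {w : ℂ} (h1 : -Real.pi < w.im)
    (h2 : w.im < Real.pi) : Complex.exp w / (C : ℂ) ∈ Complex.slitPlane := by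
  have hC' : (C : ℂ) ≠ 0 := by exact_mod_cast hC.ne'
  rw [Complex.mem_slitPlane_iff_arg]
  refine ⟨?_, div_ne_zero (Complex.exp_ne_zero w) hC'⟩
  rw [← Complex.arg_real_mul _ hC, ← Complex.log_im, log_mul_exp_div hC h1 h2]
  exact h2.ne

theorem norm_exp_div {C : ℝ} (hC : 0 < C) (w : ℂ) :
    ‖Complex.exp w / (C : ℂ)‖ = Real.exp w.re / C := by
  rw [norm_div, Complex.norm_exp, Complex.norm_real, Real.norm_of_nonneg hC.le]

theorem isOpen_slitDiscZero (C : ℝ) : IsOpen (slitDiscZero C) :=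
  Complex.isOpen_slitPlane.inter (isOpen_lt continuous_norm continuous_const)

theorem isOpen_slitDiscInfty (C : ℝ) : IsOpen (slitDiscInfty C) :=
  Complex.isOpen_slitPlane.inter (isOpen_lt continuous_const continuous_norm)

/-- The circle about `0` lifts to a vertical segment of length `2π` in the `w`-plane. -/
theorem isAnalyticContinuationAlong_circleLoop {r C : ℝ} (hr : 0 < r) (hC : 0 < C) {Y : ℂ → ℂ}
    {U : Set ℂ} (hY : AnalyticOnNhd ℂ Y U)
    (hU : ∀ s : ℝ, Complex.log ((C : ℂ) * r) + 2 * Real.pi * Complex.I * s ∈ U) :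
    IsAnalyticContinuationAlong (circleLoop 0 (r : ℂ)) (fun t => Y (Complex.log ((C : ℂ) * t)))
      (fun t => Y (Complex.log ((C : ℂ) * t) + 2 * Real.pi * Complex.I)) := by
  have hC' : (C : ℂ) ≠ 0 := by exact_mod_cast hC.ne'
  have hr' : (r : ℂ) ≠ 0 := by exact_mod_cast hr.ne'
  have hlog : ∀ t : ℂ, t ≠ 0 →
      Complex.log ((C : ℂ) * t) = Complex.log ((C : ℂ) * r) + Complex.log (t / r) := fun t ht => by
    rw [← Complex.ofReal_mul, ← Complex.ofReal_log (by positivity),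
      ← Complex.log_ofReal_mul (by positivity) (div_ne_zero ht hr')]
    congr 1
    push_cast
    field_simp
  refine (isAnalyticContinuationAlong_lift
    (w := fun s => Complex.log ((C : ℂ) * r) + 2 * Real.pi * Complex.I * ((s : ℝ) : ℂ))
    (by fun_prop) hC' (fun s => ?_) hY fun s => hU s).congr ?_ ?_
  · rw [Complex.exp_add, Complex.exp_log (mul_ne_zero hC' hr')]
    simp [circleLoop, mul_assoc]
  · filter_upwards [isOpen_ne.mem_nhds hr'] with t ht
    rw [hlog t ht]
    simp
  · filter_upwards [isOpen_ne.mem_nhds hr'] with t ht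
    rw [hlog t ht]
    simp [add_right_comm]

section

variable {ρ : Fin n → ℝ} (hρ : ∀ i, 0 < ρ i ∧ ρ i < 1)
include hρ

theorem vecZero_add_two_pi_I (hn : 1 ≤ n) {C : ℝ} (hC : 0 < C) {w : ℂ} (hw : w ∈ cutSet) :
    vecZero ρ C (w + 2 * Real.pi * Complex.I) = monodromyZero n *ᵥ vecZero ρ C w := by
  funext i
  have h := logSolZero_add hρ hn hC (Fin.rev i : Fin n) hw 1
  simp only [Nat.cast_one, mul_one, one_pow] at h
  rw [vecZero, h, Matrix.mulVec, dotProduct]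
  simp only [monodromyZero, Matrix.of_apply, ite_mul, zero_mul, ← Finset.sum_filter]
  symm
  -- The tuple is listed in decreasing order, so lowering the order of derivation by `j` moves `j`
  -- columns to the right.
  refine Finset.sum_bij (fun l _ => (l : ℕ) - (i : ℕ)) ?_ ?_ ?_ ?_
  · intro l hl
    simp only [Finset.mem_filter, Finset.mem_univ, true_and, Fin.le_def] at hl
    simp only [Finset.mem_range, Fin.val_rev]
    omega
  · intro a ha b hb hab
    simp only [Finset.mem_filter, Finset.mem_univ, true_and, Fin.le_def] at ha hb
    ext
    omega
  · intro j hj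
    simp only [Finset.mem_range, Fin.val_rev] at hj
    exact ⟨⟨(i : ℕ) + j, by omega⟩, by
      simp only [Finset.mem_filter, Finset.mem_univ, true_and, Fin.le_def]; omega, by simp⟩
  · intro l hl
    simp only [Finset.mem_filter, Finset.mem_univ, true_and, Fin.le_def] at hl
    rw [vecZero, show ((Fin.rev l : Fin n) : ℕ) = ((Fin.rev i : Fin n) : ℕ) - ((l : ℕ) - (i : ℕ)) by
      simp only [Fin.val_rev]; omega]

theorem vecZero_eq_mulVec (hn : 1 ≤ n) (hinj : Function.Injective ρ) {C : ℝ} (hC : 0 < C) {w : ℂ}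
    (hw : w ∈ lowerStrip) (hw0 : 0 < w.re) :
    vecZero ρ C w = transitionMatrix ρ C *ᵥ vecInfty ρ w := by
  funext i
  rw [vecZero, logSolZero_eq_sum hρ hn hinj hC (Fin.rev i).isLt hw hw0]
  exact (Equiv.sum_comp Fin.revPerm fun r =>
    transitionCoeff ρ C (Fin.rev i : Fin n) r * logSolInfty ρ r w).symm

theorem analyticOnNhd_dotProduct_vecZero (hn : 1 ≤ n) {C : ℝ} (hC : 0 < C) (v : Fin n → ℂ) :
    AnalyticOnNhd ℂ (fun w => v ⬝ᵥ vecZero ρ C w) cutSet :=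
  Finset.analyticOnNhd_fun_sum _ fun _ _ =>
    analyticOnNhd_const.mul (analyticOnNhd_logSolZero hρ hn hC _)

theorem analyticOnNhd_dotProduct_vecInfty (v : Fin n → ℂ) :
    AnalyticOnNhd ℂ (fun w => v ⬝ᵥ vecInfty ρ w) {w : ℂ | 0 < w.re} :=
  Finset.analyticOnNhd_fun_sum _ fun _ _ =>
    analyticOnNhd_const.mul (analyticOnNhd_logSolInfty hρ _)

/-- The left half-plane and the lower strip have connected union inside `cutSet`; a relation
anywhere in it can be moved to the left half-plane. -/
theorem eq_zero_of_dotProduct_vecZero (hn : 1 ≤ n) {C : ℝ} (hC : 0 < C) {v : Fin n → ℂ} {w₀ : ℂ}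
    (hw₀ : w₀ ∈ {w : ℂ | w.re < 0} ∪ lowerStrip)
    (h : ∀ᶠ w in 𝓝 w₀, v ⬝ᵥ vecZero ρ C w = 0) : v = 0 := by
  have hpre : IsPreconnected ({w : ℂ | w.re < 0} ∪ lowerStrip) :=
    (convex_halfSpace_re_lt 0).isPreconnected.union ⟨-1, -Real.pi⟩ (by simp) (mk_mem_lowerStrip _)
      convex_lowerStrip.isPreconnected
  have hsub : {w : ℂ | w.re < 0} ∪ lowerStrip ⊆ cutSet :=
    Set.union_subset (fun w => mem_cutSet_of_re_neg) lowerStrip_subset_cutSet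
  have h0 := ((analyticOnNhd_dotProduct_vecZero hρ hn hC v).mono
    hsub).eqOn_zero_of_preconnected_of_eventuallyEq_zero hpre hw₀ h
  have h1 := logSolZero_linearIndependent hρ hn hC (c := fun m => v (Fin.rev m)) fun w hw => by
    have h2 : v ⬝ᵥ vecZero ρ C w = 0 := h0 (Or.inl hw)
    rw [← h2, dotProduct, ← Equiv.sum_comp Fin.revPerm]
    simp [vecZero]
  funext i
  simpa using congrFun h1 (Fin.rev i)

theorem eq_zero_of_dotProduct_vecInfty (hinj : Function.Injective ρ) {O : Set ℂ} (hO : IsOpen O)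
    (hne : O.Nonempty) (hOR : ∀ w ∈ O, 0 < w.re) {v : Fin n → ℂ}
    (h : ∀ w ∈ O, v ⬝ᵥ vecInfty ρ w = 0) : v = 0 := by
  have h1 := logSolInfty_linearIndependent hρ hinj hO hne hOR (c := fun r => v (Fin.rev r))
    fun w hw => by
      rw [← h w hw, dotProduct, ← Equiv.sum_comp Fin.revPerm]
      simp [vecInfty]
  funext i
  simpa using congrFun h1 (Fin.rev i)

theorem basisZero_eq_vecZero (hn : 1 ≤ n) {C : ℝ} (hC : 0 < C) {t : ℂ} (ht : t ≠ 0)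
    (ht1 : ‖t‖ < 1 / C) :
    (fun l => basisZero ρ C l t) = vecZero ρ C (Complex.log ((C : ℂ) * t)) :=
  funext fun _ => solZero_eq_logSolZero hρ hn hC _ ht ht1

theorem basisInfty_eq_vecInfty {C : ℝ} (hC : 0 < C) {t : ℂ} (ht : t ≠ 0) :
    (fun l => basisInfty ρ C l t) = vecInfty ρ (Complex.log ((C : ℂ) * t)) :=
  funext fun _ => solInfty_eq_logSolInfty hρ hC _ ht

theorem eventually_basisZero_eq_vecZero (hn : 1 ≤ n) {C : ℝ} (hC : 0 < C) {t₀ : ℝ} (ht : 0 < t₀)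
    (ht1 : t₀ < 1 / C) : ∀ᶠ t in 𝓝 (t₀ : ℂ),
      (fun l => basisZero ρ C l t) = vecZero ρ C (Complex.log ((C : ℂ) * t)) := by
  have h0 : (t₀ : ℂ) ≠ 0 := by exact_mod_cast ht.ne'
  have h1 : ‖(t₀ : ℂ)‖ < 1 / C := by simpa [abs_of_pos ht] using ht1
  filter_upwards [isOpen_ne.mem_nhds h0,
    (isOpen_lt continuous_norm continuous_const).mem_nhds h1] with t e1 e2
  exact basisZero_eq_vecZero hρ hn hC e1 e2

theorem eventually_basisInfty_eq_vecInfty {C : ℝ} (hC : 0 < C) {R : ℝ} (hR : 0 < R) :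
    ∀ᶠ t in 𝓝 (R : ℂ),
      (fun l => basisInfty ρ C l t) = vecInfty ρ (Complex.log ((C : ℂ) * t)) := by
  have h0 : (R : ℂ) ≠ 0 := by exact_mod_cast hR.ne'
  filter_upwards [isOpen_ne.mem_nhds h0] with t e1
  exact basisInfty_eq_vecInfty hρ hC e1

/-! ### Fundamental systems and invertibility of the transition matrix -/

theorem isFundamentalSystemOn_basisZero (hn : 1 ≤ n) {C : ℝ} (hC : 0 < C) :
    IsFundamentalSystemOn ρ C (slitDiscZero C) (basisZero ρ C) := by
  refine ⟨fun i => isSolutionOn_of_hypOp ρ hC (isOpen_slitDiscZero C) (fun t ht => ht.1)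
    (U := {w : ℂ | w.re < 0}) (Y := logSolZero ρ C (Fin.rev i : Fin n))
    (fun t ht => log_re_neg hC (Complex.slitPlane_ne_zero ht.1) ht.2)
    (fun w hw => analyticOnNhd_logSolZero hρ hn hC _ w (mem_cutSet_of_re_neg hw))
    (fun t ht => solZero_eq_logSolZero hρ hn hC _ (Complex.slitPlane_ne_zero ht.1) ht.2)
    fun w hw => hypOp_logSolZero hρ hn hC (Fin.rev i).isLt hw, ?_⟩
  rw [Fintype.linearIndependent_iff]
  intro v hv
  refine congrFun (eq_zero_of_dotProduct_vecZero hρ hn hC (w₀ := -1) (Or.inl (by simp)) ?_)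
  have hO : IsOpen {w : ℂ | w.re < 0 ∧ -Real.pi < w.im ∧ w.im < Real.pi} :=
    isOpen_re_neg.inter ((isOpen_lt continuous_const Complex.continuous_im).inter
      (isOpen_lt Complex.continuous_im continuous_const))
  filter_upwards [hO.mem_nhds (show (-1 : ℂ) ∈ _ by simp [Real.pi_pos])] with w hw
  have hs := exp_div_mem_slitPlane hC hw.2.1 hw.2.2
  have hnorm : ‖Complex.exp w / (C : ℂ)‖ < 1 / C := by
    rw [norm_exp_div hC]
    exact div_lt_div_of_pos_right (Real.exp_lt_one_iff.mpr hw.1) hC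
  have h1 := congrFun hv ⟨Complex.exp w / C, hs, hnorm⟩
  have h2 := basisZero_eq_vecZero hρ hn hC (Complex.slitPlane_ne_zero hs) hnorm
  rw [log_mul_exp_div hC hw.2.1 hw.2.2] at h2
  rw [← h2]
  simpa [dotProduct] using h1

theorem isFundamentalSystemOn_basisInfty (hinj : Function.Injective ρ) {C : ℝ} (hC : 0 < C) :
    IsFundamentalSystemOn ρ C (slitDiscInfty C) (basisInfty ρ C) := by
  refine ⟨fun i => isSolutionOn_of_hypOp ρ hC (isOpen_slitDiscInfty C) (fun t ht => ht.1)
    (U := {w : ℂ | 0 < w.re}) (Y := logSolInfty ρ (Fin.rev i))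
    (fun t ht => log_re_pos hC ht.2) (analyticOnNhd_logSolInfty hρ _)
    (fun t ht => solInfty_eq_logSolInfty hρ hC _ (Complex.slitPlane_ne_zero ht.1))
    fun w hw => hypOp_logSolInfty hρ _ hw, ?_⟩
  rw [Fintype.linearIndependent_iff]
  intro v hv
  have hO : IsOpen {w : ℂ | 0 < w.re ∧ -Real.pi < w.im ∧ w.im < Real.pi} :=
    isOpen_re_pos.inter ((isOpen_lt continuous_const Complex.continuous_im).inter
      (isOpen_lt Complex.continuous_im continuous_const))
  refine congrFun (eq_zero_of_dotProduct_vecInfty hρ hinj hO ⟨1, by simp [Real.pi_pos]⟩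
    (fun w hw => hw.1) fun w hw => ?_)
  have hs := exp_div_mem_slitPlane hC hw.2.1 hw.2.2
  have hnorm : 1 / C < ‖Complex.exp w / (C : ℂ)‖ := by
    rw [norm_exp_div hC]
    exact div_lt_div_of_pos_right (Real.one_lt_exp_iff.mpr hw.1) hC
  have h1 := congrFun hv ⟨Complex.exp w / C, hs, hnorm⟩
  have h2 := basisInfty_eq_vecInfty hρ hC (Complex.slitPlane_ne_zero hs)
  rw [log_mul_exp_div hC hw.2.1 hw.2.2] at h2
  rw [← h2]
  simpa [dotProduct] using h1

/-- A row vector killing `P̃` would, by the connection formula, be a linear relation between the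
`f̃ₘ`. -/
theorem isUnit_det_transitionMatrix (hn : 1 ≤ n) (hinj : Function.Injective ρ) {C : ℝ}
    (hC : 0 < C) : IsUnit (transitionMatrix ρ C).det := by
  rw [isUnit_iff_ne_zero]
  intro hdet
  obtain ⟨v, hv, hvP⟩ := Matrix.exists_vecMul_eq_zero_iff.mpr hdet
  refine hv (eq_zero_of_dotProduct_vecZero hρ hn hC (w₀ := ⟨1, -Real.pi⟩)
    (Or.inr (mk_mem_lowerStrip 1)) ?_)
  filter_upwards [(isOpen_lowerStrip.inter isOpen_re_pos).mem_nhds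
    ⟨mk_mem_lowerStrip 1, by simp⟩] with w hw
  rw [vecZero_eq_mulVec hρ hn hinj hC hw.1 hw.2, Matrix.dotProduct_mulVec, hvP, zero_dotProduct]

/-- Translate to the lower strip by `2πi`, use the connection formula there, and undo the
translation: it acts by `M_∞` on one basis and by `m₀` on the other. -/
theorem mulVec_vecZero_eq_of_mem_upperStrip (hn : 1 ≤ n) (hinj : Function.Injective ρ) {C : ℝ}
    (hC : 0 < C) {w : ℂ} (hw : w ∈ upperStrip) (hw0 : 0 < w.re) :
    transitionMatrix ρ C *ᵥ vecInfty ρ w =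
      (transitionMatrix ρ C * monodromyInfty ρ * (transitionMatrix ρ C)⁻¹ *
        (monodromyZero n)⁻¹) *ᵥ vecZero ρ C w := by
  obtain ⟨u, rfl⟩ : ∃ u, w = u + 2 * Real.pi * Complex.I := ⟨_, (sub_add_cancel _ _).symm⟩
  have him : (u + 2 * Real.pi * Complex.I).im = u.im + 2 * Real.pi := by simp
  have hu : u ∈ lowerStrip := by
    have h1 := hw.1
    have h2 := hw.2
    rw [him] at h1 h2
    exact ⟨by linarith, by linarith⟩
  have hu0 : 0 < u.re := by simpa using hw0
  rw [vecInfty_add_two_pi_I, vecZero_add_two_pi_I hρ hn hC (lowerStrip_subset_cutSet hu),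
    Matrix.mulVec_mulVec, Matrix.mulVec_mulVec,
    Matrix.nonsing_inv_mul_cancel_right _ _ (isUnit_det_monodromyZero n),
    vecZero_eq_mulVec hρ hn hinj hC hu hu0, Matrix.mulVec_mulVec,
    Matrix.nonsing_inv_mul_cancel_right _ _ (isUnit_det_transitionMatrix hρ hn hinj hC)]

/-! ### Continuation along the paths of the theorem -/

omit hρ in
theorem gluedSol_eventuallyEq_vecInfty {C : ℝ} {A B : Matrix (Fin n) (Fin n) ℂ} {w : ℂ}
    (hw : 0 < w.re) : gluedSol ρ C A B =ᶠ[𝓝 w] fun w => A *ᵥ vecInfty ρ w := by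
  filter_upwards [isOpen_re_pos.mem_nhds hw] with u hu
  exact if_pos hu

omit hρ in
-- Inside `S` the two branches agree wherever the first is chosen, so the gluing is invisible there,
-- also at the imaginary axis where the choice changes.
theorem gluedSol_eventuallyEq_vecZero {C : ℝ} {A B : Matrix (Fin n) (Fin n) ℂ} {S : Set ℂ}
    (hS : IsOpen S) (hAB : ∀ w ∈ S, 0 < w.re → A *ᵥ vecInfty ρ w = B *ᵥ vecZero ρ C w) {w : ℂ}
    (hw : w.re < 0 ∨ w ∈ S) : gluedSol ρ C A B =ᶠ[𝓝 w] fun w => B *ᵥ vecZero ρ C w := by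
  filter_upwards [(isOpen_re_neg.union hS).mem_nhds hw] with u hu
  unfold gluedSol
  split_ifs with h
  · exact hAB u (hu.resolve_left (not_lt.mpr (le_of_lt h))) h
  · rfl

theorem analyticAt_gluedSol (hn : 1 ≤ n) {C : ℝ} (hC : 0 < C) {A B : Matrix (Fin n) (Fin n) ℂ}
    {S : Set ℂ} (hS : IsOpen S) (hScut : S ⊆ cutSet)
    (hAB : ∀ w ∈ S, 0 < w.re → A *ᵥ vecInfty ρ w = B *ᵥ vecZero ρ C w) {w : ℂ}
    (hw : 0 < w.re ∨ w.re < 0 ∨ w ∈ S) (i : Fin n) :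
    AnalyticAt ℂ (fun w => gluedSol ρ C A B w i) w := by
  rcases hw with hw | hw
  · exact (analyticOnNhd_dotProduct_vecInfty hρ (A i) w hw).congr
      ((gluedSol_eventuallyEq_vecInfty hw).mono fun u hu => (congrFun hu i).symm)
  · exact (analyticOnNhd_dotProduct_vecZero hρ hn hC (B i) w
      (hw.elim mem_cutSet_of_re_neg fun h => hScut h)).congr
        ((gluedSol_eventuallyEq_vecZero hS hAB hw).mono fun u hu => (congrFun hu i).symm)

/-- On the lower half-plane the principal `log (C t)` takes values in `lowerStrip`, however the path
winds around `1/C` inside it. A single function, `gluedSol` composed with the logarithm, is thus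
analytic along the path; the two end points lie in the left and right half-planes of `w`. -/
theorem continuesTo_path (hn : 1 ≤ n) (hinj : Function.Injective ρ) {C : ℝ} (hC : 0 < C)
    {t₀ R : ℝ} (ht₀ : 0 < t₀) (ht₁ : t₀ < 1 / C) (hR : 1 / C < R) (δ : Path (t₀ : ℂ) (R : ℂ))
    (hδ : ∀ s : unitInterval, 0 < s → s < 1 → (δ s).im < 0) :
    ContinuesTo δ (basisZero ρ C) (transitionMatrix ρ C) (basisInfty ρ C) := fun i => by
  have hR0 : 0 < R := lt_trans (by positivity) hR
  have hAB : ∀ w ∈ lowerStrip, 0 < w.re →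
      transitionMatrix ρ C *ᵥ vecInfty ρ w = (1 : Matrix (Fin n) (Fin n) ℂ) *ᵥ vecZero ρ C w :=
    fun w hw hw0 => by rw [Matrix.one_mulVec, vecZero_eq_mulVec hρ hn hinj hC hw hw0]
  have hlog : ∀ {t : ℝ}, 0 < t → ContinuousAt (fun t : ℂ => Complex.log ((C : ℂ) * t)) t :=
    fun ht => (hasDerivAt_log_const_mul hC (Complex.ofReal_mem_slitPlane.mpr ht)).continuousAt
  have ht₀n : (Complex.log ((C : ℂ) * (t₀ : ℂ))).re < 0 :=
    log_re_neg hC (by exact_mod_cast ht₀.ne') (by simpa [abs_of_pos ht₀] using ht₁)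
  have hRn : 0 < (Complex.log ((C : ℂ) * (R : ℂ))).re :=
    log_re_pos hC (by simpa [abs_of_pos hR0] using hR)
  have hmem : ∀ s, δ s ∈ Complex.slitPlane ∧ (0 < (Complex.log ((C : ℂ) * δ s)).re ∨
      (Complex.log ((C : ℂ) * δ s)).re < 0 ∨ Complex.log ((C : ℂ) * δ s) ∈ lowerStrip) := by
    intro s
    rcases eq_or_ne s 0 with rfl | h0
    · rw [δ.source]
      exact ⟨Complex.ofReal_mem_slitPlane.mpr ht₀, Or.inr (Or.inl ht₀n)⟩
    rcases eq_or_ne s 1 with rfl | h1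
    · rw [δ.target]
      exact ⟨Complex.ofReal_mem_slitPlane.mpr hR0, Or.inl hRn⟩
    have him := hδ s (unitInterval.pos_iff_ne_zero.mpr h0) (unitInterval.lt_one_iff_ne_one.mpr h1)
    exact ⟨Or.inr him.ne, Or.inr (Or.inr (log_mem_lowerStrip hC him))⟩
  refine (isAnalyticContinuationAlong_of_analyticAt (f := fun t => gluedSol ρ C
    (transitionMatrix ρ C) 1 (Complex.log ((C : ℂ) * t)) i) fun s => ?_).congr ?_ ?_
  · exact (analyticAt_gluedSol hρ hn hC isOpen_lowerStrip lowerStrip_subset_cutSet hAB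
      (hmem s).2 i).comp (f := fun t : ℂ => Complex.log ((C : ℂ) * t))
        (analyticAt_log_const_mul hC (hmem s).1)
  · filter_upwards [(hlog ht₀).eventually (gluedSol_eventuallyEq_vecZero isOpen_lowerStrip hAB
      (Or.inl ht₀n)), eventually_basisZero_eq_vecZero hρ hn hC ht₀ ht₁] with t h1 h2
    rw [h1, Matrix.one_mulVec, ← h2]
  · filter_upwards [(hlog hR0).eventually (gluedSol_eventuallyEq_vecInfty hRn),
      eventually_basisInfty_eq_vecInfty hρ hC hR0] with t h1 h2
    rw [h1, h2]

theorem hasMonodromy_circleLoop_zero (hn : 1 ≤ n) {C : ℝ} (hC : 0 < C) {t₀ : ℝ} (ht₀ : 0 < t₀)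
    (ht₁ : t₀ < 1 / C) :
    HasMonodromy (circleLoop 0 (t₀ : ℂ)) (basisZero ρ C) (monodromyZero n) := fun i => by
  have ht₀n : (Complex.log ((C : ℂ) * (t₀ : ℂ))).re < 0 :=
    log_re_neg hC (by exact_mod_cast ht₀.ne') (by simpa [abs_of_pos ht₀] using ht₁)
  have hlog : ContinuousAt (fun t : ℂ => Complex.log ((C : ℂ) * t)) t₀ :=
    (hasDerivAt_log_const_mul hC (Complex.ofReal_mem_slitPlane.mpr ht₀)).continuousAt
  refine (isAnalyticContinuationAlong_circleLoop ht₀ hC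
    (analyticOnNhd_logSolZero hρ hn hC (Fin.rev i : Fin n)) fun s =>
      mem_cutSet_of_re_neg (by simpa using ht₀n)).congr ?_ ?_
  · filter_upwards [eventually_basisZero_eq_vecZero hρ hn hC ht₀ ht₁] with t h
    exact (congrFun h i).symm
  · filter_upwards [eventually_basisZero_eq_vecZero hρ hn hC ht₀ ht₁,
      hlog.eventually (isOpen_re_neg.mem_nhds ht₀n)] with t h h1
    rw [h, ← vecZero_add_two_pi_I hρ hn hC (mem_cutSet_of_re_neg h1), vecZero]

theorem hasMonodromy_circleLoop_infty {C : ℝ} (hC : 0 < C) {R : ℝ} (hR : 1 / C < R) :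
    HasMonodromy (circleLoop 0 (R : ℂ)) (basisInfty ρ C) (monodromyInfty ρ) := fun i => by
  have hR0 : 0 < R := lt_trans (by positivity) hR
  have hRn : 0 < (Complex.log ((C : ℂ) * (R : ℂ))).re :=
    log_re_pos hC (by simpa [abs_of_pos hR0] using hR)
  refine (isAnalyticContinuationAlong_circleLoop hR0 hC
    (analyticOnNhd_logSolInfty hρ (Fin.rev i)) fun s => by simpa using hRn).congr ?_ ?_
  · filter_upwards [eventually_basisInfty_eq_vecInfty hρ hC hR0] with t h
    exact (congrFun h i).symm
  · filter_upwards [eventually_basisInfty_eq_vecInfty hρ hC hR0] with t h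
    rw [h, ← vecInfty_add_two_pi_I, vecInfty]

/-- The loop stays in `Re t > 0`, so the principal logarithm can be used throughout. It runs below
the real axis, crosses it to the right of `1/C`, and returns above. Each half is continued by a
glued function, and both equal `P̃ F̃` at the crossing. -/
theorem hasMonodromy_circleLoop_conifold (hn : 1 ≤ n) (hinj : Function.Injective ρ) {C : ℝ}
    (hC : 0 < C) {t₀ : ℝ} (ht₀ : 0 < t₀) (ht₁ : t₀ < 1 / C) :
    HasMonodromy (circleLoop (1 / (C : ℂ)) (t₀ : ℂ)) (basisZero ρ C)
      (transitionMatrix ρ C * monodromyInfty ρ * (transitionMatrix ρ C)⁻¹ *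
        (monodromyZero n)⁻¹) := fun i => by
  set N := transitionMatrix ρ C * monodromyInfty ρ * (transitionMatrix ρ C)⁻¹ * (monodromyZero n)⁻¹
  set γ := circleLoop (1 / (C : ℂ)) (t₀ : ℂ) with hγ
  have hlow : ∀ w ∈ lowerStrip, 0 < w.re →
      transitionMatrix ρ C *ᵥ vecInfty ρ w = (1 : Matrix (Fin n) (Fin n) ℂ) *ᵥ vecZero ρ C w :=
    fun w hw hw0 => by rw [Matrix.one_mulVec, vecZero_eq_mulVec hρ hn hinj hC hw hw0]
  have hupp : ∀ w ∈ upperStrip, 0 < w.re →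
      transitionMatrix ρ C *ᵥ vecInfty ρ w = N *ᵥ vecZero ρ C w := fun w hw hw0 =>
    mulVec_vecZero_eq_of_mem_upperStrip hρ hn hinj hC hw hw0
  have hlog : ∀ {t : ℂ}, t ∈ Complex.slitPlane →
      AnalyticAt ℂ (fun t : ℂ => Complex.log ((C : ℂ) * t)) t := fun ht =>
    analyticAt_log_const_mul hC ht
  have ht₀s : (t₀ : ℂ) ∈ Complex.slitPlane := Complex.ofReal_mem_slitPlane.mpr ht₀
  have ht₀n : (Complex.log ((C : ℂ) * (t₀ : ℂ))).re < 0 :=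
    log_re_neg hC (by exact_mod_cast ht₀.ne') (by simpa [abs_of_pos ht₀] using ht₁)
  -- The radius vector `t₀ - 1/C` is negative, so the counterclockwise circle starts on the left of
  -- its centre and enters the lower half-plane first.
  have hγs : ∀ s, γ s = ((1 / C - (1 / C - t₀) * Real.cos (2 * Real.pi * s) : ℝ) : ℂ) +
      ((-((1 / C - t₀) * Real.sin (2 * Real.pi * s)) : ℝ) : ℂ) * Complex.I := fun s => by
    rw [hγ, circleLoop, Path.coe_mk_mk,
      show 2 * (Real.pi : ℂ) * Complex.I * ((s : ℝ) : ℂ) = ((2 * Real.pi * s : ℝ) : ℂ) * Complex.I by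
        push_cast; ring, Complex.exp_mul_I]
    push_cast
    ring
  have hre : ∀ s, (γ s).re = 1 / C - (1 / C - t₀) * Real.cos (2 * Real.pi * s) := fun s => by
    rw [hγs]
    simp only [Complex.add_re, Complex.ofReal_re, Complex.re_ofReal_mul, Complex.I_re, mul_zero,
      add_zero]
  have him : ∀ s, (γ s).im = -((1 / C - t₀) * Real.sin (2 * Real.pi * s)) := fun s => by
    rw [hγs]
    simp only [Complex.add_im, Complex.ofReal_im, Complex.im_ofReal_mul, Complex.I_im, mul_one,
      zero_add]
  have hslit : ∀ s, γ s ∈ Complex.slitPlane := fun s => by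
    refine Or.inl ?_
    rw [hre]
    nlinarith [Real.cos_le_one (2 * Real.pi * s)]
  let s₀ : unitInterval := ⟨1 / 2, by norm_num, by norm_num⟩
  have hs₀ : 0 < (Complex.log ((C : ℂ) * γ s₀)).re := by
    refine log_re_pos hC (lt_of_lt_of_le ?_ (Complex.re_le_norm _))
    rw [hre, show 2 * Real.pi * ((s₀ : unitInterval) : ℝ) = Real.pi by simp only [s₀]; ring,
      Real.cos_pi]
    linarith
  have hcase₁ : ∀ s ≤ s₀, 0 < (Complex.log ((C : ℂ) * γ s)).re ∨
      (Complex.log ((C : ℂ) * γ s)).re < 0 ∨ Complex.log ((C : ℂ) * γ s) ∈ lowerStrip := by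
    intro s hs
    rcases eq_or_ne s 0 with rfl | h0
    · rw [γ.source]
      exact Or.inr (Or.inl ht₀n)
    rcases hs.eq_or_lt with rfl | hs
    · exact Or.inl hs₀
    refine Or.inr (Or.inr (log_mem_lowerStrip hC ?_))
    have h1 : 0 < (s : ℝ) := unitInterval.pos_iff_ne_zero.mpr h0
    have h2 : (s : ℝ) < 1 / 2 := hs
    rw [him, neg_lt_zero]
    exact mul_pos (by linarith) (Real.sin_pos_of_pos_of_lt_pi (by positivity)
      (by nlinarith [Real.pi_pos]))
  have hcase₂ : ∀ s, s₀ ≤ s → 0 < (Complex.log ((C : ℂ) * γ s)).re ∨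
      (Complex.log ((C : ℂ) * γ s)).re < 0 ∨ Complex.log ((C : ℂ) * γ s) ∈ upperStrip := by
    intro s hs
    rcases eq_or_ne s 1 with rfl | h1
    · rw [γ.target]
      exact Or.inr (Or.inl ht₀n)
    rcases hs.eq_or_lt with rfl | hs
    · exact Or.inl hs₀
    refine Or.inr (Or.inr (log_mem_upperStrip hC ?_))
    have h1 : (s : ℝ) < 1 := unitInterval.lt_one_iff_ne_one.mpr h1
    have h2 : 1 / 2 < (s : ℝ) := hs
    have h3 : Real.sin (2 * Real.pi * s) < 0 := by
      rw [← Real.sin_sub_two_pi]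
      exact Real.sin_neg_of_neg_of_neg_pi_lt (by nlinarith [Real.pi_pos])
        (by nlinarith [Real.pi_pos])
    rw [him, ← mul_neg]
    exact mul_pos (by linarith) (neg_pos.mpr h3)
  refine (isAnalyticContinuationAlong_of_glue (γ := γ) s₀
    (fun _ t => gluedSol ρ C (transitionMatrix ρ C) 1 (Complex.log ((C : ℂ) * t)) i)
    (fun _ t => gluedSol ρ C (transitionMatrix ρ C) N (Complex.log ((C : ℂ) * t)) i)
    (fun s hs => ?_) (fun s hs => ?_) (fun _ _ => .of_forall fun _ => .rfl)
    (fun _ _ => .of_forall fun _ => .rfl) ?_ s₀.2.1 (show (1 / 2 : ℝ) < 1 by norm_num)).congr ?_ ?_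
  · exact (analyticAt_gluedSol hρ hn hC isOpen_lowerStrip lowerStrip_subset_cutSet hlow
      (hcase₁ s hs) i).comp (f := fun t : ℂ => Complex.log ((C : ℂ) * t)) (hlog (hslit s))
  · exact (analyticAt_gluedSol hρ hn hC isOpen_upperStrip upperStrip_subset_cutSet hupp
      (hcase₂ s hs) i).comp (f := fun t : ℂ => Complex.log ((C : ℂ) * t)) (hlog (hslit s))
  · have hc := (hlog (hslit s₀)).continuousAt
    filter_upwards [hc.eventually (gluedSol_eventuallyEq_vecInfty hs₀),
      hc.eventually (gluedSol_eventuallyEq_vecInfty hs₀)] with t h1 h2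
    rw [h1, h2]
  · filter_upwards [(hlog ht₀s).continuousAt.eventually (gluedSol_eventuallyEq_vecZero
      isOpen_lowerStrip hlow (Or.inl ht₀n)),
      eventually_basisZero_eq_vecZero hρ hn hC ht₀ ht₁] with t h1 h2
    rw [h1, Matrix.one_mulVec, ← h2]
  · filter_upwards [(hlog ht₀s).continuousAt.eventually (gluedSol_eventuallyEq_vecZero
      isOpen_upperStrip hupp (Or.inl ht₀n)),
      eventually_basisZero_eq_vecZero hρ hn hC ht₀ ht₁] with t h1 h2
    rw [h1, h2]

end

end HypergeometricMonodromy

open HypergeometricMonodromy in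
theorem mainTheorem11 (n : ℕ) (hn : 1 ≤ n) (ρ : Fin n → ℝ) (hρ : StrictMono ρ)
    (hρ01 : ∀ i, 0 < ρ i ∧ ρ i < 1) (C : ℝ) (hC : 0 < C) :
    IsFundamentalSystemOn ρ C (slitDiscZero C) (basisZero ρ C) ∧
    IsFundamentalSystemOn ρ C (slitDiscInfty C) (basisInfty ρ C) ∧
    IsUnit (transitionMatrix ρ C).det ∧
    ∀ t₀ R : ℝ, 0 < t₀ → t₀ < 1 / C → 1 / C < R →
      ∀ δ : Path (t₀ : ℂ) (R : ℂ), (∀ s : unitInterval, 0 < s → s < 1 → (δ s).im < 0) →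
        ContinuesTo δ (basisZero ρ C) (transitionMatrix ρ C) (basisInfty ρ C) ∧
        HasMonodromy (circleLoop 0 (t₀ : ℂ)) (basisZero ρ C) (monodromyZero n) ∧
        HasMonodromy (circleLoop 0 (R : ℂ)) (basisInfty ρ C) (monodromyInfty ρ) ∧
        HasMonodromy ((δ.trans (circleLoop 0 (R : ℂ))).trans δ.symm) (basisZero ρ C)
          (transitionMatrix ρ C * monodromyInfty ρ * (transitionMatrix ρ C)⁻¹) ∧
        HasMonodromy (circleLoop (1 / (C : ℂ)) (t₀ : ℂ)) (basisZero ρ C)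
          (transitionMatrix ρ C * monodromyInfty ρ * (transitionMatrix ρ C)⁻¹ *
            (monodromyZero n)⁻¹) := by
  have hinj := hρ.injective
  have hP := isUnit_det_transitionMatrix hρ01 hn hinj hC
  refine ⟨isFundamentalSystemOn_basisZero hρ01 hn hC,
    isFundamentalSystemOn_basisInfty hρ01 hinj hC, hP, fun t₀ R ht₀ ht₁ hR δ hδ => ?_⟩
  have h1 := continuesTo_path hρ01 hn hinj hC ht₀ ht₁ hR δ hδ
  have h2 := hasMonodromy_circleLoop_infty hρ01 hC hR
  -- Going out along `δ` contributes `P̃`, the large circle `M_∞`, and the way back `P̃⁻¹`.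
  exact ⟨h1, hasMonodromy_circleLoop_zero hρ01 hn hC ht₀ ht₁, h2, (h1.trans h2).trans (h1.symm hP),
    hasMonodromy_circleLoop_conifold hρ01 hn hinj hC ht₀ ht₁⟩
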